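/- Let $(D_i)_{i\ge 1}$ be real random variables on a probability space $(\Omega,\mathcal F,\mathbb P)$ that form a martingale difference sequence for the natural filtration $\mathcal F_k=\sigma(D_j,\,1\le j\le k)$ ($\mathcal F_0$ trivial): each $D_i$ is integrable and $\mathbb E(D_i\mid\mathcal F_{i-1})=0$ a.s. for $i\ge1$. Let $(\gamma_{ij})_{(i,j)\in\mathbb Z^2}$ be a family of real random variables that is independent of $(D_i)_{i\ge1}$ (a family defined only for $1\le j\le i$, or only for $i,j\ge 1$, is extended by $0$). For $1\le j\le i$ put $$X_{ij}=\gamma_{ij}D_{u(i,j)},\qquad u(i,j)=\frac{(i-1)i}{2}+j .$$ Let $(Y_{ij})_{1\le j\le i}$ be independent centered real Gaussian random variables on the same probability space, independent of $(X_{ij})_{1\le j\le i}$, with $\mathbb E(Y_{ij}^2)=\mathbb E(X_{ij}^2)$ (equal to $0$ a.s. if this variance vanishes). Let $\mathbf X_n$ be the symmetric $n\times n$ matrix with entries $X_{ij}$ for $1\le j\le i\le n$, let $\mathbb X_n=n^{-1/2}\mathbf X_n$, define $\mathbb Y_n$ in the same way from the $Y_{ij}$, and for $z\in\mathbb C$ with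 $\operatorname{Im}z>0$ let $$S^{\mathbb X_n}(z)=\frac1n\operatorname{Tr}\big[(\mathbb X_n-z\mathbf I_n)^{-1}\big],\qquad S^{\mathbb Y_n}(z)=\frac1n\operatorname{Tr}\big[(\mathbb Y_n-z\mathbf I_n)^{-1}\big]$$ be the Stieltjes transforms of the empirical spectral distributions of these matrices. For integers $a\ge0$ let $$B_{ij}^a=\{(u,v)\in\mathbb Z^2:\ \max(|u-i|,|v-j|)\ge a,\ \text{ and } u<i \text{ or } (u=i \text{ and } v\le j)\},\qquad \Gamma_{ij}^a=\sigma(\gamma_{uv}:(u,v)\in B_{ij}^a).$$ Assume that for some $\delta>0$ we have $\sup_{i\ge1}\mathbb E|D_i|^{2+\delta}<\infty$, that there is a constant $c$ such that a.s. $|\gamma_{ij}|\le c$ for all $1\le j\le i$, and that $$\lim_{a\to\infty}\limsup_{n\to\infty}\frac1n\sum_{a\le i\le n}\big|\mathbb E(D_i^2\mid\mathcal F_{i-a})-\mathbb E(D_i^2)\big|=0\quad\text{a.s.},$$ $$\lim_{a\to\infty}\limsup_{n\to\infty}\frac1{n^2}\sum_{1\le j\le i\le n}\big|\mathbb E(\gamma_{ij}^2\mid\Gamma_{ij}^a)-\mathbb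 E(\gamma_{ij}^2)\big|=0\quad\text{a.s.}$$ Then for every $z\in\mathbb C$ with $\operatorname{Im}z>0$, $$S^{\mathbb X_n}(z)-S^{\mathbb Y_n}(z)\to0\quad\text{almost surely as } n\to\infty .$$ -/

import Mathlib

open MeasureTheory ProbabilityTheory Filter Topology

noncomputable section

namespace MartingaleMatrix

variable {Ω : Type*}

/-- The index set `{(i, j) : 1 ≤ j ≤ i}` of the lower half (with diagonal) of an infinite matrix. -/
abbrev LowerIndex : Type := {p : ℕ × ℕ // 1 ≤ p.2 ∧ p.2 ≤ p.1}

/-- The natural filtration `𝓕_k = σ(D_j, 1 ≤ j ≤ k)`; it is trivial for `k = 0`. -/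
@[reducible] def naturalSigma (D : ℕ → Ω → ℝ) (k : ℕ) : MeasurableSpace Ω :=
  ⨆ j ∈ Set.Icc 1 k, MeasurableSpace.comap (D j) inferInstance

/-- `(D_i)_{i ≥ 1}` is a sequence of martingale differences for its natural filtration:
`D_i` is integrable and `𝔼(D_i | 𝓕_{i-1}) = 0` a.s. for all `i ≥ 1`. -/
def IsMartingaleDifference [MeasurableSpace Ω] (P : Measure Ω) (D : ℕ → Ω → ℝ) : Prop :=
  ∀ i, 1 ≤ i → Integrable (D i) P ∧ P[D i | naturalSigma D (i - 1)] =ᵐ[P] 0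

/-- `B_{ij}^a`: the index pairs `(u, v) ∈ ℤ²` that are at most `(i, j)` in the lexicographic order
(`u < i`, or `u = i` and `v ≤ j`) and at sup-distance at least `a` from `(i, j)`. -/
def lexPast (a : ℕ) (i j : ℤ) : Set (ℤ × ℤ) :=
  {p | (a : ℤ) ≤ max |p.1 - i| |p.2 - j| ∧ toLex p ≤ toLex (i, j)}

/-- `Γ_{ij}^a = σ(γ_{uv} : (u, v) ∈ B_{ij}^a)`. -/
@[reducible] def fieldSigma (γ : ℤ × ℤ → Ω → ℝ) (a : ℕ) (i j : ℤ) : MeasurableSpace Ω :=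
  ⨆ p ∈ lexPast a i j, MeasurableSpace.comap (γ p) inferInstance

/-- `u(i, j) = (i - 1) i / 2 + j`, the position of `(i, j)` when the lower half of the matrix
is read row by row. -/
def position (i j : ℕ) : ℕ := (i - 1) * i / 2 + j

/-- The entry `X_{ij} = γ_{ij} D_{u(i,j)}`, used for `1 ≤ j ≤ i`. -/
def entry (γ : ℤ × ℤ → Ω → ℝ) (D : ℕ → Ω → ℝ) (i j : ℕ) (ω : Ω) : ℝ :=
  γ ((i : ℤ), (j : ℤ)) ω * D (position i j) ω

/-- The symmetric `n × n` matrix whose `(i, j)` entry, for `1 ≤ j ≤ i ≤ n`, is `x i j`. The rows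
and columns are numbered `0, …, n - 1` by `Fin n`, hence the shift by one. -/
def symmetricMatrix (x : ℕ → ℕ → ℝ) (n : ℕ) : Matrix (Fin n) (Fin n) ℝ :=
  Matrix.of fun i j =>
    if j ≤ i then x ((i : ℕ) + 1) ((j : ℕ) + 1) else x ((j : ℕ) + 1) ((i : ℕ) + 1)

/-- The Stieltjes transform at `z` of the empirical spectral distribution of `n^{-1/2} A`, that is,
`n⁻¹ Tr (n^{-1/2} A - z I)⁻¹`. -/
def stieltjes {n : ℕ} (A : Matrix (Fin n) (Fin n) ℝ) (z : ℂ) : ℂ :=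
  (1 / (n : ℂ)) *
    Matrix.trace ((((1 / √(n : ℝ)) • A).map (fun t : ℝ => (t : ℂ)) - z • 1)⁻¹)

end MartingaleMatrix

end

noncomputable section

namespace MartingaleMatrix

section Resolvent

open scoped Matrix.Norms.L2Operator

variable {n : ℕ}

/-- The resolvent `(A - z)⁻¹` of a complex matrix. -/
def green (A : Matrix (Fin n) (Fin n) ℂ) (z : ℂ) : Matrix (Fin n) (Fin n) ℂ :=
  (A - z • 1)⁻¹

theorem isUnit_sub_smul_one {A : Matrix (Fin n) (Fin n) ℂ} (hA : IsSelfAdjoint A) {z : ℂ}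
    (hz : 0 < z.im) : IsUnit (A - z • 1) := by
  have h : z ∉ spectrum ℂ A := fun h => hz.ne' (hA.im_eq_zero_of_mem_spectrum h)
  rw [spectrum.notMem_iff, Algebra.algebraMap_eq_smul_one] at h
  rw [← neg_sub]
  exact h.neg

theorem norm_green_le {A : Matrix (Fin n) (Fin n) ℂ} (hA : IsSelfAdjoint A) {z : ℂ}
    (hz : 0 < z.im) : ‖green A z‖ ≤ z.im⁻¹ := by
  have hn : IsStarNormal A := hA.isStarNormal
  have hlow : ∀ x ∈ spectrum ℂ A, z.im ≤ ‖x - z‖ := by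
    intro x hx
    have h1 := hA.im_eq_zero_of_mem_spectrum hx
    have h2 := Complex.abs_im_le_norm (x - z)
    rw [Complex.sub_im, h1, zero_sub, abs_neg, abs_of_pos hz] at h2
    exact h2
  have h1 : cfc (fun x : ℂ => x - z) A = A - z • 1 := by
    rw [cfc_sub (fun x : ℂ => x) (fun _ => z) A, cfc_id' ℂ A, cfc_const z A,
      Algebra.algebraMap_eq_smul_one]
  have h2 : green A z = cfc (fun x : ℂ => (x - z)⁻¹) A := by
    rw [cfc_inv (fun x : ℂ => x - z) A (fun x hx h0 => ?_), h1, green,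
      Matrix.nonsing_inv_eq_ringInverse]
    have := hlow x hx
    rw [h0, norm_zero] at this
    linarith
  rw [h2]
  refine norm_cfc_le (by positivity) fun x hx => ?_
  rw [norm_inv]
  exact inv_anti₀ hz (hlow x hx)

theorem green_sub_green {A B : Matrix (Fin n) (Fin n) ℂ} (hA : IsSelfAdjoint A)
    (hB : IsSelfAdjoint B) {z : ℂ} (hz : 0 < z.im) :
    green A z - green B z = green A z * (B - A) * green B z := by
  have h1 : green A z * (A - z • 1) = 1 :=
    Matrix.nonsing_inv_mul _ ((Matrix.isUnit_iff_isUnit_det _).1 (isUnit_sub_smul_one hA hz))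
  have h2 : (B - z • 1) * green B z = 1 :=
    Matrix.mul_nonsing_inv _ ((Matrix.isUnit_iff_isUnit_det _).1 (isUnit_sub_smul_one hB hz))
  calc green A z - green B z
      = green A z * ((B - z • 1) * green B z) - (green A z * (A - z • 1)) * green B z := by
        rw [h1, h2, mul_one, one_mul]
    _ = _ := by noncomm_ring

theorem norm_apply_le_norm (M : Matrix (Fin n) (Fin n) ℂ) (i j : Fin n) : ‖M i j‖ ≤ ‖M‖ := by
  have h := M.l2_opNorm_mulVec (EuclideanSpace.single j 1)
  rw [PiLp.norm_single, norm_one, mul_one] at h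
  refine le_trans ?_ h
  refine le_trans (le_of_eq ?_) (PiLp.norm_apply_le _ i)
  simp

theorem sum_norm_sq_column_le (M : Matrix (Fin n) (Fin n) ℂ) (j : Fin n) :
    ∑ i, ‖M i j‖ ^ 2 ≤ ‖M‖ ^ 2 := by
  have h := M.l2_opNorm_mulVec (EuclideanSpace.single j 1)
  rw [PiLp.norm_single, norm_one, mul_one] at h
  have h2 := pow_le_pow_left₀ (norm_nonneg _) h 2
  rw [EuclideanSpace.norm_sq_eq] at h2
  simpa using h2

theorem norm_trace_mul_le (M E : Matrix (Fin n) (Fin n) ℂ) :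
    ‖Matrix.trace (M * E)‖ ≤ √n * ‖M‖ * √(∑ i, ∑ j, ‖E i j‖ ^ 2) := by
  have h1 : ‖Matrix.trace (M * E)‖ ≤ ∑ p : Fin n × Fin n, ‖M p.2 p.1‖ * ‖E p.1 p.2‖ := by
    rw [Matrix.trace, Fintype.sum_prod_type, Finset.sum_comm]
    refine (norm_sum_le _ _).trans (Finset.sum_le_sum fun i _ => ?_)
    rw [Matrix.diag_apply, Matrix.mul_apply]
    refine (norm_sum_le _ _).trans (Finset.sum_le_sum fun j _ => ?_)
    rw [norm_mul]
  refine h1.trans ((Real.sum_mul_le_sqrt_mul_sqrt _ _ _).trans ?_)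
  rw [← Fintype.sum_prod_type' (f := fun i j => ‖E i j‖ ^ 2)]
  refine mul_le_mul_of_nonneg_right ?_ (Real.sqrt_nonneg _)
  rw [Real.sqrt_le_left (by positivity), Fintype.sum_prod_type, mul_pow,
    Real.sq_sqrt (Nat.cast_nonneg n)]
  calc ∑ i, ∑ j, ‖M j i‖ ^ 2 ≤ ∑ _i : Fin n, ‖M‖ ^ 2 :=
        Finset.sum_le_sum fun i _ => sum_norm_sq_column_le M i
    _ = n * ‖M‖ ^ 2 := by simp

end Resolvent

end MartingaleMatrix

namespace MartingaleMatrix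

section Position

/-- The number of positions before row `i`. -/
def rowStart (i : ℕ) : ℕ := (i - 1) * i / 2

theorem position_eq (i j : ℕ) : position i j = rowStart i + j := rfl

theorem rowStart_succ (i : ℕ) : rowStart (i + 1) = rowStart i + i := by
  unfold rowStart
  rcases i with _ | i
  · rfl
  · have : (i + 1 + 1 - 1) * (i + 1 + 1) = (i + 1 - 1) * (i + 1) + (i + 1) * 2 := by
      simp only [Nat.add_sub_cancel]; ring
    rw [this, Nat.add_mul_div_right _ _ two_pos]

theorem rowStart_mono : Monotone rowStart :=
  monotone_nat_of_le_succ fun i => by rw [rowStart_succ]; omega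

theorem position_lt_position {i j i' j' : ℕ} (hj : j ≤ i) (hj' : 1 ≤ j') (h : i < i') :
    position i j < position i' j' := by
  have h1 := rowStart_mono (Nat.succ_le_of_lt h)
  rw [Nat.succ_eq_add_one, rowStart_succ] at h1
  rw [position_eq, position_eq]
  omega

theorem position_inj {i j i' j' : ℕ} (hj1 : 1 ≤ j) (hj : j ≤ i) (hj1' : 1 ≤ j') (hj' : j' ≤ i')
    (h : position i j = position i' j') : i = i' ∧ j = j' := by
  rcases lt_trichotomy i i' with hlt | rfl | hlt
  · exact absurd h (position_lt_position hj hj1' hlt).ne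
  · rw [position_eq, position_eq] at h
    omega
  · exact absurd h (position_lt_position hj' hj1 hlt).ne'

theorem rowStart_succ_le_sq (n : ℕ) : rowStart (n + 1) ≤ n ^ 2 := by
  induction n with
  | zero => simp [rowStart]
  | succ n ih => rw [rowStart_succ]; nlinarith

/-- Summation over the lower half of a matrix is summation over the positions. -/
theorem sum_position {M : Type*} [AddCommMonoid M] (F : ℕ → M) (n : ℕ) :
    ∑ i ∈ Finset.Icc 1 n, ∑ j ∈ Finset.Icc 1 i, F (position i j)
      = ∑ k ∈ Finset.Icc 1 (rowStart (n + 1)), F k := by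
  induction n with
  | zero => simp [rowStart]
  | succ n ih =>
    rw [Finset.sum_Icc_succ_top (by omega), ih, rowStart_succ (n + 1)]
    have h : ∀ m k, ∑ k ∈ Finset.Icc 1 (m + k), F k
        = ∑ k ∈ Finset.Icc 1 m, F k + ∑ j ∈ Finset.Icc 1 k, F (m + j) := by
      intro m k
      induction k with
      | zero => simp
      | succ k ihk =>
        rw [← add_assoc, Finset.sum_Icc_succ_top (by omega), ihk,
          Finset.sum_Icc_succ_top (by omega), add_assoc, add_assoc]
    rw [h]
    rfl

theorem exists_position (k : ℕ) (hk : 1 ≤ k) : ∃ i j, 1 ≤ j ∧ j ≤ i ∧ position i j = k := by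
  have hex : ∃ i, k ≤ rowStart (i + 1) := by
    refine ⟨k, ?_⟩
    have : ∀ k, k ≤ rowStart (k + 1) := by
      intro k
      rw [rowStart_succ]; omega
    exact this k
  classical
  set i := Nat.find hex with hi
  have h1 : k ≤ rowStart (i + 1) := Nat.find_spec hex
  have h0 : rowStart i < k := by
    rcases Nat.eq_zero_or_pos i with h | h
    · rw [h]; simpa [rowStart] using Nat.lt_of_succ_le hk
    · have := Nat.find_min hex (m := i - 1) (by omega)
      rw [Nat.sub_add_cancel h] at this
      omega
  rw [rowStart_succ] at h1
  exact ⟨i, k - rowStart i, by omega, by omega, by rw [position_eq]; omega⟩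

/-- The position of the entry `(i, j)` of the symmetric matrix of size `n`. -/
def entryIndex {n : ℕ} (i j : Fin n) : ℕ :=
  if j ≤ i then position ((i : ℕ) + 1) ((j : ℕ) + 1) else position ((j : ℕ) + 1) ((i : ℕ) + 1)

theorem entryIndex_comm {n : ℕ} (i j : Fin n) : entryIndex i j = entryIndex j i := by
  unfold entryIndex
  rcases lt_trichotomy i j with h | rfl | h
  · rw [if_neg h.not_ge, if_pos h.le]
  · rfl
  · rw [if_neg h.not_ge, if_pos h.le]

theorem entryIndex_inj {n : ℕ} {i j i' j' : Fin n} (h : entryIndex i j = entryIndex i' j') :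
    (i, j) = (i', j') ∨ (i, j) = (j', i') := by
  unfold entryIndex at h
  simp only [Prod.mk.injEq, Fin.ext_iff]
  split_ifs at h with h1 h2 h2 <;> simp only [Fin.le_def] at h1 h2 <;>
    have := position_inj (by omega) (by omega) (by omega) (by omega) h <;> omega

theorem entryIndex_mem {n : ℕ} (i j : Fin n) :
    entryIndex i j ∈ Finset.Icc 1 (rowStart (n + 1)) := by
  have key : ∀ i j : ℕ, i < n → j ≤ i →
      position (i + 1) (j + 1) ∈ Finset.Icc 1 (rowStart (n + 1)) := by
    intro i j hi hj
    have h1 := rowStart_mono (show i + 1 + 1 ≤ n + 1 by omega)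
    rw [rowStart_succ (i + 1)] at h1
    rw [Finset.mem_Icc, position_eq]
    omega
  unfold entryIndex
  split_ifs with h
  · exact key _ _ i.2 h
  · exact key _ _ j.2 (not_le.1 h).le

theorem card_entryIndex_le {n : ℕ} (k : ℕ) :
    (Finset.univ.filter fun p : Fin n × Fin n => entryIndex p.1 p.2 = k).card ≤ 2 := by
  rcases (Finset.univ.filter fun p : Fin n × Fin n => entryIndex p.1 p.2 = k).eq_empty_or_nonempty
    with h | ⟨⟨i, j⟩, hp⟩
  · simp [h]
  · refine (Finset.card_le_card (t := {(i, j), (j, i)}) fun q hq => ?_).trans Finset.card_le_two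
    simp only [Finset.mem_filter, Finset.mem_univ, true_and] at hp hq
    rcases entryIndex_inj (hq.trans hp.symm) with h | h <;> simp_all

end Position

section SequenceMatrix

open scoped Matrix.Norms.L2Operator

variable {n : ℕ}

/-- The normalized symmetric matrix with entries read from a sequence, row by row. -/
def seqMatrix (n : ℕ) (x : ℕ → ℝ) : Matrix (Fin n) (Fin n) ℂ :=
  ((1 / √(n : ℝ)) • symmetricMatrix (fun i j => x (position i j)) n).map (fun t : ℝ => (t : ℂ))

theorem stieltjes_eq (x : ℕ → ℝ) (z : ℂ) :
    stieltjes (symmetricMatrix (fun i j => x (position i j)) n) z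
      = (1 / (n : ℂ)) * Matrix.trace (green (seqMatrix n x) z) := rfl

theorem seqMatrix_apply (x : ℕ → ℝ) (i j : Fin n) :
    seqMatrix n x i j = ((x (entryIndex i j) / √(n : ℝ) : ℝ) : ℂ) := by
  have : symmetricMatrix (fun i j => x (position i j)) n i j = x (entryIndex i j) := by
    unfold symmetricMatrix entryIndex
    rw [Matrix.of_apply]
    split_ifs <;> rfl
  rw [seqMatrix, Matrix.map_apply, Matrix.smul_apply, this, smul_eq_mul]
  congr 1
  ring

theorem isSelfAdjoint_seqMatrix (x : ℕ → ℝ) : IsSelfAdjoint (seqMatrix n x) := by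
  ext i j
  rw [Matrix.star_apply, seqMatrix_apply, seqMatrix_apply, entryIndex_comm]
  simp

/-- The symmetric matrix with entry one at position `k` and zero elsewhere. -/
def unitMatrix (n k : ℕ) : Matrix (Fin n) (Fin n) ℂ :=
  Matrix.of fun i j => if entryIndex i j = k then 1 else 0

theorem isSelfAdjoint_unitMatrix (k : ℕ) : IsSelfAdjoint (unitMatrix n k) := by
  ext i j
  rw [Matrix.star_apply]
  simp only [unitMatrix, Matrix.of_apply, entryIndex_comm j i]
  split_ifs <;> simp

theorem unitMatrix_eq_sum (k : ℕ) : unitMatrix n k =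
    ∑ p ∈ Finset.univ.filter fun p : Fin n × Fin n => entryIndex p.1 p.2 = k,
      Matrix.single p.1 p.2 (1 : ℂ) := by
  ext i j
  rw [Matrix.sum_apply]
  simp only [unitMatrix, Matrix.of_apply, Matrix.single_apply, Finset.sum_filter]
  rw [Fintype.sum_eq_single (i, j)]
  · simp
  · rintro ⟨i', j'⟩ hne
    split_ifs with h1 h2
    · exact absurd (Prod.ext h2.1 h2.2) hne
    · rfl
    · rfl

theorem norm_single_le (i j : Fin n) : ‖Matrix.single i j (1 : ℂ)‖ ≤ 1 := by
  have h := Matrix.l2_opNorm_conjTranspose_mul_self (Matrix.single i j (1 : ℂ))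
  rw [Matrix.conjTranspose_single, Matrix.single_mul_single_same, star_one, mul_one,
    ← Matrix.diagonal_single, Matrix.l2_opNorm_diagonal, Pi.norm_single, norm_one] at h
  nlinarith [norm_nonneg (Matrix.single i j (1 : ℂ))]

theorem norm_unitMatrix_le (k : ℕ) : ‖unitMatrix n k‖ ≤ 2 := by
  rw [unitMatrix_eq_sum]
  refine (norm_sum_le_of_le _ (fun p _ => norm_single_le p.1 p.2)).trans ?_
  rw [Finset.sum_const, nsmul_eq_mul, mul_one]
  exact_mod_cast card_entryIndex_le k

theorem norm_trace_mul_unitMatrix_le (M : Matrix (Fin n) (Fin n) ℂ) (k : ℕ) :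
    ‖Matrix.trace (M * unitMatrix n k)‖ ≤ 2 * ‖M‖ := by
  rw [unitMatrix_eq_sum, Finset.mul_sum, Matrix.trace_sum]
  refine (norm_sum_le_of_le (n := fun _ => ‖M‖) _ (fun p _ => ?_)).trans ?_
  · rw [Matrix.trace_mul_single]
    simpa using norm_apply_le_norm M p.2 p.1
  · rw [Finset.sum_const, nsmul_eq_mul]
    exact mul_le_mul_of_nonneg_right (by exact_mod_cast card_entryIndex_le k) (norm_nonneg _)

theorem seqMatrix_eq_add_sum (s : Finset ℕ) (x y : ℕ → ℝ) (h : ∀ l ∉ s, x l = y l) :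
    seqMatrix n x = seqMatrix n y
      + ∑ l ∈ s, (((x l - y l) / √(n : ℝ) : ℝ) : ℂ) • unitMatrix n l := by
  ext i j
  rw [Matrix.add_apply, Matrix.sum_apply, seqMatrix_apply, seqMatrix_apply]
  simp only [Matrix.smul_apply, unitMatrix, Matrix.of_apply, smul_eq_mul, mul_ite, mul_one,
    mul_zero, Finset.sum_ite_eq]
  split_ifs with hs
  · push_cast; ring
  · rw [h _ hs, add_zero]

theorem seqMatrix_congr {x y : ℕ → ℝ} (h : ∀ k ∈ Finset.Icc 1 (rowStart (n + 1)), x k = y k) :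
    seqMatrix n x = seqMatrix n y := by
  ext i j
  rw [seqMatrix_apply, seqMatrix_apply, h _ (entryIndex_mem i j)]

theorem norm_seqMatrix_sub_le (s : Finset ℕ) (x y : ℕ → ℝ) (h : ∀ l ∉ s, x l = y l) :
    ‖seqMatrix n x - seqMatrix n y‖ ≤ 2 * ∑ l ∈ s, |x l - y l| / √(n : ℝ) := by
  rw [seqMatrix_eq_add_sum s x y h, add_sub_cancel_left, Finset.mul_sum]
  refine norm_sum_le_of_le _ fun l _ => ?_
  rw [norm_smul, Complex.norm_real, Real.norm_eq_abs, abs_div, abs_of_nonneg (Real.sqrt_nonneg n),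
    mul_comm]
  exact mul_le_mul_of_nonneg_right (norm_unitMatrix_le l) (by positivity)

theorem seqMatrix_update (x : ℕ → ℝ) (k : ℕ) (hx : x k = 0) (t : ℝ) :
    seqMatrix n (Function.update x k t)
      = seqMatrix n x + ((t / √(n : ℝ) : ℝ) : ℂ) • unitMatrix n k := by
  rw [seqMatrix_eq_add_sum {k} (Function.update x k t) x fun l hl => ?_]
  · simp [hx]
  · rw [Function.update_of_ne (by simpa using hl)]

theorem continuous_seqMatrix : Continuous (seqMatrix n) := by
  refine continuous_matrix fun i j => ?_
  simp only [seqMatrix_apply]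
  fun_prop

theorem continuous_green_seqMatrix {z : ℂ} (hz : 0 < z.im) :
    Continuous fun x => green (seqMatrix n x) z := by
  have h1 : Continuous fun x => seqMatrix n x - z • 1 := continuous_seqMatrix.sub continuous_const
  simp only [green, Matrix.inv_def, Ring.inverse_eq_inv']
  refine Continuous.smul (Continuous.inv₀ h1.matrix_det fun x => ?_) h1.matrix_adjugate
  exact ((Matrix.isUnit_iff_isUnit_det _).1
    (isUnit_sub_smul_one (isSelfAdjoint_seqMatrix x) hz)).ne_zero

end SequenceMatrix

end MartingaleMatrix

namespace MartingaleMatrix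

section Expansion

open scoped Matrix.Norms.L2Operator

variable {n : ℕ}

theorem green_add_smul {A E : Matrix (Fin n) (Fin n) ℂ} (hA : IsSelfAdjoint A)
    (hE : IsSelfAdjoint E) {z : ℂ} (hz : 0 < z.im) (s : ℝ) :
    green (A + (s : ℂ) • E) z
      = green A z - (s : ℂ) • (green A z * E * green (A + (s : ℂ) • E) z) := by
  have hB : IsSelfAdjoint (A + (s : ℂ) • E) :=
    hA.add (IsSelfAdjoint.smul (by simp [isSelfAdjoint_iff]) hE)
  have h := green_sub_green hA hB hz
  rw [add_sub_cancel_left, mul_smul_comm, smul_mul_assoc] at h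
  rw [← h, sub_sub_cancel]

/-- The trace of the fourth-order product occurring in the second derivative. -/
def greenTwo (A E : Matrix (Fin n) (Fin n) ℂ) (z : ℂ) : ℂ :=
  Matrix.trace (green A z * E * green A z * E * green A z)

theorem norm_mul_le_of_le' {a b : Matrix (Fin n) (Fin n) ℂ} {r s : ℝ} (ha : ‖a‖ ≤ r)
    (hb : ‖b‖ ≤ s) : ‖a * b‖ ≤ r * s :=
  (norm_mul_le a b).trans (mul_le_mul ha hb (norm_nonneg _) ((norm_nonneg _).trans ha))

theorem norm_trace_unit_product_le (k : ℕ) {a b c : Matrix (Fin n) (Fin n) ℂ} {r s t : ℝ}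
    (ha : ‖a‖ ≤ r) (hb : ‖b‖ ≤ s) (hc : ‖c‖ ≤ t) :
    ‖Matrix.trace (a * unitMatrix n k * b * unitMatrix n k * c)‖ ≤ 4 * (r * s * t) := by
  rw [Matrix.trace_mul_comm, ← mul_assoc]
  refine (norm_trace_mul_unitMatrix_le _ k).trans ?_
  have := norm_mul_le_of_le' hc (norm_mul_le_of_le' (norm_mul_le_of_le' ha
    (norm_unitMatrix_le k)) hb)
  calc _ ≤ 2 * (t * (r * 2 * s)) := mul_le_mul_of_nonneg_left this zero_le_two
    _ = _ := by ring

theorem resolvent_expansion {R : Type*} [Ring R] [Algebra ℂ R] {G G' E : R} {s : ℂ}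
    (h : G' = G - s • (G * E * G')) :
    G' = G - s • (G * E * G) + s ^ 2 • (G * E * G * E * G') ∧
      G * E * G * E * G' = G * E * G * E * G - s • (G * E * (G * E * G) * E * G') := by
  have h1 : G * E * G' = G * E * G - s • (G * E * G * E * G') := by
    conv_lhs => rw [h]
    simp only [mul_sub, mul_smul_comm, ← mul_assoc]
  constructor
  · conv_lhs => rw [h, h1]
    rw [smul_sub, smul_smul, ← sq]
    abel
  · have := congrArg (fun M => G * E * M) h1
    simpa only [mul_sub, mul_smul_comm, ← mul_assoc] using this

theorem norm_trace_green_one_le {A : Matrix (Fin n) (Fin n) ℂ} (hA : IsSelfAdjoint A) {z : ℂ}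
    (hz : 0 < z.im) (k : ℕ) :
    ‖Matrix.trace (green A z * unitMatrix n k * green A z)‖ ≤ 2 * z.im⁻¹ ^ 2 := by
  rw [Matrix.trace_mul_comm, ← mul_assoc]
  refine (norm_trace_mul_unitMatrix_le _ k).trans ?_
  have h := norm_green_le hA hz
  have := norm_mul_le_of_le' h h
  rw [sq]
  linarith

theorem norm_greenTwo_le {A : Matrix (Fin n) (Fin n) ℂ} (hA : IsSelfAdjoint A) {z : ℂ}
    (hz : 0 < z.im) (k : ℕ) : ‖greenTwo A (unitMatrix n k) z‖ ≤ 4 * z.im⁻¹ ^ 3 := by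
  have h := norm_green_le hA hz
  refine (norm_trace_unit_product_le k h h h).trans (le_of_eq (by ring))

theorem norm_greenTwo_sub_le {A B : Matrix (Fin n) (Fin n) ℂ} (hA : IsSelfAdjoint A)
    (hB : IsSelfAdjoint B) {z : ℂ} (hz : 0 < z.im) (k : ℕ) :
    ‖greenTwo A (unitMatrix n k) z - greenTwo B (unitMatrix n k) z‖
      ≤ 12 * z.im⁻¹ ^ 4 * ‖A - B‖ := by
  have h1 := norm_green_le hA hz
  have h2 := norm_green_le hB hz
  have h3 : ‖green A z - green B z‖ ≤ z.im⁻¹ * ‖A - B‖ * z.im⁻¹ := by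
    rw [green_sub_green hA hB hz]
    refine norm_mul_le_of_le' (norm_mul_le_of_le' h1 ?_) h2
    rw [norm_sub_rev]
  have e : greenTwo A (unitMatrix n k) z - greenTwo B (unitMatrix n k) z
      = Matrix.trace ((green A z - green B z) * unitMatrix n k * green A z * unitMatrix n k
          * green A z)
        + Matrix.trace (green B z * unitMatrix n k * (green A z - green B z) * unitMatrix n k
          * green A z)
        + Matrix.trace (green B z * unitMatrix n k * green B z * unitMatrix n k
          * (green A z - green B z)) := by
    rw [greenTwo, greenTwo, ← Matrix.trace_sub, ← Matrix.trace_add, ← Matrix.trace_add]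
    congr 1
    noncomm_ring
  rw [e]
  refine (norm_add₃_le.trans (add_le_add (add_le_add
    (norm_trace_unit_product_le k h3 h1 h1) (norm_trace_unit_product_le k h2 h3 h1))
    (norm_trace_unit_product_le k h2 h2 h3))).trans (le_of_eq (by ring))

theorem norm_trace_taylor_le {A : Matrix (Fin n) (Fin n) ℂ} (hA : IsSelfAdjoint A) {z : ℂ}
    (hz : 0 < z.im) (k : ℕ) (s : ℝ) :
    ‖Matrix.trace (green (A + (s : ℂ) • unitMatrix n k) z) - Matrix.trace (green A z)
      + (s : ℂ) * Matrix.trace (green A z * unitMatrix n k * green A z)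
      - (s : ℂ) ^ 2 * greenTwo A (unitMatrix n k) z‖
      ≤ 24 * z.im⁻¹ ^ 4 * |s| ^ 3 ∧
    ‖Matrix.trace (green (A + (s : ℂ) • unitMatrix n k) z) - Matrix.trace (green A z)
      + (s : ℂ) * Matrix.trace (green A z * unitMatrix n k * green A z)
      - (s : ℂ) ^ 2 * greenTwo A (unitMatrix n k) z‖
      ≤ 8 * z.im⁻¹ ^ 3 * s ^ 2 := by
  have hE := isSelfAdjoint_unitMatrix (n := n) k
  have hB : IsSelfAdjoint (A + (s : ℂ) • unitMatrix n k) :=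
    hA.add (IsSelfAdjoint.smul (by simp [isSelfAdjoint_iff]) hE)
  have h := green_add_smul hA hE hz s
  have hG := norm_green_le hA hz
  have hG' := norm_green_le hB hz
  have b1 := norm_greenTwo_le hA hz k
  have hU := norm_unitMatrix_le (n := n) k
  have b2 := norm_trace_unit_product_le k hG hG hG'
  have b3 := norm_trace_unit_product_le k hG (norm_mul_le_of_le' (norm_mul_le_of_le' hG hU) hG) hG'
  have hT : greenTwo A (unitMatrix n k) z = Matrix.trace (green A z * unitMatrix n k * green A z
    * unitMatrix n k * green A z) := rfl
  rw [hT] at b1 ⊢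
  generalize green (A + (s : ℂ) • unitMatrix n k) z = G' at *
  generalize green A z = G at *
  generalize unitMatrix n k = E at *
  have e2 : Matrix.trace G' - Matrix.trace G + (s : ℂ) * Matrix.trace (G * E * G)
      - (s : ℂ) ^ 2 * Matrix.trace (G * E * G * E * G)
      = (s : ℂ) ^ 2 * (Matrix.trace (G * E * G * E * G') - Matrix.trace (G * E * G * E * G)) := by
    have h3 := congrArg Matrix.trace (resolvent_expansion h).1
    simp only [Matrix.trace_add, Matrix.trace_sub, Matrix.trace_smul, smul_eq_mul] at h3
    rw [mul_sub]
    linear_combination h3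
  rw [e2, norm_mul, norm_pow, Complex.norm_real, Real.norm_eq_abs, sq_abs]
  constructor
  · have h4 : Matrix.trace (G * E * G * E * G') - Matrix.trace (G * E * G * E * G)
        = - ((s : ℂ) * Matrix.trace (G * E * (G * E * G) * E * G')) := by
      have h6 := congrArg Matrix.trace (resolvent_expansion h).2
      simp only [Matrix.trace_sub, Matrix.trace_smul, smul_eq_mul] at h6
      rw [h6]
      ring
    rw [h4, norm_neg, norm_mul, Complex.norm_real, Real.norm_eq_abs]
    calc s ^ 2 * (|s| * _) ≤ s ^ 2 * (|s| * (4 * (z.im⁻¹ * (z.im⁻¹ * 2 * z.im⁻¹) * z.im⁻¹))) := by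
          gcongr
      _ = 8 * z.im⁻¹ ^ 4 * |s| ^ 3 := by rw [← sq_abs]; ring
      _ ≤ _ := by gcongr; norm_num
  · calc s ^ 2 * _ ≤ s ^ 2 * (4 * (z.im⁻¹ * z.im⁻¹ * z.im⁻¹) + 4 * z.im⁻¹ ^ 3) := by
          gcongr
          exact (norm_sub_le _ _).trans (add_le_add b2 b1)
      _ = _ := by ring

/-- `f` is a bounded function of the entries of the `n × n` matrix, with first and second
derivatives `g`, `2 h` in the single entries, that behaves like a Stieltjes transform. -/
structure SmoothTest (n : ℕ) (δ K : ℝ) (f : (ℕ → ℝ) → ℝ) (g h : ℕ → (ℕ → ℝ) → ℝ) : Prop where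
  continuous_f : Continuous f
  continuous_g : ∀ k, Continuous (g k)
  continuous_h : ∀ k, Continuous (h k)
  abs_f_le : ∀ x, |f x| ≤ K
  f_congr : ∀ x y, (∀ k ∈ Finset.Icc 1 (rowStart (n + 1)), x k = y k) → f x = f y
  abs_g_le : ∀ k x, |g k x| ≤ K / (n * √n)
  abs_h_le : ∀ k x, |h k x| ≤ K / n ^ 2
  taylor : ∀ k x t, x k = 0 →
    |f (Function.update x k t) - f x - t * g k x - t ^ 2 * h k x|
      ≤ K / n * (|t| / √n) ^ (2 + δ)
  h_sub : ∀ k (s : Finset ℕ) x y, (∀ l ∉ s, x l = y l) →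
    |h k x - h k y| ≤ K / n ^ 2 * ∑ l ∈ s, (|x l - y l| / √n) ^ δ

theorem min_sq_cube_le_rpow {δ s a b : ℝ} (hδ : 0 < δ) (hδ1 : δ ≤ 1) (hs : 0 ≤ s) (ha : 0 ≤ a)
    (hb : 0 ≤ b) {r : ℝ} (h3 : r ≤ a * s ^ 3) (h2 : r ≤ b * s ^ 2) :
    r ≤ (a + b) * s ^ (2 + δ) := by
  have hnn : 0 ≤ s ^ (2 + δ) := Real.rpow_nonneg hs _
  rcases le_total s 1 with h | h
  · rcases hs.eq_or_lt with rfl | hs0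
    · simp at h2
      exact h2.trans (by positivity)
    · have : s ^ 3 ≤ s ^ (2 + δ) := by
        rw [← Real.rpow_natCast s 3]
        exact Real.rpow_le_rpow_of_exponent_ge hs0 h (by norm_num; linarith)
      nlinarith
  · have : s ^ 2 ≤ s ^ (2 + δ) := by
      rw [← Real.rpow_natCast s 2]
      exact Real.rpow_le_rpow_of_exponent_le h (by norm_num; linarith)
    nlinarith

theorem min_one_le_sum_rpow {ι : Type*} {δ a b r : ℝ} (hδ1 : δ ≤ 1) (hδ : 0 < δ)
    (ha : 0 ≤ a) (hb : 0 ≤ b) (s : Finset ι) (u : ι → ℝ) (hu : ∀ i, 0 ≤ u i)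
    (h1 : r ≤ a * ∑ i ∈ s, u i) (h2 : r ≤ b) : r ≤ (a + b) * ∑ i ∈ s, u i ^ δ := by
  have hnn : ∀ i, 0 ≤ u i ^ δ := fun i => Real.rpow_nonneg (hu i) _
  by_cases h : ∃ i ∈ s, 1 ≤ u i
  · obtain ⟨i, hi, hi1⟩ := h
    have h3 : 1 ≤ ∑ i ∈ s, u i ^ δ :=
      (Real.one_le_rpow hi1 hδ.le).trans (Finset.single_le_sum (fun i _ => hnn i) hi)
    nlinarith
  · push Not at h
    have h3 : ∑ i ∈ s, u i ≤ ∑ i ∈ s, u i ^ δ := by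
      refine Finset.sum_le_sum fun i hi => ?_
      rcases (hu i).eq_or_lt with h0 | h0
      · rw [← h0, Real.zero_rpow hδ.ne']
      · conv_lhs => rw [← Real.rpow_one (u i)]
        exact Real.rpow_le_rpow_of_exponent_ge h0 (h i hi).le hδ1
    have h4 : 0 ≤ ∑ i ∈ s, u i ^ δ := Finset.sum_nonneg fun i _ => hnn i
    nlinarith

/-- Real-linear images of the Stieltjes transform. -/
def stieltjesPart (l : ℂ →L[ℝ] ℝ) (n : ℕ) (z : ℂ) (x : ℕ → ℝ) : ℝ :=
  l (stieltjes (symmetricMatrix (fun i j => x (position i j)) n) z)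

theorem norm_trace_green_le {A : Matrix (Fin n) (Fin n) ℂ} (hA : IsSelfAdjoint A) {z : ℂ}
    (hz : 0 < z.im) : ‖Matrix.trace (green A z)‖ ≤ n * z.im⁻¹ := by
  refine (norm_sum_le_of_le _ fun i _ =>
    (norm_apply_le_norm (green A z) i i).trans (norm_green_le hA hz)).trans (le_of_eq ?_)
  simp

theorem exists_smoothTest (l : ℂ →L[ℝ] ℝ) (hl : ∀ w, |l w| ≤ ‖w‖) {z : ℂ} (hz : 0 < z.im)
    {δ : ℝ} (hδ : 0 < δ) (hδ1 : δ ≤ 1) :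
    ∃ K : ℝ, 0 < K ∧ ∀ n : ℕ, 0 < n → ∃ g h, SmoothTest n δ K (stieltjesPart l n z) g h := by
  set η := z.im⁻¹ with hη
  have hη0 : 0 < η := by positivity
  refine ⟨1 + η + 2 * η ^ 2 + 8 * η ^ 3 + (24 * η ^ 4 + 8 * η ^ 3)
    + (24 * η ^ 4 + 8 * η ^ 3), by positivity, fun n hn => ?_⟩
  have hn' : (0 : ℝ) < n := by exact_mod_cast hn
  have hsq : (0 : ℝ) < √n := Real.sqrt_pos.2 hn'
  have hss : √(n : ℝ) * √n = n := Real.mul_self_sqrt hn'.le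
  have hinv : ∀ x, IsSelfAdjoint (seqMatrix n x) := fun x => isSelfAdjoint_seqMatrix x
  have hreal : ∀ (r : ℝ) (w : ℂ), l ((r : ℂ) * w) = r * l w := fun r w => by
    rw [← Complex.real_smul, map_smul, smul_eq_mul]
  have hf : ∀ x, stieltjesPart l n z x = 1 / n * l (Matrix.trace (green (seqMatrix n x) z)) := by
    intro x
    rw [stieltjesPart, stieltjes_eq, ← hreal]
    norm_num
  refine ⟨fun k x => - (1 / (n * √n)) * l (Matrix.trace (green (seqMatrix n x) z
      * unitMatrix n k * green (seqMatrix n x) z)),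
    fun k x => 1 / n ^ 2 * l (greenTwo (seqMatrix n x) (unitMatrix n k) z), ?_⟩
  have hc := continuous_green_seqMatrix (n := n) hz
  refine ⟨?_, fun k => ?_, fun k => ?_, fun x => ?_, fun x y hxy => ?_, fun k x => ?_,
    fun k x => ?_, fun k x t hx => ?_, fun k s x y hxy => ?_⟩
  · simp only [funext hf]
    exact continuous_const.mul (l.continuous.comp hc.matrix_trace)
  · exact continuous_const.mul (l.continuous.comp
      ((hc.matrix_mul continuous_const).matrix_mul hc).matrix_trace)
  · exact continuous_const.mul (l.continuous.comp
      ((((hc.matrix_mul continuous_const).matrix_mul hc).matrix_mul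
        continuous_const).matrix_mul hc).matrix_trace)
  · rw [hf, abs_mul, abs_of_pos (by positivity)]
    have := (hl _).trans (norm_trace_green_le (hinv x) hz)
    calc 1 / (n : ℝ) * _ ≤ 1 / n * (n * η) := by gcongr
      _ = η := by field_simp
      _ ≤ _ := by nlinarith [pow_pos hη0 2, pow_pos hη0 3, pow_pos hη0 4]
  · rw [hf, hf, seqMatrix_congr hxy]
  · have := (hl _).trans (norm_trace_green_one_le (hinv x) hz k)
    rw [abs_mul, abs_neg, abs_of_pos (show 0 < 1 / ((n : ℝ) * √n) by positivity), div_mul_eq_mul_div,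
      one_mul]
    gcongr
    refine this.trans ?_
    nlinarith [pow_pos hη0 2, pow_pos hη0 3, pow_pos hη0 4]
  · have := (hl _).trans (norm_greenTwo_le (hinv x) hz k)
    rw [abs_mul, abs_of_pos (show 0 < 1 / (n : ℝ) ^ 2 by positivity), div_mul_eq_mul_div,
      one_mul]
    gcongr
    refine this.trans ?_
    nlinarith [pow_pos hη0 2, pow_pos hη0 3, pow_pos hη0 4]
  · rw [hf, hf, seqMatrix_update x k hx t]
    obtain ⟨h3, h2⟩ := norm_trace_taylor_le (hinv x) hz k (t / √n)
    set T := Matrix.trace (green (seqMatrix n x + ((t / √n : ℝ) : ℂ) • unitMatrix n k) z)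
    set T0 := Matrix.trace (green (seqMatrix n x) z)
    set T1 := Matrix.trace (green (seqMatrix n x) z * unitMatrix n k * green (seqMatrix n x) z)
    set T2 := greenTwo (seqMatrix n x) (unitMatrix n k) z
    have e : 1 / (n : ℝ) * l T - 1 / n * l T0 - t * (- (1 / (n * √n)) * l T1)
        - t ^ 2 * (1 / n ^ 2 * l T2)
        = 1 / n * l (T - T0 + ((t / √n : ℝ) : ℂ) * T1 - ((t / √n : ℝ) : ℂ) ^ 2 * T2) := by
      rw [map_sub, map_add, map_sub, hreal, ← Complex.ofReal_pow, hreal, div_pow,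
        Real.sq_sqrt hn'.le]
      field_simp
      ring
    rw [e, abs_mul, abs_of_pos (show 0 < 1 / (n : ℝ) by positivity), div_mul_eq_mul_div, one_mul,
      div_mul_eq_mul_div]
    gcongr
    have habs : |t / √n| = |t| / √n := by rw [abs_div, abs_of_pos hsq]
    rw [habs] at h3
    rw [← sq_abs (t / √(n : ℝ)), habs] at h2
    refine (min_sq_cube_le_rpow hδ hδ1 (by positivity) (by positivity) (by positivity)
      ((hl _).trans h3) ((hl _).trans h2)).trans ?_
    refine mul_le_mul_of_nonneg_right ?_ (by positivity)
    nlinarith [pow_pos hη0 2, pow_pos hη0 3, pow_pos hη0 4]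
  · rw [← mul_sub, ← map_sub, abs_mul, abs_of_pos (show 0 < 1 / (n : ℝ) ^ 2 by positivity),
      div_mul_eq_mul_div, one_mul, div_mul_eq_mul_div]
    gcongr
    refine (min_one_le_sum_rpow hδ1 hδ (a := 24 * η ^ 4) (b := 8 * η ^ 3) (by positivity)
      (by positivity) s (fun l => |x l - y l| / √n) (fun i => by positivity) ?_ ?_).trans ?_
    · refine (hl _).trans ((norm_greenTwo_sub_le (hinv x) (hinv y) hz k).trans ?_)
      calc 12 * η ^ 4 * _ ≤ 12 * η ^ 4 * (2 * ∑ l ∈ s, |x l - y l| / √(n : ℝ)) := by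
            gcongr
            exact norm_seqMatrix_sub_le s x y hxy
        _ = _ := by ring
    · refine (hl _).trans ((norm_sub_le _ _).trans ((add_le_add (norm_greenTwo_le (hinv x) hz k)
        (norm_greenTwo_le (hinv y) hz k)).trans (le_of_eq (by ring))))
    · refine mul_le_mul_of_nonneg_right ?_ (Finset.sum_nonneg fun i _ => by positivity)
      nlinarith [pow_pos hη0 2, pow_pos hη0 3, pow_pos hη0 4]

end Expansion

end MartingaleMatrix

namespace MartingaleMatrix

section Interpolation

open scoped Matrix.Norms.L2Operator

theorem norm_trace_green_sub_le {n : ℕ} {A B : Matrix (Fin n) (Fin n) ℂ} (hA : IsSelfAdjoint A)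
    (hB : IsSelfAdjoint B) {z : ℂ} (hz : 0 < z.im) :
    ‖Matrix.trace (green A z) - Matrix.trace (green B z)‖
      ≤ z.im⁻¹ ^ 2 * (√n * √(∑ i, ∑ j, ‖A i j - B i j‖ ^ 2)) := by
  rw [← Matrix.trace_sub, green_sub_green hA hB hz, mul_assoc, Matrix.trace_mul_comm, mul_assoc,
    Matrix.trace_mul_comm]
  refine (norm_trace_mul_le _ _).trans ?_
  have h := norm_mul_le_of_le' (norm_green_le hB hz) (norm_green_le hA hz)
  have e : ∑ i, ∑ j, ‖(B - A) i j‖ ^ 2 = ∑ i, ∑ j, ‖A i j - B i j‖ ^ 2 := by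
    simp_rw [Matrix.sub_apply, norm_sub_rev]
  rw [e]
  calc _ ≤ √n * (z.im⁻¹ * z.im⁻¹) * √(∑ i, ∑ j, ‖A i j - B i j‖ ^ 2) := by gcongr
    _ = _ := by ring

/-- Extension of a square matrix by zero. -/
def padMatrix {m : ℕ} (r : ℕ) (A : Matrix (Fin m) (Fin m) ℂ) :
    Matrix (Fin (m + r)) (Fin (m + r)) ℂ :=
  (Matrix.fromBlocks A 0 0 (0 : Matrix (Fin r) (Fin r) ℂ)).submatrix finSumFinEquiv.symm
    finSumFinEquiv.symm

theorem isSelfAdjoint_padMatrix {m : ℕ} (r : ℕ) {A : Matrix (Fin m) (Fin m) ℂ}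
    (hA : IsSelfAdjoint A) : IsSelfAdjoint (padMatrix r A) := by
  have hA' : A.conjTranspose = A := hA
  rw [isSelfAdjoint_iff, Matrix.star_eq_conjTranspose, padMatrix, Matrix.conjTranspose_submatrix,
    Matrix.fromBlocks_conjTranspose, hA']
  simp

theorem trace_green_padMatrix {m : ℕ} (r : ℕ) {A : Matrix (Fin m) (Fin m) ℂ}
    (hA : IsSelfAdjoint A) {z : ℂ} (hz : 0 < z.im) :
    Matrix.trace (green (padMatrix r A) z) = Matrix.trace (green A z) - r * z⁻¹ := by
  have hz0 : z ≠ 0 := by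
    rintro rfl
    simp at hz
  have h1 : padMatrix r A - z • 1 = (Matrix.fromBlocks (A - z • 1) 0 0
      (-(z • (1 : Matrix (Fin r) (Fin r) ℂ)))).submatrix finSumFinEquiv.symm
        finSumFinEquiv.symm := by
    have h2 : (Matrix.fromBlocks (A - z • 1) 0 0 (-(z • (1 : Matrix (Fin r) (Fin r) ℂ))))
        = Matrix.fromBlocks A 0 0 (0 : Matrix (Fin r) (Fin r) ℂ) - z • 1 := by
      rw [← Matrix.fromBlocks_one, Matrix.fromBlocks_smul, sub_eq_add_neg _ (Matrix.fromBlocks _ _ _ _),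
        Matrix.fromBlocks_neg, Matrix.fromBlocks_add]
      simp [sub_eq_add_neg]
    rw [h2, Matrix.submatrix_sub, Pi.sub_apply, Pi.sub_apply, Matrix.submatrix_smul, Pi.smul_apply,
      Pi.smul_apply, Matrix.submatrix_one_equiv]
    rfl
  have hD : -(z • (1 : Matrix (Fin r) (Fin r) ℂ)) * -(z⁻¹ • (1 : Matrix (Fin r) (Fin r) ℂ)) = 1 := by
    rw [neg_mul_neg, smul_mul_smul_comm, mul_inv_cancel₀ hz0, one_smul, one_mul]
  have hDu : IsUnit (-(z • (1 : Matrix (Fin r) (Fin r) ℂ))) :=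
    IsUnit.of_mul_eq_one _ hD
  rw [green, h1, Matrix.inv_submatrix_equiv, Matrix.inv_fromBlocks_zero₂₁_of_isUnit_iff _ _ _
    ⟨fun _ => hDu, fun _ => isUnit_sub_smul_one hA hz⟩, Matrix.inv_eq_right_inv hD]
  rw [Matrix.trace, ← finSumFinEquiv.sum_comp]
  simp [Matrix.trace, green]
  ring

theorem sum_entryIndex_le {n : ℕ} (φ : ℕ → ℝ) (hφ : ∀ k, 0 ≤ φ k) :
    ∑ i : Fin n, ∑ j : Fin n, φ (entryIndex i j)
      ≤ 2 * ∑ k ∈ Finset.Icc 1 (rowStart (n + 1)), φ k := by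
  rw [← Fintype.sum_prod_type' (f := fun i j : Fin n => φ (entryIndex i j)),
    ← Finset.sum_fiberwise_of_maps_to (g := fun p : Fin n × Fin n => entryIndex p.1 p.2)
      (fun p _ => entryIndex_mem p.1 p.2), Finset.mul_sum]
  refine Finset.sum_le_sum fun k _ => ?_
  rw [Finset.sum_congr rfl (g := fun _ => φ k) (fun p hp => by rw [(Finset.mem_filter.1 hp).2]),
    Finset.sum_const, nsmul_eq_mul]
  exact mul_le_mul_of_nonneg_right (by exact_mod_cast card_entryIndex_le k) (hφ k)

theorem entryIndex_castAdd {m : ℕ} (r : ℕ) (i j : Fin m) :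
    entryIndex (Fin.castAdd r i) (Fin.castAdd r j) = entryIndex i j := rfl

theorem lt_entryIndex {n m : ℕ} {i j : Fin n} (h : m ≤ i ∨ m ≤ j) :
    rowStart (m + 1) < entryIndex i j := by
  have key : ∀ i j : ℕ, m ≤ i → rowStart (m + 1) < position (i + 1) (j + 1) := by
    intro i j hi
    have := rowStart_mono (show m + 1 ≤ i + 1 by omega)
    rw [position_eq]; omega
  unfold entryIndex
  split_ifs with h1 <;> rw [Fin.le_def] at h1
  · exact key _ _ (by omega)
  · exact key _ _ (by omega)

theorem padMatrix_seqMatrix_apply {m : ℕ} (r : ℕ) (x : ℕ → ℝ) (i j : Fin (m + r)) :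
    padMatrix r (seqMatrix m x) i j = if entryIndex i j ≤ rowStart (m + 1) then
      ((x (entryIndex i j) / √(m : ℝ) : ℝ) : ℂ) else 0 := by
  obtain ⟨i, rfl⟩ := finSumFinEquiv.surjective i
  obtain ⟨j, rfl⟩ := finSumFinEquiv.surjective j
  rw [padMatrix, Matrix.submatrix_apply, Equiv.symm_apply_apply, Equiv.symm_apply_apply]
  rcases i with i | i <;> rcases j with j | j
  · rw [Matrix.fromBlocks_apply₁₁, finSumFinEquiv_apply_left, finSumFinEquiv_apply_left,
      entryIndex_castAdd, if_pos (Finset.mem_Icc.1 (entryIndex_mem i j)).2, seqMatrix_apply]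
  · rw [if_neg]
    · rfl
    · exact (lt_entryIndex (Or.inr (by simp))).not_ge
  · rw [if_neg]
    · rfl
    · exact (lt_entryIndex (Or.inl (by simp))).not_ge
  · rw [if_neg]
    · rfl
    · exact (lt_entryIndex (Or.inl (by simp))).not_ge

/-- The Stieltjes transform of the matrix with entries read from a sequence. -/
def seqStieltjes (n : ℕ) (z : ℂ) (x : ℕ → ℝ) : ℂ :=
  stieltjes (symmetricMatrix (fun i j => x (position i j)) n) z

theorem norm_seqStieltjes_sub_le {m n : ℕ} (hm : 0 < m) (hmn : m ≤ n) {z : ℂ} (hz : 0 < z.im)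
    (x : ℕ → ℝ) :
    ‖seqStieltjes n z x - seqStieltjes m z x‖ ≤ 2 * z.im⁻¹ * ((n - m) / n)
      + z.im⁻¹ ^ 2 * √(2 * (((n - m) / n : ℝ) ^ 2
          * ((∑ k ∈ Finset.Icc 1 (rowStart (m + 1)), x k ^ 2) / m ^ 2)
        + (∑ k ∈ Finset.Ioc (rowStart (m + 1)) (rowStart (n + 1)), x k ^ 2) / m ^ 2)) := by
  obtain ⟨r, rfl⟩ := Nat.exists_eq_add_of_le hmn
  set n := m + r with hn
  have hm' : (0 : ℝ) < m := by exact_mod_cast hm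
  have hn' : (0 : ℝ) < n := by exact_mod_cast (by omega : 0 < n)
  have hmn' : (m : ℝ) ≤ n := by exact_mod_cast hmn
  have hη : 0 < z.im⁻¹ := by positivity
  have hr : (r : ℝ) = n - m := by rw [hn]; push_cast; ring
  have hr0 : (0 : ℝ) ≤ r := Nat.cast_nonneg r
  set A := seqMatrix n x with hA
  set B := padMatrix r (seqMatrix m x) with hB
  have hAs : IsSelfAdjoint A := isSelfAdjoint_seqMatrix x
  have hBs : IsSelfAdjoint B := isSelfAdjoint_padMatrix r (isSelfAdjoint_seqMatrix x)
  have htr := trace_green_padMatrix r (isSelfAdjoint_seqMatrix (n := m) x) hz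
  have hzinv : ‖z⁻¹‖ ≤ z.im⁻¹ := by
    rw [norm_inv]
    exact inv_anti₀ hz ((le_abs_self _).trans (Complex.abs_im_le_norm z))
  have hF : ∑ i, ∑ j, ‖A i j - B i j‖ ^ 2 ≤ n * (2 * (((n - m) / n : ℝ) ^ 2
          * ((∑ k ∈ Finset.Icc 1 (rowStart (m + 1)), x k ^ 2) / m ^ 2)
        + (∑ k ∈ Finset.Ioc (rowStart (m + 1)) (rowStart (n + 1)), x k ^ 2) / m ^ 2)) := by
    set φ : ℕ → ℝ := fun k => if k ≤ rowStart (m + 1) then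
      n * (((n - m) / n : ℝ) ^ 2 * (x k ^ 2 / m ^ 2)) else n * (x k ^ 2 / m ^ 2) with hφ
    have hφ0 : ∀ k, 0 ≤ φ k := by
      intro k
      simp only [hφ]
      split_ifs <;> positivity
    have h1 : ∀ i j, ‖A i j - B i j‖ ^ 2 ≤ φ (entryIndex i j) := by
      intro i j
      rw [hB, padMatrix_seqMatrix_apply, hA, seqMatrix_apply]
      simp only [hφ]
      have hsn : (0 : ℝ) < √n := Real.sqrt_pos.2 hn'
      have hsm : (0 : ℝ) < √m := Real.sqrt_pos.2 hm'
      have hsn2 : √(n : ℝ) ^ 2 = n := Real.sq_sqrt hn'.le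
      have hsm2 : √(m : ℝ) ^ 2 = m := Real.sq_sqrt hm'.le
      have hle : √(m : ℝ) ≤ √n := Real.sqrt_le_sqrt hmn'
      split_ifs with hs
      · rw [← Complex.ofReal_sub, Complex.norm_real, Real.norm_eq_abs, sq_abs]
        have e : x (entryIndex i j) / √n - x (entryIndex i j) / √(m : ℝ)
            = - (x (entryIndex i j) * ((√n - √m) / (√n * √m))) := by
          field_simp; ring
        have h3 : ((√(n : ℝ) - √m) / (√n * √m)) ^ 2 ≤ n * ((((n : ℝ) - m) / n) ^ 2 / m ^ 2) := by
          have h4 : (√(n : ℝ) - √m) / √n ≤ ((n : ℝ) - m) / n := by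
            rw [div_le_div_iff₀ hsn hn']
            have : ((n : ℝ) - m) * √n - (√n - √m) * n = √n * √m * (√n - √m) := by
              rw [← hsn2, ← hsm2]
              rw [Real.sqrt_sq hsn.le, Real.sqrt_sq hsm.le]
              ring
            have : 0 ≤ √(n : ℝ) * √m * (√n - √m) :=
              mul_nonneg (by positivity) (sub_nonneg.2 hle)
            linarith
          have h5 : 0 ≤ (√(n : ℝ) - √m) / √n := div_nonneg (sub_nonneg.2 hle) hsn.le
          have h6 : (1 : ℝ) / m ≤ n / m ^ 2 := by
            rw [div_le_div_iff₀ hm' (by positivity)]; nlinarith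
          calc ((√(n : ℝ) - √m) / (√n * √m)) ^ 2 = ((√(n : ℝ) - √m) / √n) ^ 2 * (1 / m) := by
                rw [← div_div, div_pow _ (√(m : ℝ)), hsm2]; ring
            _ ≤ (((n : ℝ) - m) / n) ^ 2 * (n / m ^ 2) := by gcongr
            _ = _ := by ring
        rw [e, neg_sq, mul_pow]
        calc x (entryIndex i j) ^ 2 * _ ≤ x (entryIndex i j) ^ 2
              * (n * ((((n : ℝ) - m) / n) ^ 2 / m ^ 2)) := by gcongr
          _ = _ := by ring
      · rw [sub_zero, Complex.norm_real, Real.norm_eq_abs, sq_abs, div_pow, hsn2,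
          mul_div_assoc', div_le_div_iff₀ hn' (by positivity)]
        have : (m : ℝ) ^ 2 ≤ n * n := by nlinarith
        nlinarith [mul_le_mul_of_nonneg_left this (sq_nonneg (x (entryIndex i j)))]
    refine (Finset.sum_le_sum fun i _ => Finset.sum_le_sum fun j _ => h1 i j).trans
      ((sum_entryIndex_le φ hφ0).trans (le_of_eq ?_))
    have h2 : Finset.Icc 1 (rowStart (n + 1)) = Finset.Icc 1 (rowStart (m + 1))
        ∪ Finset.Ioc (rowStart (m + 1)) (rowStart (n + 1)) := by
      have := rowStart_mono (show m + 1 ≤ n + 1 by omega)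
      ext k
      simp only [Finset.mem_union, Finset.mem_Icc, Finset.mem_Ioc]
      omega
    rw [h2, Finset.sum_union]
    · rw [Finset.sum_congr rfl (g := fun k => n * (((n - m) / n : ℝ) ^ 2 * (x k ^ 2 / m ^ 2)))
          (fun k hk => if_pos (Finset.mem_Icc.1 hk).2),
        Finset.sum_congr (s₁ := Finset.Ioc _ _) rfl (g := fun k => n * (x k ^ 2 / m ^ 2))
          (fun k hk => if_neg (Finset.mem_Ioc.1 hk).1.not_ge), ← Finset.mul_sum, ← Finset.mul_sum,
        ← Finset.mul_sum, ← Finset.sum_div, ← Finset.sum_div]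
      ring
    · rw [Finset.disjoint_left]
      intro k hk hk'
      rw [Finset.mem_Icc] at hk
      rw [Finset.mem_Ioc] at hk'
      omega
  have h1 := norm_trace_green_sub_le hAs hBs hz
  have h2 := norm_trace_green_le (isSelfAdjoint_seqMatrix (n := m) x) hz
  have e : seqStieltjes n z x - seqStieltjes m z x
      = (1 / (n : ℂ)) * (Matrix.trace (green A z) - Matrix.trace (green B z))
        - (1 / (n : ℂ)) * (r * z⁻¹)
        - (r / (n * m : ℂ)) * Matrix.trace (green (seqMatrix m x) z) := by
    rw [seqStieltjes, stieltjes_eq, seqStieltjes, stieltjes_eq, htr]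
    have hn0 : (n : ℂ) ≠ 0 := by exact_mod_cast hn'.ne'
    have hm0 : (m : ℂ) ≠ 0 := by exact_mod_cast hm'.ne'
    have hrC : (r : ℂ) = n - m := by rw [hn]; push_cast; ring
    rw [hrC]
    field_simp
    ring
  rw [e]
  refine (norm_sub_le _ _).trans ((add_le_add_left (norm_sub_le _ _) _).trans ?_)
  rw [norm_mul, norm_mul, norm_mul, norm_mul, norm_div, norm_div, norm_mul, norm_one,
    Complex.norm_natCast, Complex.norm_natCast, Complex.norm_natCast]
  have b1 : 1 / (n : ℝ) * ‖Matrix.trace (green A z) - Matrix.trace (green B z)‖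
      ≤ z.im⁻¹ ^ 2 * √(2 * (((n - m) / n : ℝ) ^ 2
          * ((∑ k ∈ Finset.Icc 1 (rowStart (m + 1)), x k ^ 2) / m ^ 2)
        + (∑ k ∈ Finset.Ioc (rowStart (m + 1)) (rowStart (n + 1)), x k ^ 2) / m ^ 2)) := by
    have h3 := Real.sqrt_le_sqrt hF
    rw [Real.sqrt_mul hn'.le] at h3
    calc _ ≤ 1 / (n : ℝ) * (z.im⁻¹ ^ 2 * (√n * (√n * _))) := by
          gcongr
          exact h1.trans (by gcongr)
      _ = _ := by
          rw [← mul_assoc (√(n : ℝ)), Real.mul_self_sqrt hn'.le]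
          field_simp
  have b2 : 1 / (n : ℝ) * (r * ‖z⁻¹‖) ≤ z.im⁻¹ * ((n - m) / n) := by
    rw [← hr]
    calc 1 / (n : ℝ) * (r * ‖z⁻¹‖) ≤ 1 / (n : ℝ) * (r * z.im⁻¹) := by gcongr
      _ = _ := by ring
  have b3 : (r : ℝ) / (n * m) * ‖Matrix.trace (green (seqMatrix m x) z)‖
      ≤ z.im⁻¹ * ((n - m) / n) := by
    rw [← hr]
    calc (r : ℝ) / (n * m) * _ ≤ (r : ℝ) / (n * m) * (m * z.im⁻¹) := by gcongr
      _ = _ := by field_simp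
  linarith

end Interpolation

end MartingaleMatrix

namespace MartingaleMatrix

section AlmostSure

variable {Ω : Type*} [MeasurableSpace Ω] {P : Measure Ω}

theorem ae_tendsto_zero_of_tsum_lintegral {u : ℕ → Ω → ℝ} (hm : ∀ j, AEMeasurable (u j) P)
    (h0 : ∀ j ω, 0 ≤ u j ω) (h : ∑' j, ∫⁻ ω, ENNReal.ofReal (u j ω) ∂P ≠ ⊤) :
    ∀ᵐ ω ∂P, Tendsto (fun j => u j ω) atTop (𝓝 0) := by
  rw [← lintegral_tsum fun j => (hm j).ennreal_ofReal] at h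
  filter_upwards [ae_lt_top' (AEMeasurable.tsum fun j => (hm j).ennreal_ofReal) h] with ω hω
  have h1 := ENNReal.tendsto_atTop_zero_of_tsum_ne_top hω.ne
  have h2 := (ENNReal.tendsto_toReal ENNReal.zero_ne_top).comp h1
  simpa [Function.comp_def, ENNReal.toReal_ofReal (h0 _ ω)] using h2

theorem ae_tendsto_zero_of_lintegral_le {u : ℕ → Ω → ℝ} (hm : ∀ j, AEMeasurable (u j) P)
    (h0 : ∀ j ω, 0 ≤ u j ω) {C q : ℝ} (hq : 1 < q)
    (h : ∀ j : ℕ, ∫⁻ ω, ENNReal.ofReal (u j ω) ∂P ≤ ENNReal.ofReal (C / ((j : ℝ) + 1) ^ q)) :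
    ∀ᵐ ω ∂P, Tendsto (fun j => u j ω) atTop (𝓝 0) := by
  refine ae_tendsto_zero_of_tsum_lintegral hm h0 (ne_top_of_le_ne_top ?_ (ENNReal.tsum_le_tsum h))
  have hs : Summable fun j : ℕ => C / ((j : ℝ) + 1) ^ q := by
    have h1 := (summable_nat_add_iff 1).2 (Real.summable_one_div_nat_rpow.2 hq)
    simpa [div_eq_mul_inv] using h1.mul_left C
  have hs' : Summable fun j : ℕ => (C / ((j : ℝ) + 1) ^ q).toNNReal := hs.toNNReal
  simpa [ENNReal.ofReal] using ENNReal.tsum_coe_ne_top_iff_summable.2 hs'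

theorem sq_le_one_add_rpow {δ : ℝ} (hδ : 0 < δ) (x : ℝ) : x ^ 2 ≤ 1 + |x| ^ (2 + δ) := by
  have h0 : 0 ≤ |x| ^ (2 + δ) := Real.rpow_nonneg (abs_nonneg x) _
  rw [← sq_abs]
  rcases le_total |x| 1 with h | h
  · nlinarith [abs_nonneg x]
  · have : |x| ^ (2 : ℕ) ≤ |x| ^ (2 + δ) := by
      rw [← Real.rpow_natCast |x| 2]
      exact Real.rpow_le_rpow_of_exponent_le h (by norm_num; linarith)
    linarith

theorem lintegral_sq_le [IsProbabilityMeasure P] {δ K : ℝ} (hδ : 0 < δ) (hK : 0 ≤ K) {X : Ω → ℝ}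
    (h : ∫⁻ ω, ENNReal.ofReal (|X ω| ^ (2 + δ)) ∂P ≤ ENNReal.ofReal K) :
    ∫⁻ ω, ENNReal.ofReal (X ω ^ 2) ∂P ≤ ENNReal.ofReal (1 + K) := by
  calc ∫⁻ ω, ENNReal.ofReal (X ω ^ 2) ∂P
      ≤ ∫⁻ ω, (1 + ENNReal.ofReal (|X ω| ^ (2 + δ))) ∂P := by
        refine lintegral_mono fun ω => ?_
        rw [← ENNReal.ofReal_one, ← ENNReal.ofReal_add zero_le_one
          (Real.rpow_nonneg (abs_nonneg _) _)]
        exact ENNReal.ofReal_le_ofReal (sq_le_one_add_rpow hδ _)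
    _ = 1 + ∫⁻ ω, ENNReal.ofReal (|X ω| ^ (2 + δ)) ∂P := by
        rw [lintegral_add_left measurable_const]
        simp
    _ ≤ 1 + ENNReal.ofReal K := by gcongr
    _ = _ := by rw [ENNReal.ofReal_add zero_le_one hK, ENNReal.ofReal_one]

theorem lintegral_ofReal_sum_le {ι : Type*} {s : Finset ι} {v : ι → Ω → ℝ} {K : ℝ}
    (hv : ∀ i ∈ s, AEMeasurable (v i) P) (hv0 : ∀ i ω, 0 ≤ v i ω)
    (h : ∀ i ∈ s, ∫⁻ ω, ENNReal.ofReal (v i ω) ∂P ≤ ENNReal.ofReal K) :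
    ∫⁻ ω, ENNReal.ofReal (∑ i ∈ s, v i ω) ∂P ≤ ENNReal.ofReal (s.card * K) := by
  simp_rw [ENNReal.ofReal_sum_of_nonneg fun i _ => hv0 i _]
  rw [lintegral_finsetSum' s fun i hi => (hv i hi).ennreal_ofReal]
  refine (Finset.sum_le_sum h).trans ?_
  rw [Finset.sum_const, nsmul_eq_mul, ENNReal.ofReal_mul (Nat.cast_nonneg _),
    ENNReal.ofReal_natCast]

theorem lintegral_ofReal_const_mul {c : ℝ} (hc : 0 ≤ c) (v : Ω → ℝ) (hv : AEMeasurable v P) :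
    ∫⁻ ω, ENNReal.ofReal (c * v ω) ∂P = ENNReal.ofReal c * ∫⁻ ω, ENNReal.ofReal (v ω) ∂P := by
  simp_rw [ENNReal.ofReal_mul hc]
  exact lintegral_const_mul'' _ hv.ennreal_ofReal

/-- The total of the squares in the first `m` rows. -/
def rowEnergy (x : ℕ → ℝ) (m : ℕ) : ℝ := ∑ k ∈ Finset.Icc 1 (rowStart (m + 1)), x k ^ 2

/-- The total of the squares in the rows `m + 1, …, n`. -/
def blockEnergy (x : ℕ → ℝ) (m n : ℕ) : ℝ :=
  ∑ k ∈ Finset.Ioc (rowStart (m + 1)) (rowStart (n + 1)), x k ^ 2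

theorem rowEnergy_nonneg (x : ℕ → ℝ) (m : ℕ) : 0 ≤ rowEnergy x m :=
  Finset.sum_nonneg fun _ _ => sq_nonneg _

theorem blockEnergy_nonneg (x : ℕ → ℝ) (m n : ℕ) : 0 ≤ blockEnergy x m n :=
  Finset.sum_nonneg fun _ _ => sq_nonneg _

theorem blockEnergy_mono (x : ℕ → ℝ) (m : ℕ) {n n' : ℕ} (h : n ≤ n') :
    blockEnergy x m n ≤ blockEnergy x m n' :=
  Finset.sum_le_sum_of_subset_of_nonneg
    (Finset.Ioc_subset_Ioc_right (rowStart_mono (by omega))) fun _ _ _ => sq_nonneg _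

theorem card_block_le {m n : ℕ} (h : m ≤ n) :
    (rowStart (n + 1) - rowStart (m + 1) : ℕ) ≤ (n - m) * n := by
  induction n, h using Nat.le_induction with
  | base => simp
  | succ n hmn ih =>
    have := rowStart_mono (show m + 1 ≤ n + 1 by omega)
    rw [rowStart_succ (n + 1), Nat.succ_sub hmn]
    have : (n - m) * n ≤ (n - m) * (n + 1) := Nat.mul_le_mul_left _ (by omega)
    rw [Nat.succ_eq_add_one, add_mul, one_mul]
    omega

/-- The negligibility of the rows between two consecutive `p`-th powers. -/
def SmallBlocks (p : ℕ) (x : ℕ → ℝ) : Prop :=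
  Tendsto (fun j : ℕ => rowEnergy x ((j + 1) ^ p) / (((j + 1) ^ p : ℕ) : ℝ) ^ 2
    / ((j : ℝ) + 1) ^ 2) atTop (𝓝 0) ∧
  Tendsto (fun j : ℕ => blockEnergy x ((j + 1) ^ p) ((j + 2) ^ p)
    / (((j + 1) ^ p : ℕ) : ℝ) ^ 2) atTop (𝓝 0)

theorem one_sub_pow_ratio_le (p j n : ℕ) (hn0 : 0 < n) (hn : n ≤ (j + 2) ^ p) :
    ((n : ℝ) - ((j + 1) ^ p : ℕ)) / n ≤ p / ((j : ℝ) + 1) := by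
  have hn' : (0 : ℝ) < n := by exact_mod_cast hn0
  have h1 : (n : ℝ) ≤ ((j : ℝ) + 2) ^ p := by exact_mod_cast hn
  have hb := one_add_mul_le_pow (a := -(1 / ((j : ℝ) + 2))) (by
    have : 1 / ((j : ℝ) + 2) ≤ 1 := by rw [div_le_one (by positivity)]; linarith [Nat.cast_nonneg (α := ℝ) j]
    linarith) p
  have e : 1 + -(1 / ((j : ℝ) + 2)) = (j + 1) / (j + 2) := by field_simp; ring
  rw [e, div_pow] at hb
  have h2 : ((j : ℝ) + 1) ^ p / (j + 2) ^ p ≤ ((j + 1) ^ p : ℕ) / (n : ℝ) := by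
    push_cast
    gcongr
  have h3 : (p : ℝ) / (j + 2) ≤ p / (j + 1) := by gcongr; norm_num
  rw [sub_div, div_self hn'.ne']
  have : (p : ℝ) * -(1 / ((j : ℝ) + 2)) = -(p / (j + 2)) := by ring
  linarith

theorem norm_seqStieltjes_sub_pow_le {p j n : ℕ} (hn1 : (j + 1) ^ p ≤ n) (hn2 : n ≤ (j + 2) ^ p)
    {z : ℂ} (hz : 0 < z.im) (x : ℕ → ℝ) :
    ‖seqStieltjes n z x - seqStieltjes ((j + 1) ^ p) z x‖ ≤ 2 * z.im⁻¹ * (p / ((j : ℝ) + 1))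
      + z.im⁻¹ ^ 2 * √(2 * (p ^ 2 * (rowEnergy x ((j + 1) ^ p) / (((j + 1) ^ p : ℕ) : ℝ) ^ 2
          / ((j : ℝ) + 1) ^ 2)
        + blockEnergy x ((j + 1) ^ p) ((j + 2) ^ p) / (((j + 1) ^ p : ℕ) : ℝ) ^ 2)) := by
  have hm : 0 < (j + 1) ^ p := by positivity
  have hn0 : 0 < n := hm.trans_le hn1
  have hn' : (0 : ℝ) < n := by exact_mod_cast hn0
  have hratio := one_sub_pow_ratio_le p j n hn0 hn2
  have hratio0 : 0 ≤ ((n : ℝ) - ((j + 1) ^ p : ℕ)) / n :=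
    div_nonneg (sub_nonneg.2 (by exact_mod_cast hn1)) hn'.le
  refine (norm_seqStieltjes_sub_le hm hn1 hz x).trans ?_
  have hE := rowEnergy_nonneg x ((j + 1) ^ p)
  have hB := blockEnergy_mono x ((j + 1) ^ p) hn2
  have hη : 0 < z.im⁻¹ := by positivity
  rw [← rowEnergy, ← blockEnergy]
  generalize rowEnergy x ((j + 1) ^ p) = E at *
  have e : (p : ℝ) ^ 2 * (E / (((j + 1) ^ p : ℕ) : ℝ) ^ 2 / ((j : ℝ) + 1) ^ 2)
      = (p / ((j : ℝ) + 1)) ^ 2 * (E / (((j + 1) ^ p : ℕ) : ℝ) ^ 2) := by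
    rw [div_pow]; ring
  rw [e]
  gcongr

theorem exists_pow_le_lt {p : ℕ} (hp : p ≠ 0) {J n : ℕ} (hn : (J + 1) ^ p ≤ n) :
    ∃ j, J ≤ j ∧ (j + 1) ^ p ≤ n ∧ n ≤ (j + 2) ^ p := by
  classical
  have hex : ∃ j, n < (j + 2) ^ p :=
    ⟨n, lt_of_lt_of_le (by omega) (Nat.le_self_pow hp (n + 2))⟩
  refine ⟨Nat.find hex, ?_, ?_, (Nat.find_spec hex).le⟩
  · by_contra! h
    have h1 := Nat.find_spec hex
    have h2 : (Nat.find hex + 2) ^ p ≤ (J + 1) ^ p := Nat.pow_le_pow_left (by omega) p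
    omega
  · rcases Nat.eq_zero_or_pos (Nat.find hex) with h | h
    · rw [h, zero_add, one_pow]
      exact (Nat.one_le_pow _ _ (by omega)).trans hn
    · have := Nat.find_min hex (m := Nat.find hex - 1) (by omega)
      rw [show Nat.find hex - 1 + 2 = Nat.find hex + 1 by omega] at this
      exact not_lt.1 this

theorem tendsto_of_tendsto_pow {p : ℕ} (hp : p ≠ 0) {z : ℂ} (hz : 0 < z.im) {x y : ℕ → ℝ}
    (hx : SmallBlocks p x) (hy : SmallBlocks p y)
    (h : Tendsto (fun j : ℕ => seqStieltjes ((j + 1) ^ p) z x - seqStieltjes ((j + 1) ^ p) z y)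
      atTop (𝓝 0)) :
    Tendsto (fun n => seqStieltjes n z x - seqStieltjes n z y) atTop (𝓝 0) := by
  have hb : ∀ {x : ℕ → ℝ}, SmallBlocks p x → Tendsto (fun j : ℕ =>
      2 * z.im⁻¹ * (p / ((j : ℝ) + 1))
      + z.im⁻¹ ^ 2 * √(2 * (p ^ 2 * (rowEnergy x ((j + 1) ^ p) / (((j + 1) ^ p : ℕ) : ℝ) ^ 2
          / ((j : ℝ) + 1) ^ 2)
        + blockEnergy x ((j + 1) ^ p) ((j + 2) ^ p) / (((j + 1) ^ p : ℕ) : ℝ) ^ 2)))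
      atTop (𝓝 0) := by
    intro x hx
    have h1 : Tendsto (fun j : ℕ => (p : ℝ) / ((j : ℝ) + 1)) atTop (𝓝 0) :=
      tendsto_const_nhds.div_atTop (tendsto_natCast_atTop_atTop.atTop_add tendsto_const_nhds)
    have h2 := (((hx.1.const_mul ((p : ℝ) ^ 2)).add hx.2).const_mul 2).sqrt.const_mul (z.im⁻¹ ^ 2)
    have h3 := (h1.const_mul (2 * z.im⁻¹)).add h2
    simpa using h3
  rw [Metric.tendsto_atTop]
  intro ε hε
  obtain ⟨J, hJ⟩ := eventually_atTop.1 (((hb hx).eventually_lt_const (show 0 < ε / 3 by linarith)).and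
    (((hb hy).eventually_lt_const (show 0 < ε / 3 by linarith)).and
      ((tendsto_zero_iff_norm_tendsto_zero.1 h).eventually_lt_const (show 0 < ε / 3 by linarith))))
  refine ⟨(J + 1) ^ p, fun n hn => ?_⟩
  obtain ⟨j, hj, h1, h2⟩ := exists_pow_le_lt hp hn
  obtain ⟨b1, b2, b3⟩ := hJ j hj
  have c1 := (norm_seqStieltjes_sub_pow_le h1 h2 hz x).trans_lt b1
  have c2 := (norm_seqStieltjes_sub_pow_le h1 h2 hz y).trans_lt b2
  rw [norm_sub_rev] at c2
  rw [dist_zero_right]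
  have e : seqStieltjes n z x - seqStieltjes n z y
      = (seqStieltjes n z x - seqStieltjes ((j + 1) ^ p) z x)
        + (seqStieltjes ((j + 1) ^ p) z x - seqStieltjes ((j + 1) ^ p) z y)
        + (seqStieltjes ((j + 1) ^ p) z y - seqStieltjes n z y) := by ring
  rw [e]
  refine norm_add₃_le.trans_lt ?_
  linarith

theorem ae_smallBlocks [IsProbabilityMeasure P] {X : ℕ → Ω → ℝ} {δ K : ℝ} (hδ : 0 < δ)
    (hK : 0 ≤ K) (hX : ∀ k, 1 ≤ k → AEMeasurable (X k) P)
    (hmom : ∀ k, 1 ≤ k → ∫⁻ ω, ENNReal.ofReal (|X k ω| ^ (2 + δ)) ∂P ≤ ENNReal.ofReal K) (p : ℕ) :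
    ∀ᵐ ω ∂P, SmallBlocks p fun k => X k ω := by
  have hmR : ∀ m, AEMeasurable (fun ω => rowEnergy (fun k => X k ω) m) P := fun m =>
    Finset.aemeasurable_fun_sum _ fun k hk => (hX k (Finset.mem_Icc.1 hk).1).pow_const 2
  have hmB : ∀ m n, AEMeasurable (fun ω => blockEnergy (fun k => X k ω) m n) P := fun m n =>
    Finset.aemeasurable_fun_sum _ fun k hk =>
      (hX k (by have := (Finset.mem_Ioc.1 hk).1; omega)).pow_const 2
  refine Filter.Eventually.and ?_ ?_
  · refine ae_tendsto_zero_of_lintegral_le (C := 1 + K) (q := 2)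
      (fun j => ((hmR _).div_const _).div_const _)
      (fun j ω => by have := rowEnergy_nonneg (fun k => X k ω) ((j + 1) ^ p); positivity)
      (by norm_num) fun j => ?_
    set m := (j + 1) ^ p with hm
    have hm0 : (0 : ℝ) < m := by rw [hm]; positivity
    have e : ∀ ω, rowEnergy (fun k => X k ω) m / (m : ℝ) ^ 2 / ((j : ℝ) + 1) ^ 2
        = (1 / ((m : ℝ) ^ 2 * ((j : ℝ) + 1) ^ 2)) * rowEnergy (fun k => X k ω) m := by
      intro ω; field_simp
    simp_rw [e]
    rw [lintegral_ofReal_const_mul (by positivity) _ (hmR m)]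
    have h1 := lintegral_ofReal_sum_le (P := P) (s := Finset.Icc 1 (rowStart (m + 1)))
      (v := fun k ω => X k ω ^ 2) (K := 1 + K)
      (fun k hk => (hX k (Finset.mem_Icc.1 hk).1).pow_const 2) (fun _ _ => sq_nonneg _)
      (fun k hk => lintegral_sq_le hδ hK (hmom k (Finset.mem_Icc.1 hk).1))
    refine (mul_le_mul_right h1 _).trans ?_
    rw [← ENNReal.ofReal_mul (by positivity)]
    refine ENNReal.ofReal_le_ofReal ?_
    have h2 : ((Finset.Icc 1 (rowStart (m + 1))).card : ℝ) ≤ (m : ℝ) ^ 2 := by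
      rw [Nat.card_Icc, Nat.add_sub_cancel]
      exact_mod_cast rowStart_succ_le_sq m
    calc _ ≤ 1 / ((m : ℝ) ^ 2 * ((j : ℝ) + 1) ^ 2) * ((m : ℝ) ^ 2 * (1 + K)) := by gcongr
      _ = (1 + K) / ((j : ℝ) + 1) ^ (2 : ℝ) := by
        rw [Real.rpow_two]; field_simp
  · set q := 1 + δ / 2 with hq
    have hq1 : 1 < q := by rw [hq]; linarith
    have hq0 : 0 < q := by linarith
    have key : ∀ᵐ ω ∂P, Tendsto (fun j : ℕ => (blockEnergy (fun k => X k ω) ((j + 1) ^ p)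
        ((j + 2) ^ p) / (((j + 1) ^ p : ℕ) : ℝ) ^ 2) ^ q) atTop (𝓝 0) := by
      refine ae_tendsto_zero_of_lintegral_le (C := (4 ^ p * p) ^ q * K) (q := q)
        (fun j => ((hmB _ _).div_const _).pow_const _)
        (fun j ω => Real.rpow_nonneg (div_nonneg (blockEnergy_nonneg _ _ _) (sq_nonneg _)) _)
        hq1 fun j => ?_
      set m := (j + 1) ^ p with hm
      set n := (j + 2) ^ p with hn
      have hm0 : (0 : ℝ) < m := by rw [hm]; positivity
      have hmn : m ≤ n := Nat.pow_le_pow_left (by omega) p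
      set s := Finset.Ioc (rowStart (m + 1)) (rowStart (n + 1)) with hs
      have hpm : ∀ ω, (blockEnergy (fun k => X k ω) m n / (m : ℝ) ^ 2) ^ q
          ≤ (1 / ((m : ℝ) ^ 2) ^ q * (s.card : ℝ) ^ (q - 1))
            * ∑ k ∈ s, |X k ω| ^ (2 + δ) := by
        intro ω
        have h1 := Real.rpow_sum_le_const_mul_sum_rpow s (fun k => X k ω ^ 2) hq1.le
        have h2 : ∀ k, |X k ω ^ 2| ^ q = |X k ω| ^ (2 + δ) := by
          intro k
          rw [abs_pow, ← Real.rpow_natCast, ← Real.rpow_mul (abs_nonneg _)]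
          congr 1
          rw [hq]; push_cast; ring
        have h3 : ∑ k ∈ s, |X k ω ^ 2| = blockEnergy (fun k => X k ω) m n :=
          Finset.sum_congr rfl fun k _ => abs_of_nonneg (sq_nonneg _)
        simp_rw [h2] at h1
        rw [h3] at h1
        rw [Real.div_rpow (blockEnergy_nonneg _ _ _) (sq_nonneg _), div_eq_mul_one_div, mul_comm,
          mul_assoc]
        gcongr
      refine (lintegral_mono fun ω => ENNReal.ofReal_le_ofReal (hpm ω)).trans ?_
      have hXs : ∀ k ∈ s, AEMeasurable (X k) P := fun k hk =>
        hX k (by have := (Finset.mem_Ioc.1 hk).1; omega)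
      have hXs' : ∀ k ∈ s, AEMeasurable (fun ω => |X k ω| ^ (2 + δ)) P := fun k hk =>
        ((hXs k hk).norm).pow_const _
      rw [lintegral_ofReal_const_mul (by positivity) _ (Finset.aemeasurable_fun_sum _ hXs')]
      have h1 := lintegral_ofReal_sum_le (P := P) (s := s)
        (v := fun k ω => |X k ω| ^ (2 + δ)) (K := K) hXs' (fun _ _ => Real.rpow_nonneg (abs_nonneg _) _)
        (fun k hk => hmom k (by have := (Finset.mem_Ioc.1 hk).1; omega))
      refine (mul_le_mul_right h1 _).trans ?_
      rw [← ENNReal.ofReal_mul (by positivity)]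
      refine ENNReal.ofReal_le_ofReal ?_
      have hcard : (s.card : ℝ) ≤ ((n : ℝ) - m) * n := by
        rw [hs, Nat.card_Ioc, ← Nat.cast_sub hmn]
        exact_mod_cast card_block_le hmn
      have hn0 : 0 < n := by rw [hn]; positivity
      have hn0' : (0 : ℝ) < n := by exact_mod_cast hn0
      have hratio := one_sub_pow_ratio_le p j n hn0 le_rfl
      have hnm : (n : ℝ) ≤ 2 ^ p * m := by
        rw [hn, hm]
        push_cast
        rw [← mul_pow]
        gcongr
        linarith [Nat.cast_nonneg (α := ℝ) j]
      have h5 : (s.card : ℝ) / (m : ℝ) ^ 2 ≤ 4 ^ p * p / ((j : ℝ) + 1) := by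
        rw [div_le_iff₀ (by positivity)]
        rw [div_le_iff₀ hn0'] at hratio
        calc (s.card : ℝ) ≤ ((n : ℝ) - m) * n := hcard
          _ ≤ (p / ((j : ℝ) + 1) * n) * n := by gcongr
          _ = (p / ((j : ℝ) + 1)) * (n * n) := by ring
          _ ≤ (p / ((j : ℝ) + 1)) * ((2 ^ p * m) * (2 ^ p * m)) := by gcongr
          _ = _ := by
            rw [show (4 : ℝ) = 2 * 2 by norm_num, mul_pow]; ring
      calc 1 / ((m : ℝ) ^ 2) ^ q * (s.card : ℝ) ^ (q - 1) * (s.card * K)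
          = ((s.card : ℝ) / (m : ℝ) ^ 2) ^ q * K := by
            rw [Real.div_rpow (Nat.cast_nonneg _) (by positivity)]
            rcases (Nat.cast_nonneg (α := ℝ) s.card).eq_or_lt with h0 | h0
            · rw [← h0, Real.zero_rpow hq0.ne']; simp
            · rw [Real.rpow_sub_one h0.ne']
              field_simp
        _ ≤ (4 ^ p * p / ((j : ℝ) + 1)) ^ q * K := by gcongr
        _ = _ := by rw [Real.div_rpow (by positivity) (by positivity)]; ring
    filter_upwards [key] with ω hω
    have h1 := hω.rpow_const (p := q⁻¹) (Or.inr (by positivity))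
    rw [Real.zero_rpow (by positivity)] at h1
    refine h1.congr fun j => ?_
    rw [Real.rpow_rpow_inv (div_nonneg (blockEnergy_nonneg _ _ _) (sq_nonneg _)) hq0.ne']

end AlmostSure

end MartingaleMatrix

namespace MartingaleMatrix

section Orthogonality

variable {Ω : Type*} {mΩ : MeasurableSpace Ω} {P : Measure Ω} [IsProbabilityMeasure P]

theorem integral_mul_eq_zero_of_condExp_eq_zero {m : MeasurableSpace Ω} (hm : m ≤ mΩ)
    {w d : Ω → ℝ} (hw : StronglyMeasurable[m] w) (hd : Integrable d P)
    (hwd : Integrable (w * d) P) (h : P[d | m] =ᵐ[P] 0) : ∫ ω, w ω * d ω ∂P = 0 := by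
  have h1 : P[w * d | m] =ᵐ[P] 0 := by
    filter_upwards [condExp_mul_of_stronglyMeasurable_left hw hwd hd, h] with ω h1 h2
    rw [h1, Pi.mul_apply, h2, Pi.zero_apply, mul_zero]
  have h2 : ∫ ω, (w * d) ω ∂P = 0 := by
    rw [← integral_condExp hm, integral_congr_ae h1]
    simp
  exact h2

open scoped Classical in
theorem lintegral_sq_weighted_sum_le {s : Finset ℕ} {m : ℕ → MeasurableSpace Ω}
    (hm : ∀ k, m k ≤ mΩ) {w d : ℕ → Ω → ℝ} {b v κ : ℝ}
    (hw : ∀ k ∈ s, StronglyMeasurable[m k] (w k)) (hwb : ∀ k ∈ s, ∀ ω, |w k ω| ≤ b)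
    (hd : ∀ k ∈ s, MemLp (d k) 2 P) (hv : ∀ k ∈ s, ∫ ω, d k ω ^ 2 ∂P ≤ v)
    (hc : ∀ k ∈ s, P[d k | m k] =ᵐ[P] 0) {far : ℕ → ℕ → Prop}
    (hfar : ∀ k ∈ s, ∀ l ∈ s, far k l → StronglyMeasurable[m k] fun ω => w l ω * d l ω)
    (hcard : ∀ k ∈ s, ((s.filter fun l => ¬ far k l ∧ ¬ far l k).card : ℝ) ≤ κ) :
    ∫⁻ ω, ENNReal.ofReal ((∑ k ∈ s, w k ω * d k ω) ^ 2) ∂P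
      ≤ ENNReal.ofReal (s.card * (κ * (b ^ 2 * v))) := by
  set ξ : ℕ → Ω → ℝ := fun k ω => w k ω * d k ω with hξ
  have hξ2 : ∀ k ∈ s, MemLp (ξ k) 2 P := fun k hk =>
    (hd k hk).of_le_mul (c := b) ((((hw k hk).mono (hm k)).aestronglyMeasurable).mul
      (hd k hk).aestronglyMeasurable) (Eventually.of_forall fun ω => by
        rw [hξ, norm_mul]
        exact mul_le_mul_of_nonneg_right (hwb k hk ω) (norm_nonneg _))
  have hint : ∀ k ∈ s, ∀ l ∈ s, Integrable (fun ω => ξ k ω * ξ l ω) P := fun k hk l hl =>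
    (hξ2 k hk).integrable_mul (hξ2 l hl)
  have hsq : ∀ k ∈ s, ∫ ω, ξ k ω ^ 2 ∂P ≤ b ^ 2 * v := by
    intro k hk
    calc ∫ ω, ξ k ω ^ 2 ∂P ≤ ∫ ω, b ^ 2 * d k ω ^ 2 ∂P := by
          refine integral_mono (hξ2 k hk).integrable_sq ((hd k hk).integrable_sq.const_mul _) ?_
          intro ω
          change (w k ω * d k ω) ^ 2 ≤ b ^ 2 * d k ω ^ 2
          rw [mul_pow]
          gcongr ?_ * _
          rw [← sq_abs]
          exact pow_le_pow_left₀ (abs_nonneg _) (hwb k hk ω) 2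
      _ = b ^ 2 * ∫ ω, d k ω ^ 2 ∂P := integral_const_mul _ _
      _ ≤ _ := by gcongr; exact hv k hk
  have hfar0 : ∀ k ∈ s, ∀ l ∈ s, far k l → ∫ ω, ξ k ω * ξ l ω ∂P = 0 := by
    intro k hk l hl hkl
    have e : ∀ ω, ξ k ω * ξ l ω = (w k ω * ξ l ω) * d k ω := fun ω => by
      simp only [hξ]; ring
    simp_rw [e]
    refine integral_mul_eq_zero_of_condExp_eq_zero (hm k) ((hw k hk).mul (hfar k hk l hl hkl))
      ((hd k hk).integrable one_le_two) ?_ (hc k hk)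
    refine (hint k hk l hl).congr (Eventually.of_forall fun ω => ?_)
    exact e ω
  have hpair : ∀ k ∈ s, ∀ l ∈ s, ∫ ω, ξ k ω * ξ l ω ∂P
      ≤ if ¬ far k l ∧ ¬ far l k then b ^ 2 * v else 0 := by
    intro k hk l hl
    by_cases h1 : far k l
    · simp [h1, hfar0 k hk l hl h1]
    by_cases h2 : far l k
    · have := hfar0 l hl k hk h2
      simp_rw [mul_comm (ξ l _)] at this
      simp [h2, this]
    rw [if_pos ⟨h1, h2⟩]
    calc ∫ ω, ξ k ω * ξ l ω ∂P ≤ ∫ ω, (1 / 2 * ξ k ω ^ 2 + 1 / 2 * ξ l ω ^ 2) ∂P := by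
          refine integral_mono (hint k hk l hl) (((hξ2 k hk).integrable_sq.const_mul _).add
            ((hξ2 l hl).integrable_sq.const_mul _)) fun ω => ?_
          simp only
          nlinarith [sq_nonneg (ξ k ω - ξ l ω)]
      _ = 1 / 2 * ∫ ω, ξ k ω ^ 2 ∂P + 1 / 2 * ∫ ω, ξ l ω ^ 2 ∂P := by
          rw [integral_add ((hξ2 k hk).integrable_sq.const_mul _)
            ((hξ2 l hl).integrable_sq.const_mul _), integral_const_mul, integral_const_mul]
      _ ≤ _ := by linarith [hsq k hk, hsq l hl]
  have hexp : ∀ ω, (∑ k ∈ s, w k ω * d k ω) ^ 2 = ∑ k ∈ s, ∑ l ∈ s, ξ k ω * ξ l ω := fun ω => by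
    rw [sq, Finset.sum_mul_sum]
  have hI : Integrable (fun ω => ∑ k ∈ s, ∑ l ∈ s, ξ k ω * ξ l ω) P :=
    integrable_finsetSum _ fun k hk => integrable_finsetSum _ fun l hl => hint k hk l hl
  simp_rw [hexp]
  rw [← ofReal_integral_eq_lintegral_ofReal hI (Eventually.of_forall fun ω =>
    (sq_nonneg _).trans_eq (hexp ω))]
  refine ENNReal.ofReal_le_ofReal ?_
  rw [integral_finsetSum _ fun k hk => integrable_finsetSum _ fun l hl => hint k hk l hl]
  calc ∑ k ∈ s, ∫ ω, ∑ l ∈ s, ξ k ω * ξ l ω ∂P ≤ ∑ _k ∈ s, κ * (b ^ 2 * v) := by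
        refine Finset.sum_le_sum fun k hk => ?_
        have hbv : 0 ≤ b ^ 2 * v :=
          (integral_nonneg fun ω => sq_nonneg (ξ k ω)).trans (hsq k hk)
        rw [integral_finsetSum _ fun l hl => hint k hk l hl]
        refine (Finset.sum_le_sum fun l hl => hpair k hk l hl).trans ?_
        rw [← Finset.sum_filter, Finset.sum_const, nsmul_eq_mul]
        exact mul_le_mul_of_nonneg_right (hcard k hk) hbv
    _ = _ := by rw [Finset.sum_const, nsmul_eq_mul]

end Orthogonality

section Lindeberg

variable {Ω : Type*} [MeasurableSpace Ω] {P : Measure Ω}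

/-- The sequence with entries `x l` before `k`, zero at `k`, and `y l` for `k < l ≤ N`. -/
def hybrid (N k : ℕ) (x y : ℕ → ℝ) : ℕ → ℝ := fun l =>
  if l ∈ Finset.Ico 1 k then x l else if l ∈ Finset.Ioc k N then y l else 0

theorem hybrid_self (N k : ℕ) (x y : ℕ → ℝ) : hybrid N k x y k = 0 := by
  simp [hybrid]

theorem continuous_hybrid (N k : ℕ) :
    Continuous fun p : (ℕ → ℝ) × (ℕ → ℝ) => hybrid N k p.1 p.2 := by
  refine continuous_pi fun l => ?_
  unfold hybrid
  split_ifs <;> fun_prop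

/-- The average of `u` over the random second part of the hybrid sequence. -/
def hybridMean (P : Measure Ω) (Y : ℕ → Ω → ℝ) (N k : ℕ) (u : (ℕ → ℝ) → ℝ) (x : ℕ → ℝ) : ℝ :=
  ∫ ω, u (hybrid N k x fun l => Y l ω) ∂P

variable {Y : ℕ → Ω → ℝ}

theorem integral_sub_sub_sub {a b c d : Ω → ℝ} (ha : Integrable a P) (hb : Integrable b P)
    (hc : Integrable c P) (hd : Integrable d P) :
    ∫ ω, (a ω - b ω - c ω - d ω) ∂P
      = (∫ ω, a ω ∂P) - (∫ ω, b ω ∂P) - (∫ ω, c ω ∂P) - ∫ ω, d ω ∂P := by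
  rw [integral_sub (f := fun ω => a ω - b ω - c ω) ((ha.sub hb).sub hc) hd,
    integral_sub (f := fun ω => a ω - b ω) (ha.sub hb) hc, integral_sub ha hb]

theorem hybridMean_congr (N k : ℕ) (u : (ℕ → ℝ) → ℝ) {x x' : ℕ → ℝ}
    (h : ∀ l ∈ Finset.Ico 1 k, x l = x' l) :
    hybridMean P Y N k u x = hybridMean P Y N k u x' := by
  have : ∀ y, hybrid N k x y = hybrid N k x' y := by
    intro y
    funext l
    unfold hybrid
    split_ifs with h1
    · exact h l h1
    · rfl
    · rfl
  simp only [hybridMean, this]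

variable [IsProbabilityMeasure P]

theorem measurable_comp_hybrid (hY : ∀ l, Measurable (Y l)) (N k : ℕ) {u : (ℕ → ℝ) → ℝ}
    (hu : Continuous u) (x : ℕ → ℝ) : Measurable fun ω => u (hybrid N k x fun l => Y l ω) :=
  (hu.comp (continuous_hybrid N k)).measurable.comp
    (measurable_const.prodMk (measurable_pi_lambda _ hY))

theorem integrable_comp_hybrid (hY : ∀ l, Measurable (Y l)) (N k : ℕ) {u : (ℕ → ℝ) → ℝ}
    (hu : Continuous u) {b : ℝ} (hb : ∀ x, |u x| ≤ b) (x : ℕ → ℝ) :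
    Integrable (fun ω => u (hybrid N k x fun l => Y l ω)) P :=
  Integrable.of_bound (measurable_comp_hybrid hY N k hu x).aestronglyMeasurable b
    (Eventually.of_forall fun _ => hb _)

theorem continuous_hybridMean (hY : ∀ l, Measurable (Y l)) (N k : ℕ) {u : (ℕ → ℝ) → ℝ}
    (hu : Continuous u) {b : ℝ} (hb : ∀ x, |u x| ≤ b) : Continuous (hybridMean P Y N k u) := by
  refine continuous_of_dominated (bound := fun _ => b)
    (fun x => (measurable_comp_hybrid hY N k hu x).aestronglyMeasurable)
    (fun x => Eventually.of_forall fun _ => hb _) (integrable_const _)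
    (Eventually.of_forall fun ω => ?_)
  exact (hu.comp (continuous_hybrid N k)).comp (continuous_id.prodMk continuous_const)

theorem abs_integral_le_of_abs_le {u : Ω → ℝ} {b : ℝ} (hb : ∀ ω, |u ω| ≤ b) :
    |∫ ω, u ω ∂P| ≤ b := by
  have := norm_integral_le_of_norm_le_const (μ := P) (f := u) (Eventually.of_forall fun ω => hb ω)
  simpa using this

theorem abs_hybridMean_le (N k : ℕ) {u : (ℕ → ℝ) → ℝ} {b : ℝ} (hb : ∀ x, |u x| ≤ b)
    (x : ℕ → ℝ) : |hybridMean P Y N k u x| ≤ b :=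
  abs_integral_le_of_abs_le fun _ => hb _

/-- Measurability of the averages with respect to the entries that they involve. -/
theorem stronglyMeasurable_hybridMean {Ω' : Type*} {m : MeasurableSpace Ω'}
    (hY : ∀ l, Measurable (Y l)) (N k : ℕ) {u : (ℕ → ℝ) → ℝ} (hu : Continuous u) {b : ℝ}
    (hb : ∀ x, |u x| ≤ b) {X : ℕ → Ω' → ℝ} (hX : ∀ l ∈ Finset.Ico 1 k, Measurable[m] (X l)) :
    StronglyMeasurable[m] fun ω => hybridMean P Y N k u fun l => X l ω := by
  have e : (fun ω => hybridMean P Y N k u fun l => X l ω)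
      = fun ω => hybridMean P Y N k u fun l => if l ∈ Finset.Ico 1 k then X l ω else 0 := by
    funext ω
    exact hybridMean_congr N k u fun l hl => by rw [if_pos hl]
  rw [e]
  refine Measurable.stronglyMeasurable ?_
  refine (continuous_hybridMean hY N k hu hb).measurable.comp (measurable_pi_lambda _ fun l => ?_)
  split_ifs with h
  · exact hX l h
  · exact measurable_const

variable {n : ℕ} {δ K : ℝ} {f : (ℕ → ℝ) → ℝ} {g h : ℕ → (ℕ → ℝ) → ℝ}

theorem abs_hybridMean_sub_le (ht : SmoothTest n δ K f g h) (hY : ∀ l, Measurable (Y l))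
    (N k : ℕ) (s : Finset ℕ) (x x' : ℕ → ℝ) (hs : ∀ l ∈ Finset.Ico 1 k, l ∉ s → x l = x' l)
    (hsk : s ⊆ Finset.Ico 1 k) :
    |hybridMean P Y N k (h k) x - hybridMean P Y N k (h k) x'|
      ≤ K / n ^ 2 * ∑ l ∈ s, (|x l - x' l| / √n) ^ δ := by
  rw [hybridMean, hybridMean, ← integral_sub
    (integrable_comp_hybrid hY N k (ht.continuous_h k) (ht.abs_h_le k) x)
    (integrable_comp_hybrid hY N k (ht.continuous_h k) (ht.abs_h_le k) x')]
  refine abs_integral_le_of_abs_le fun ω => ?_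
  refine (ht.h_sub k s _ _ fun l hl => ?_).trans (le_of_eq ?_)
  · unfold hybrid
    split_ifs with h1
    · exact hs l h1 hl
    · rfl
    · rfl
  · congr 1
    refine Finset.sum_congr rfl fun l hl => ?_
    unfold hybrid
    rw [if_pos (hsk hl), if_pos (hsk hl)]

/-- The sequence with entries `x l` up to `k` and `y l` after it. -/
def splice (k : ℕ) (x y : ℕ → ℝ) : ℕ → ℝ := fun l => if l ≤ k then x l else y l

theorem lindeberg_step (ht : SmoothTest n δ K f g h) (hY : ∀ l, Measurable (Y l))
    {k : ℕ} (hk : 1 ≤ k) (hY2 : MemLp (Y k) 2 P)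
    (hYδ : Integrable (fun ω => |Y k ω| ^ (2 + δ)) P) (hY0 : ∫ ω, Y k ω ∂P = 0)
    (hind : IndepFun (Y k)
      (fun ω l => if l ∈ Finset.Ioc k (rowStart (n + 1)) then Y l ω else 0) P) (x : ℕ → ℝ) :
    |(∫ ω, f (splice k x fun l => Y l ω) ∂P) - (∫ ω, f (splice (k - 1) x fun l => Y l ω) ∂P)
      - x k * hybridMean P Y (rowStart (n + 1)) k (g k) x
      - (x k ^ 2 - ∫ ω, Y k ω ^ 2 ∂P) * hybridMean P Y (rowStart (n + 1)) k (h k) x|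
      ≤ K / n * ((|x k| / √n) ^ (2 + δ) + ∫ ω, (|Y k ω| / √n) ^ (2 + δ) ∂P) := by
  set N := rowStart (n + 1) with hN
  set u : Ω → ℕ → ℝ := fun ω => hybrid N k x fun l => Y l ω with hu
  have hYm : Measurable fun ω l => Y l ω := measurable_pi_lambda _ hY
  have hum : Measurable u :=
    (continuous_hybrid N k).measurable.comp (measurable_const.prodMk hYm)
  have e1 : ∀ ω, f (splice k x fun l => Y l ω) = f (Function.update (u ω) k (x k)) := by
    intro ω
    refine ht.f_congr _ _ fun l hl => ?_
    rw [Finset.mem_Icc] at hl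
    simp only [splice, hu, hybrid, Function.update_apply, Finset.mem_Ico, Finset.mem_Ioc]
    split_ifs <;> first | rfl | omega | (subst_vars; rfl)
  have e2 : ∀ ω, f (splice (k - 1) x fun l => Y l ω) = f (Function.update (u ω) k (Y k ω)) := by
    intro ω
    refine ht.f_congr _ _ fun l hl => ?_
    rw [Finset.mem_Icc] at hl
    simp only [splice, hu, hybrid, Function.update_apply, Finset.mem_Ico, Finset.mem_Ioc]
    split_ifs <;> first | rfl | omega | (subst_vars; rfl)
  have hfm := ht.continuous_f.measurable
  have hupd : ∀ {t : Ω → ℝ}, Measurable t →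
      Integrable (fun ω => f (Function.update (u ω) k (t ω))) P := by
    intro t htm
    refine Integrable.of_bound (hfm.comp (measurable_pi_lambda _ fun l => ?_)).aestronglyMeasurable
      K (Eventually.of_forall fun _ => ht.abs_f_le _)
    by_cases hl : l = k
    · subst hl; simpa using htm
    · simpa [Function.update_of_ne hl, Function.comp_def] using (measurable_pi_apply l).comp hum
  have hgi : Integrable (fun ω => g k (u ω)) P :=
    integrable_comp_hybrid hY N k (ht.continuous_g k) (ht.abs_g_le k) x
  have hhi : Integrable (fun ω => h k (u ω)) P :=
    integrable_comp_hybrid hY N k (ht.continuous_h k) (ht.abs_h_le k) x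
  have hY1 : Integrable (Y k) P := hY2.integrable one_le_two
  have hYsq : Integrable (fun ω => Y k ω ^ 2) P := hY2.integrable_sq
  have hYg : Integrable (fun ω => Y k ω * g k (u ω)) P :=
    hY1.mul_bdd (c := K / (n * √n)) hgi.aestronglyMeasurable
      (Eventually.of_forall fun _ => ht.abs_g_le k _)
  have hYh : Integrable (fun ω => Y k ω ^ 2 * h k (u ω)) P :=
    hYsq.mul_bdd (c := K / n ^ 2) hhi.aestronglyMeasurable
      (Eventually.of_forall fun _ => ht.abs_h_le k _)
  have hindu : IndepFun (Y k) u P := by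
    have : u = (fun y : ℕ → ℝ => hybrid N k x y) ∘
        (fun ω l => if l ∈ Finset.Ioc k N then Y l ω else 0) := by
      funext ω l
      simp only [hu, hybrid, Function.comp_apply]
      split_ifs <;> rfl
    rw [this]
    exact hind.comp measurable_id ((continuous_hybrid N k).measurable.comp
      (measurable_const.prodMk measurable_id))
  have i1 : ∫ ω, Y k ω * g k (u ω) ∂P = 0 := by
    have := (hindu.comp measurable_id (ht.continuous_g k).measurable).integral_fun_mul_eq_mul_integral
      hY1.aestronglyMeasurable hgi.aestronglyMeasurable
    simp only [Function.comp_apply, id] at this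
    rw [this, hY0, zero_mul]
  have i2 : ∫ ω, Y k ω ^ 2 * h k (u ω) ∂P
      = (∫ ω, Y k ω ^ 2 ∂P) * hybridMean P Y N k (h k) x := by
    have := (hindu.comp (measurable_id.pow_const 2)
      (ht.continuous_h k).measurable).integral_fun_mul_eq_mul_integral
      hYsq.aestronglyMeasurable hhi.aestronglyMeasurable
    simp only [Function.comp_apply, id] at this
    exact this
  have t1 : ∀ ω, |f (Function.update (u ω) k (x k)) - f (u ω) - x k * g k (u ω)
      - x k ^ 2 * h k (u ω)| ≤ K / n * (|x k| / √n) ^ (2 + δ) := fun ω =>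
    ht.taylor k (u ω) (x k) (hybrid_self N k _ _)
  have t2 : ∀ ω, |f (Function.update (u ω) k (Y k ω)) - f (u ω) - Y k ω * g k (u ω)
      - Y k ω ^ 2 * h k (u ω)| ≤ K / n * (|Y k ω| / √n) ^ (2 + δ) := fun ω =>
    ht.taylor k (u ω) (Y k ω) (hybrid_self N k _ _)
  have hf0 : Integrable (fun ω => f (u ω)) P :=
    integrable_comp_hybrid hY N k ht.continuous_f ht.abs_f_le x
  have hYδ' : Integrable (fun ω => K / n * (|Y k ω| / √n) ^ (2 + δ)) P := by
    refine Integrable.const_mul ?_ _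
    refine (hYδ.div_const (√(n : ℝ) ^ (2 + δ))).congr (Eventually.of_forall fun ω => ?_)
    simp only
    rw [Real.div_rpow (abs_nonneg _) (Real.sqrt_nonneg _)]
  simp_rw [e1, e2]
  have key : (∫ ω, f (Function.update (u ω) k (x k)) ∂P)
      - (∫ ω, f (Function.update (u ω) k (Y k ω)) ∂P) - x k * hybridMean P Y N k (g k) x
      - (x k ^ 2 - ∫ ω, Y k ω ^ 2 ∂P) * hybridMean P Y N k (h k) x
      = (∫ ω, (f (Function.update (u ω) k (x k)) - f (u ω) - x k * g k (u ω)
          - x k ^ 2 * h k (u ω)) ∂P)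
        - ∫ ω, (f (Function.update (u ω) k (Y k ω)) - f (u ω) - Y k ω * g k (u ω)
          - Y k ω ^ 2 * h k (u ω)) ∂P := by
    rw [integral_sub_sub_sub (hupd measurable_const) hf0 (hgi.const_mul _) (hhi.const_mul _),
      integral_sub_sub_sub (hupd (hY k)) hf0 hYg hYh, integral_const_mul, integral_const_mul,
      i1, i2]
    simp only [hybridMean, hu]
    ring
  rw [key, mul_add]
  refine (abs_sub _ _).trans (add_le_add (abs_integral_le_of_abs_le t1) ?_)
  rw [← integral_const_mul]
  exact (abs_integral_le_integral_abs).trans (integral_mono_of_nonneg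
    (Eventually.of_forall fun _ => abs_nonneg _) hYδ' (Eventually.of_forall t2))

theorem lindeberg_sum (ht : SmoothTest n δ K f g h) (hY : ∀ l, Measurable (Y l))
    (hY2 : ∀ k, MemLp (Y k) 2 P)
    (hYδ : ∀ k, Integrable (fun ω => |Y k ω| ^ (2 + δ)) P) (hY0 : ∀ k, ∫ ω, Y k ω ∂P = 0)
    (hind : ∀ k N, 1 ≤ k → IndepFun (Y k) (fun ω l => if l ∈ Finset.Ioc k N then Y l ω else 0) P)
    (x : ℕ → ℝ) :
    |f x - (∫ ω, f (fun l => Y l ω) ∂P)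
      - ∑ k ∈ Finset.Icc 1 (rowStart (n + 1)), x k * hybridMean P Y (rowStart (n + 1)) k (g k) x
      - ∑ k ∈ Finset.Icc 1 (rowStart (n + 1)),
        (x k ^ 2 - ∫ ω, Y k ω ^ 2 ∂P) * hybridMean P Y (rowStart (n + 1)) k (h k) x|
      ≤ ∑ k ∈ Finset.Icc 1 (rowStart (n + 1)),
        K / n * ((|x k| / √n) ^ (2 + δ) + ∫ ω, (|Y k ω| / √n) ^ (2 + δ) ∂P) := by
  set N := rowStart (n + 1) with hN
  have h0 : ∫ ω, f (splice 0 x fun l => Y l ω) ∂P = ∫ ω, f (fun l => Y l ω) ∂P := by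
    congr 1
    funext ω
    refine ht.f_congr _ _ fun l hl => ?_
    rw [Finset.mem_Icc] at hl
    rw [splice, if_neg (by omega)]
  have hNN : ∫ ω, f (splice N x fun l => Y l ω) ∂P = f x := by
    have : ∀ ω, f (splice N x fun l => Y l ω) = f x := fun ω =>
      ht.f_congr _ _ fun l hl => by
        rw [Finset.mem_Icc] at hl
        rw [splice, if_pos hl.2]
    simp [this]
  have htel : ∀ N, ∑ k ∈ Finset.Icc 1 N, ((∫ ω, f (splice k x fun l => Y l ω) ∂P)
      - ∫ ω, f (splice (k - 1) x fun l => Y l ω) ∂P)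
      = (∫ ω, f (splice N x fun l => Y l ω) ∂P) - ∫ ω, f (splice 0 x fun l => Y l ω) ∂P := by
    intro N
    induction N with
    | zero => simp
    | succ N ih =>
      rw [Finset.sum_Icc_succ_top (by omega), ih, Nat.add_sub_cancel]
      ring
  rw [← h0, show f x = _ from hNN.symm, ← htel N, ← Finset.sum_sub_distrib, ← Finset.sum_sub_distrib]
  refine (Finset.abs_sum_le_sum_abs _ _).trans (Finset.sum_le_sum fun k hk => ?_)
  have hk1 := (Finset.mem_Icc.1 hk).1
  exact lindeberg_step ht hY hk1 (hY2 k) (hYδ k) (hY0 k) (hind k N hk1) x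

end Lindeberg

end MartingaleMatrix

namespace MartingaleMatrix

section NaturalFiltration

variable {Ω : Type*}

theorem naturalSigma_le [mΩ : MeasurableSpace Ω] {D : ℕ → Ω → ℝ} (hD : ∀ k, 1 ≤ k → Measurable (D k))
    (k : ℕ) : naturalSigma D k ≤ mΩ :=
  iSup₂_le fun j hj => (hD j hj.1).comap_le

theorem naturalSigma_mono (D : ℕ → Ω → ℝ) {k l : ℕ} (h : k ≤ l) :
    naturalSigma D k ≤ naturalSigma D l :=
  iSup₂_le fun j hj => le_iSup₂_of_le (f := fun j (_ : j ∈ Set.Icc 1 l) =>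
    MeasurableSpace.comap (D j) inferInstance) j ⟨hj.1, hj.2.trans h⟩ le_rfl

theorem measurable_naturalSigma (D : ℕ → Ω → ℝ) {j k : ℕ} (hj : 1 ≤ j) (hjk : j ≤ k) :
    Measurable[naturalSigma D k] (D j) :=
  measurable_iff_comap_le.2 (le_iSup₂_of_le (f := fun j (_ : j ∈ Set.Icc 1 k) =>
    MeasurableSpace.comap (D j) inferInstance) j ⟨hj, hjk⟩ le_rfl)

end NaturalFiltration

section Centering

variable {Ω : Type*} {mΩ : MeasurableSpace Ω} {P : Measure Ω} [IsProbabilityMeasure P]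

theorem condExp_sub_condExp_eq_zero {m : MeasurableSpace Ω} (hm : m ≤ mΩ) {u : Ω → ℝ}
    (hu : Integrable u P) : P[fun ω => u ω - (P[u | m]) ω | m] =ᵐ[P] 0 := by
  filter_upwards [condExp_sub hu (integrable_condExp (m := m) (f := u)) m] with ω h
  have h2 : P[P[u | m] | m] = P[u | m] :=
    condExp_of_stronglyMeasurable hm stronglyMeasurable_condExp integrable_condExp
  rw [h2] at h
  exact h.trans (sub_self _)

theorem abs_sub_condExp_le {m : MeasurableSpace Ω} (hm : m ≤ mΩ) {u : Ω → ℝ} {B : ℝ}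
    (hu : Integrable u P) (h0 : ∀ᵐ ω ∂P, 0 ≤ u ω) (hB : ∀ᵐ ω ∂P, u ω ≤ B) :
    ∀ᵐ ω ∂P, |u ω - (P[u | m]) ω| ≤ B := by
  have h1 : 0 ≤ᵐ[P] P[u | m] := condExp_nonneg h0
  have h2 : P[u | m] ≤ᵐ[P] P[fun _ => B | m] := condExp_mono hu (integrable_const B) hB
  rw [condExp_const hm] at h2
  filter_upwards [h0, hB, h1, h2] with ω a b (c : 0 ≤ (P[u | m]) ω) d
  rw [abs_le]
  constructor <;> linarith

theorem memLp_two_sub_condExp {m : MeasurableSpace Ω} (hm : m ≤ mΩ) {u : Ω → ℝ} {B : ℝ}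
    (hu : Integrable u P) (h0 : ∀ᵐ ω ∂P, 0 ≤ u ω) (hB : ∀ᵐ ω ∂P, u ω ≤ B) :
    MemLp (fun ω => u ω - (P[u | m]) ω) 2 P ∧ ∫ ω, (u ω - (P[u | m]) ω) ^ 2 ∂P ≤ B ^ 2 := by
  have h1 := abs_sub_condExp_le hm hu h0 hB
  have h2 : MemLp (fun ω => u ω - (P[u | m]) ω) 2 P :=
    MemLp.of_bound (hu.sub integrable_condExp).aestronglyMeasurable B h1
  refine ⟨h2, ?_⟩
  calc ∫ ω, (u ω - (P[u | m]) ω) ^ 2 ∂P ≤ ∫ _ω, B ^ 2 ∂P := by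
        refine integral_mono_ae h2.integrable_sq (integrable_const _) ?_
        filter_upwards [h1] with ω h
        rw [← sq_abs]
        exact pow_le_pow_left₀ (abs_nonneg _) h 2
    _ = B ^ 2 := by simp

variable {Ω' : Type*} {mΩ' : MeasurableSpace Ω'} {P' : Measure Ω'} [IsProbabilityMeasure P']

theorem lintegral_prod_le_of_ae_left {v : Ω × Ω' → ENNReal} (hv : AEMeasurable v (P.prod P'))
    {B : ENNReal} (h : ∀ᵐ ω ∂P, ∫⁻ ω', v (ω, ω') ∂P' ≤ B) : ∫⁻ p, v p ∂(P.prod P') ≤ B := by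
  rw [lintegral_prod _ hv]
  exact (lintegral_mono_ae h).trans (by simp)

theorem lintegral_prod_le_of_ae_right {v : Ω × Ω' → ENNReal} (hv : AEMeasurable v (P.prod P'))
    {B : ENNReal} (h : ∀ᵐ ω' ∂P', ∫⁻ ω, v (ω, ω') ∂P ≤ B) : ∫⁻ p, v p ∂(P.prod P') ≤ B := by
  rw [lintegral_prod_symm _ hv]
  exact (lintegral_mono_ae h).trans (by simp)

end Centering

section Model

open scoped Classical

section

variable {Ω₁ Ω₂ Ω₃ : Type*} [MeasurableSpace Ω₃]

/-- The entries of the matrix, read row by row. -/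
def prodEntry (γ : ℕ → Ω₁ → ℝ) (D : ℕ → Ω₂ → ℝ) (p : Ω₁ × Ω₂) : ℕ → ℝ := fun l =>
  γ l p.1 * D l p.2

/-- The entries `x l` with `good k l`; the other entries are replaced by zero. -/
def keepGood (good : ℕ → ℕ → Prop) (k : ℕ) (x : ℕ → ℝ) : ℕ → ℝ := fun l =>
  if good k l then x l else 0

/-- The coefficient of the second order term at `k`, from the entries `l` with `good k l`. -/
def goodWeight (P₃ : Measure Ω₃) (Y : ℕ → Ω₃ → ℝ) (γ : ℕ → Ω₁ → ℝ) (D : ℕ → Ω₂ → ℝ)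
    (good : ℕ → ℕ → Prop) (h : ℕ → (ℕ → ℝ) → ℝ) (N k : ℕ) (p : Ω₁ × Ω₂) : ℝ :=
  hybridMean P₃ Y N k (h k) (keepGood good k (prodEntry γ D p))

end

set_option linter.unusedSectionVars false

variable {Ω₁ Ω₂ Ω₃ : Type*} [mΩ₁ : MeasurableSpace Ω₁] [mΩ₂ : MeasurableSpace Ω₂]
  [mΩ₃ : MeasurableSpace Ω₃]

/-- The probabilistic assumptions on the factors `γ`, `D` of the entries and on the comparison
sequence `Y`, each on its own probability space. -/
structure ProductModel (P₁ : Measure Ω₁) (P₂ : Measure Ω₂) (P₃ : Measure Ω₃) (γ : ℕ → Ω₁ → ℝ)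
    (D : ℕ → Ω₂ → ℝ) (Y : ℕ → Ω₃ → ℝ) (δ L c : ℝ) : Prop where
  measurable_γ : ∀ k, Measurable (γ k)
  measurable_D : ∀ k, Measurable (D k)
  measurable_Y : ∀ k, Measurable (Y k)
  delta_pos : 0 < δ
  delta_le : δ ≤ 1
  L_nonneg : 0 ≤ L
  c_nonneg : 0 ≤ c
  moment_D : ∀ k, ∫⁻ ω, ENNReal.ofReal (|D k ω| ^ (2 + δ)) ∂P₂ ≤ ENNReal.ofReal L
  moment_Y : ∀ k, ∫⁻ ω, ENNReal.ofReal (|Y k ω| ^ (2 + δ)) ∂P₃ ≤ ENNReal.ofReal L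
  condExp_D : ∀ k, 1 ≤ k → P₂[D k | naturalSigma D (k - 1)] =ᵐ[P₂] 0
  bound_γ : ∀ᵐ ω ∂P₁, ∀ k, |γ k ω| ≤ c
  mean_Y : ∀ k, ∫ ω, Y k ω ∂P₃ = 0
  variance_Y : ∀ k, ∫ ω, Y k ω ^ 2 ∂P₃ = (∫ ω, γ k ω ^ 2 ∂P₁) * ∫ ω, D k ω ^ 2 ∂P₂
  indep_Y : ∀ k N, 1 ≤ k →
    IndepFun (Y k) (fun ω l => if l ∈ Finset.Ioc k N then Y l ω else 0) P₃

/-- A system of `σ`-algebras generated by the entries `γ l` with `good k l`, together with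
counting bounds for the excluded entries. -/
structure PastSystem (γ : ℕ → Ω₁ → ℝ) (a : ℕ) (κ : ℝ) (G : ℕ → MeasurableSpace Ω₁)
    (good far : ℕ → ℕ → Prop) : Prop where
  le : ∀ k, G k ≤ mΩ₁
  add_le : ∀ k l, good k l → l + a ≤ k
  measurable : ∀ k l, 1 ≤ l → good k l → Measurable[G k] (γ l)
  card_bad : ∀ k, (((Finset.Ico 1 k).filter fun l => ¬ good k l).card : ℝ) ≤ κ
  far_le : ∀ k l, far k l → G l ≤ G k
  far_good : ∀ k l l', far k l → 1 ≤ l' → l' ≤ l → good k l'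
  card_close : ∀ n, ∀ k ∈ Finset.Icc 1 (rowStart (n + 1)),
    (((Finset.Icc 1 (rowStart (n + 1))).filter fun l => ¬ far k l ∧ ¬ far l k).card : ℝ) ≤ κ * n

variable {P₁ : Measure Ω₁} {P₂ : Measure Ω₂} {P₃ : Measure Ω₃} [IsProbabilityMeasure P₁]
  [IsProbabilityMeasure P₂] [IsProbabilityMeasure P₃] {γ : ℕ → Ω₁ → ℝ} {D : ℕ → Ω₂ → ℝ}
  {Y : ℕ → Ω₃ → ℝ} {δ L c : ℝ}

theorem integrable_of_lintegral_le {Ω : Type*} [MeasurableSpace Ω] {P : Measure Ω} {u : Ω → ℝ}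
    (hu : AEStronglyMeasurable u P) (h0 : ∀ ω, 0 ≤ u ω) {B : ℝ}
    (h : ∫⁻ ω, ENNReal.ofReal (u ω) ∂P ≤ ENNReal.ofReal B) : Integrable u P := by
  refine ⟨hu, ?_⟩
  rw [hasFiniteIntegral_iff_ofReal (Eventually.of_forall h0)]
  exact h.trans_lt ENNReal.ofReal_lt_top

theorem integral_le_of_lintegral_le {Ω : Type*} [MeasurableSpace Ω] {P : Measure Ω} {u : Ω → ℝ}
    (hu : AEStronglyMeasurable u P) (h0 : ∀ ω, 0 ≤ u ω) {B : ℝ} (hB : 0 ≤ B)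
    (h : ∫⁻ ω, ENNReal.ofReal (u ω) ∂P ≤ ENNReal.ofReal B) : ∫ ω, u ω ∂P ≤ B := by
  rw [integral_eq_lintegral_of_nonneg_ae (Eventually.of_forall h0) hu]
  exact ENNReal.toReal_le_of_le_ofReal hB h

theorem memLp_two_of_moment {Ω : Type*} [MeasurableSpace Ω] {P : Measure Ω}
    [IsProbabilityMeasure P] {u : Ω → ℝ} (hu : Measurable u) (hδ : 0 < δ) (hL : 0 ≤ L)
    (h : ∫⁻ ω, ENNReal.ofReal (|u ω| ^ (2 + δ)) ∂P ≤ ENNReal.ofReal L) :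
    MemLp u 2 P ∧ ∫ ω, u ω ^ 2 ∂P ≤ 1 + L := by
  have h2 := lintegral_sq_le hδ hL h
  have hm : AEStronglyMeasurable (fun ω => u ω ^ 2) P := (hu.pow_const 2).aestronglyMeasurable
  exact ⟨(memLp_two_iff_integrable_sq hu.aestronglyMeasurable).2
    (integrable_of_lintegral_le hm (fun _ => sq_nonneg _) h2),
    integral_le_of_lintegral_le hm (fun _ => sq_nonneg _) (by linarith) h2⟩

namespace ProductModel

theorem memLp_D (hM : ProductModel P₁ P₂ P₃ γ D Y δ L c) (k : ℕ) : MemLp (D k) 2 P₂ :=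
  (memLp_two_of_moment (hM.measurable_D k) hM.delta_pos hM.L_nonneg (hM.moment_D k)).1

theorem integral_D_sq_le (hM : ProductModel P₁ P₂ P₃ γ D Y δ L c) (k : ℕ) :
    ∫ ω, D k ω ^ 2 ∂P₂ ≤ 1 + L :=
  (memLp_two_of_moment (hM.measurable_D k) hM.delta_pos hM.L_nonneg (hM.moment_D k)).2

theorem memLp_Y (hM : ProductModel P₁ P₂ P₃ γ D Y δ L c) (k : ℕ) : MemLp (Y k) 2 P₃ :=
  (memLp_two_of_moment (hM.measurable_Y k) hM.delta_pos hM.L_nonneg (hM.moment_Y k)).1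

theorem sq_γ_le (hM : ProductModel P₁ P₂ P₃ γ D Y δ L c) (k : ℕ) :
    ∀ᵐ ω ∂P₁, γ k ω ^ 2 ≤ c ^ 2 := by
  filter_upwards [hM.bound_γ] with ω h
  rw [← sq_abs]
  exact pow_le_pow_left₀ (abs_nonneg _) (h k) 2

theorem integrable_sq_γ (hM : ProductModel P₁ P₂ P₃ γ D Y δ L c) (k : ℕ) :
    Integrable (fun ω => γ k ω ^ 2) P₁ := by
  refine Integrable.of_bound ((hM.measurable_γ k).pow_const 2).aestronglyMeasurable (c ^ 2) ?_
  filter_upwards [hM.sq_γ_le k] with ω h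
  rwa [Real.norm_eq_abs, abs_of_nonneg (sq_nonneg _)]

theorem naturalSigma_le' (hM : ProductModel P₁ P₂ P₃ γ D Y δ L c) (k : ℕ) :
    naturalSigma D k ≤ mΩ₂ :=
  naturalSigma_le (fun k _ => hM.measurable_D k) k

end ProductModel

theorem measurable_prodEntry (hM : ProductModel P₁ P₂ P₃ γ D Y δ L c) (l : ℕ) :
    Measurable fun p : Ω₁ × Ω₂ => prodEntry γ D p l :=
  ((hM.measurable_γ l).comp measurable_fst).mul ((hM.measurable_D l).comp measurable_snd)

theorem lintegral_prodEntry_le (hM : ProductModel P₁ P₂ P₃ γ D Y δ L c) (l : ℕ) :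
    ∫⁻ p, ENNReal.ofReal (|prodEntry γ D p l| ^ (2 + δ)) ∂(P₁.prod P₂)
      ≤ ENNReal.ofReal (c ^ (2 + δ) * L) := by
  have hδ := hM.delta_pos
  have hc := hM.c_nonneg
  refine lintegral_prod_le_of_ae_left
    (((measurable_prodEntry hM l).norm.pow_const _).ennreal_ofReal.aemeasurable) ?_
  filter_upwards [hM.bound_γ] with ω h
  calc ∫⁻ ω', ENNReal.ofReal (|prodEntry γ D (ω, ω') l| ^ (2 + δ)) ∂P₂
      ≤ ∫⁻ ω', ENNReal.ofReal (c ^ (2 + δ) * |D l ω'| ^ (2 + δ)) ∂P₂ := by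
        refine lintegral_mono fun ω' => ENNReal.ofReal_le_ofReal ?_
        rw [prodEntry, abs_mul, Real.mul_rpow (abs_nonneg _) (abs_nonneg _)]
        gcongr
        exact h l
    _ = ENNReal.ofReal (c ^ (2 + δ)) * ∫⁻ ω', ENNReal.ofReal (|D l ω'| ^ (2 + δ)) ∂P₂ :=
        lintegral_ofReal_const_mul (by positivity) _
          ((hM.measurable_D l).norm.pow_const _).aemeasurable
    _ ≤ ENNReal.ofReal (c ^ (2 + δ)) * ENNReal.ofReal L := by gcongr; exact hM.moment_D l
    _ = _ := by rw [ENNReal.ofReal_mul (by positivity)]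

variable {n : ℕ} {K : ℝ} {f : (ℕ → ℝ) → ℝ} {g h : ℕ → (ℕ → ℝ) → ℝ}

theorem SmoothTest.K_nonneg (ht : SmoothTest n δ K f g h) : 0 ≤ K :=
  (abs_nonneg _).trans (ht.abs_f_le 0)

theorem card_Icc_rowStart_le (n : ℕ) :
    ((Finset.Icc 1 (rowStart (n + 1))).card : ℝ) ≤ (n : ℝ) ^ 2 := by
  rw [Nat.card_Icc, Nat.add_sub_cancel]
  exact_mod_cast rowStart_succ_le_sq n

/-- The first order term of the expansion. -/
def firstTerm (P₃ : Measure Ω₃) (Y : ℕ → Ω₃ → ℝ) (γ : ℕ → Ω₁ → ℝ) (D : ℕ → Ω₂ → ℝ)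
    (g : ℕ → (ℕ → ℝ) → ℝ) (N : ℕ) (p : Ω₁ × Ω₂) : ℝ :=
  ∑ k ∈ Finset.Icc 1 N, (hybridMean P₃ Y N k (g k) (prodEntry γ D p) * γ k p.1) * D k p.2

theorem measurable_firstTerm (hM : ProductModel P₁ P₂ P₃ γ D Y δ L c)
    (ht : SmoothTest n δ K f g h) (N : ℕ) : Measurable (firstTerm P₃ Y γ D g N) := by
  refine Finset.measurable_fun_sum _ fun k _ => ?_
  exact ((stronglyMeasurable_hybridMean hM.measurable_Y N k (ht.continuous_g k) (ht.abs_g_le k)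
    fun l _ => measurable_prodEntry hM l).measurable.mul
      ((hM.measurable_γ k).comp measurable_fst)).mul ((hM.measurable_D k).comp measurable_snd)

theorem lintegral_firstTerm_sq_le (hM : ProductModel P₁ P₂ P₃ γ D Y δ L c)
    (ht : SmoothTest n δ K f g h) (hn : 0 < n) :
    ∫⁻ p, ENNReal.ofReal (firstTerm P₃ Y γ D g (rowStart (n + 1)) p ^ 2) ∂(P₁.prod P₂)
      ≤ ENNReal.ofReal ((K * c) ^ 2 * (1 + L) / n) := by
  have hn' : (0 : ℝ) < n := by exact_mod_cast hn
  have hK := ht.K_nonneg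
  have hL := hM.L_nonneg
  have hc0 := hM.c_nonneg
  refine lintegral_prod_le_of_ae_left
    ((measurable_firstTerm hM ht _).pow_const 2).ennreal_ofReal.aemeasurable ?_
  filter_upwards [hM.bound_γ] with ω hω
  have h1 := lintegral_sq_weighted_sum_le (P := P₂) (s := Finset.Icc 1 (rowStart (n + 1)))
    (m := fun k => naturalSigma D (k - 1)) (fun k => hM.naturalSigma_le' _)
    (w := fun k ω' => hybridMean P₃ Y (rowStart (n + 1)) k (g k) (prodEntry γ D (ω, ω')) * γ k ω)
    (d := D) (b := K / (n * √n) * c) (v := 1 + L) (κ := 1) (far := fun k l => l < k)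
    (fun k hk => ?_) (fun k hk ω' => ?_) (fun k _ => hM.memLp_D k)
    (fun k _ => hM.integral_D_sq_le k) (fun k hk => hM.condExp_D k (Finset.mem_Icc.1 hk).1)
    (fun k hk l hl hkl => ?_) (fun k hk => ?_)
  · refine h1.trans (ENNReal.ofReal_le_ofReal ?_)
    have hs : √(n : ℝ) ^ 2 = n := Real.sq_sqrt hn'.le
    calc _ ≤ (n : ℝ) ^ 2 * (1 * ((K / (n * √n) * c) ^ 2 * (1 + L))) := by
          gcongr
          exact card_Icc_rowStart_le n
      _ = (K * c) ^ 2 * (1 + L) / n := by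
          rw [mul_pow (K / _), div_pow, mul_pow (n : ℝ), hs]
          field_simp
  · refine (stronglyMeasurable_hybridMean hM.measurable_Y _ k (ht.continuous_g k) (ht.abs_g_le k)
      fun l hl => ?_).mul stronglyMeasurable_const
    rw [Finset.mem_Ico] at hl
    exact (measurable_naturalSigma D hl.1 (by omega)).const_mul (γ l ω)
  · rw [abs_mul]
    exact mul_le_mul (abs_hybridMean_le _ k (ht.abs_g_le k) _) (hω k) (abs_nonneg _)
      (by positivity)
  · rw [Finset.mem_Icc] at hl
    refine ((stronglyMeasurable_hybridMean hM.measurable_Y _ l (ht.continuous_g l) (ht.abs_g_le l)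
      fun l' hl' => ?_).mul stronglyMeasurable_const).mul
        (measurable_naturalSigma D hl.1 (by omega)).stronglyMeasurable
    rw [Finset.mem_Ico] at hl'
    exact (measurable_naturalSigma D hl'.1 (by omega)).const_mul (γ l' ω)
  · have : ∀ t : Finset ℕ, (∀ l ∈ t, l = k) → (t.card : ℝ) ≤ 1 := fun t h => by
      exact_mod_cast Finset.card_le_one.2 fun i hi j hj => (h i hi).trans (h j hj).symm
    refine this _ fun l hl => ?_
    simp only [Finset.mem_filter] at hl
    omega

theorem abs_goodWeight_le (ht : SmoothTest n δ K f g h) (good : ℕ → ℕ → Prop) (N k : ℕ)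
    (p : Ω₁ × Ω₂) : |goodWeight P₃ Y γ D good h N k p| ≤ K / n ^ 2 :=
  abs_hybridMean_le N k (ht.abs_h_le k) _

theorem measurable_goodWeight (hM : ProductModel P₁ P₂ P₃ γ D Y δ L c)
    (ht : SmoothTest n δ K f g h) (good : ℕ → ℕ → Prop) (N k : ℕ) :
    Measurable (goodWeight P₃ Y γ D good h N k) := by
  refine (stronglyMeasurable_hybridMean hM.measurable_Y N k (ht.continuous_h k) (ht.abs_h_le k)
    (X := fun l p => keepGood good k (prodEntry γ D p) l) fun l _ => ?_).measurable
  unfold keepGood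
  split_ifs
  · exact measurable_prodEntry hM l
  · exact measurable_const

theorem stronglyMeasurable_goodWeight_right (hY : ∀ l, Measurable (Y l))
    (ht : SmoothTest n δ K f g h) {good : ℕ → ℕ → Prop} {a k : ℕ}
    (hg : ∀ l, good k l → l + a ≤ k) (N : ℕ) (ω : Ω₁) :
    StronglyMeasurable[naturalSigma D (k - a)] fun ω' =>
      goodWeight P₃ Y γ D good h N k (ω, ω') := by
  refine stronglyMeasurable_hybridMean hY N k (ht.continuous_h k) (ht.abs_h_le k)
    (X := fun l ω' => keepGood good k (prodEntry γ D (ω, ω')) l) fun l hl => ?_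
  unfold keepGood
  rw [Finset.mem_Ico] at hl
  split_ifs with hgood
  · exact (measurable_naturalSigma D hl.1 (by have := hg l hgood; omega)).const_mul (γ l ω)
  · exact measurable_const

theorem stronglyMeasurable_goodWeight_left (hY : ∀ l, Measurable (Y l))
    (ht : SmoothTest n δ K f g h) {good : ℕ → ℕ → Prop} {k : ℕ} {m : MeasurableSpace Ω₁}
    (hg : ∀ l, 1 ≤ l → good k l → Measurable[m] (γ l)) (N : ℕ) (ω' : Ω₂) :
    StronglyMeasurable[m] fun ω => goodWeight P₃ Y γ D good h N k (ω, ω') := by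
  refine stronglyMeasurable_hybridMean hY N k (ht.continuous_h k) (ht.abs_h_le k)
    (X := fun l ω => keepGood good k (prodEntry γ D (ω, ω')) l) fun l hl => ?_
  unfold keepGood
  rw [Finset.mem_Ico] at hl
  split_ifs with hgood
  · simpa only [prodEntry, mul_comm (γ l _)] using (hg l hl.1 hgood).const_mul (D l ω')
  · exact measurable_const

variable {a : ℕ} {κ : ℝ} {G : ℕ → MeasurableSpace Ω₁} {good far : ℕ → ℕ → Prop}

/-- The term that compares `γ²` with its conditional expectation given the past. -/
def fieldTerm (P₁ : Measure Ω₁) (P₂ : Measure Ω₂) (P₃ : Measure Ω₃) (Y : ℕ → Ω₃ → ℝ)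
    (γ : ℕ → Ω₁ → ℝ) (D : ℕ → Ω₂ → ℝ) (good : ℕ → ℕ → Prop) (G : ℕ → MeasurableSpace Ω₁)
    (h : ℕ → (ℕ → ℝ) → ℝ) (N : ℕ) (p : Ω₁ × Ω₂) : ℝ :=
  ∑ k ∈ Finset.Icc 1 N, (goodWeight P₃ Y γ D good h N k p * ∫ ω, D k ω ^ 2 ∂P₂)
    * (γ k p.1 ^ 2 - (P₁[fun ω => γ k ω ^ 2 | G k]) p.1)

theorem measurable_fieldTerm (hM : ProductModel P₁ P₂ P₃ γ D Y δ L c)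
    (ht : SmoothTest n δ K f g h) (hS : PastSystem γ a κ G good far) (N : ℕ) :
    Measurable (fieldTerm P₁ P₂ P₃ Y γ D good G h N) := by
  refine Finset.measurable_fun_sum _ fun k _ => ?_
  refine ((measurable_goodWeight hM ht good N k).mul_const _).mul ?_
  exact (((hM.measurable_γ k).pow_const 2).sub
    (stronglyMeasurable_condExp.mono (hS.le k)).measurable).comp measurable_fst

theorem lintegral_fieldTerm_sq_le (hM : ProductModel P₁ P₂ P₃ γ D Y δ L c)
    (ht : SmoothTest n δ K f g h) (hS : PastSystem γ a κ G good far) (hn : 0 < n) :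
    ∫⁻ p, ENNReal.ofReal (fieldTerm P₁ P₂ P₃ Y γ D good G h (rowStart (n + 1)) p ^ 2)
        ∂(P₁.prod P₂)
      ≤ ENNReal.ofReal (κ * (K * (1 + L) * c ^ 2) ^ 2 / n) := by
  have hn' : (0 : ℝ) < n := by exact_mod_cast hn
  have hK := ht.K_nonneg
  have hL := hM.L_nonneg
  have hκ : 0 ≤ κ := (Nat.cast_nonneg _).trans (hS.card_bad 0)
  refine lintegral_prod_le_of_ae_right
    ((measurable_fieldTerm hM ht hS _).pow_const 2).ennreal_ofReal.aemeasurable ?_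
  refine Eventually.of_forall fun ω' => ?_
  have hcen := fun k => memLp_two_sub_condExp (P := P₁) (hS.le k) (hM.integrable_sq_γ k)
    (Eventually.of_forall fun _ => sq_nonneg _) (hM.sq_γ_le k)
  have hmw : ∀ k l, (∀ l', 1 ≤ l' → good l l' → Measurable[G k] (γ l')) →
      StronglyMeasurable[G k] fun ω =>
        goodWeight P₃ Y γ D good h (rowStart (n + 1)) l (ω, ω') * ∫ ω, D l ω ^ 2 ∂P₂ :=
    fun k l hkl => (stronglyMeasurable_goodWeight_left hM.measurable_Y ht hkl _ ω').mul stronglyMeasurable_const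
  have h1 := lintegral_sq_weighted_sum_le (P := P₁) (s := Finset.Icc 1 (rowStart (n + 1)))
    (m := G) hS.le
    (w := fun k ω => goodWeight P₃ Y γ D good h (rowStart (n + 1)) k (ω, ω')
      * ∫ ω, D k ω ^ 2 ∂P₂)
    (d := fun k ω => γ k ω ^ 2 - (P₁[fun ω => γ k ω ^ 2 | G k]) ω) (b := K / n ^ 2 * (1 + L))
    (v := (c ^ 2) ^ 2) (κ := κ * n) (far := far)
    (fun k _ => hmw k k (hS.measurable k)) (fun k _ ω => ?_) (fun k _ => (hcen k).1)
    (fun k _ => (hcen k).2)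
    (fun k _ => condExp_sub_condExp_eq_zero (hS.le k) (hM.integrable_sq_γ k))
    (fun k hk l hl hkl => ?_) (hS.card_close n)
  · refine h1.trans (ENNReal.ofReal_le_ofReal ?_)
    calc _ ≤ (n : ℝ) ^ 2 * (κ * n * ((K / n ^ 2 * (1 + L)) ^ 2 * (c ^ 2) ^ 2)) := by
          gcongr
          exact card_Icc_rowStart_le n
      _ = _ := by field_simp
  · rw [abs_mul]
    refine mul_le_mul (abs_goodWeight_le ht good _ k _) ?_ (abs_nonneg _) (by positivity)
    rw [abs_of_nonneg (integral_nonneg fun _ => sq_nonneg _)]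
    exact hM.integral_D_sq_le k
  · rw [Finset.mem_Icc] at hl
    refine (hmw k l fun l' hl1 hgl => ?_).mul (StronglyMeasurable.sub ?_ ?_)
    · exact hS.measurable k l' hl1 (hS.far_good k l l' hkl hl1 (by have := hS.add_le l l' hgl; omega))
    · exact ((hS.measurable k l hl.1 (hS.far_good k l l hkl hl.1 le_rfl)).pow_const
        2).stronglyMeasurable
    · exact stronglyMeasurable_condExp.mono (hS.far_le k l hkl)

/-- The squares of `D` up to the truncation level `M`. -/
def truncSq (M : ℝ) (x : ℝ) : ℝ := if |x| ≤ M then x ^ 2 else 0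

theorem measurable_truncSq (M : ℝ) : Measurable (truncSq M) :=
  Measurable.ite (measurableSet_le measurable_norm measurable_const)
    (measurable_id.pow_const 2) measurable_const

theorem truncSq_nonneg (M x : ℝ) : 0 ≤ truncSq M x := by
  unfold truncSq
  split_ifs
  · exact sq_nonneg x
  · exact le_rfl

theorem truncSq_le (M x : ℝ) : truncSq M x ≤ M ^ 2 := by
  unfold truncSq
  split_ifs with h
  · rw [← sq_abs]
    exact pow_le_pow_left₀ (abs_nonneg _) h 2
  · exact sq_nonneg M

theorem sq_sub_truncSq_nonneg (M x : ℝ) : 0 ≤ x ^ 2 - truncSq M x := by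
  unfold truncSq
  split_ifs
  · simp
  · simpa using sq_nonneg x

theorem sq_sub_truncSq_le {M : ℝ} (hM : 0 < M) (hδ : 0 < δ) (x : ℝ) :
    x ^ 2 - truncSq M x ≤ (M ^ δ)⁻¹ * |x| ^ (2 + δ) := by
  unfold truncSq
  split_ifs with h
  · rw [sub_self]; positivity
  · push Not at h
    have hx : 0 < |x| := hM.trans h
    rw [sub_zero, Real.rpow_add hx, Real.rpow_two, sq_abs, inv_mul_eq_div,
      le_div_iff₀ (by positivity)]
    gcongr

/-- The term that compares the truncation of `D²` with its conditional expectation. -/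
def truncTerm (P₂ : Measure Ω₂) (P₃ : Measure Ω₃) (Y : ℕ → Ω₃ → ℝ)
    (γ : ℕ → Ω₁ → ℝ) (D : ℕ → Ω₂ → ℝ) (good : ℕ → ℕ → Prop)
    (h : ℕ → (ℕ → ℝ) → ℝ) (a N : ℕ) (M : ℝ) (p : Ω₁ × Ω₂) : ℝ :=
  ∑ k ∈ Finset.Icc 1 N, (goodWeight P₃ Y γ D good h N k p * γ k p.1 ^ 2)
    * (truncSq M (D k p.2) - (P₂[fun ω => truncSq M (D k ω) | naturalSigma D (k - a)]) p.2)

theorem integrable_truncSq (hM : ProductModel P₁ P₂ P₃ γ D Y δ L c) (M : ℝ) (k : ℕ) :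
    Integrable (fun ω => truncSq M (D k ω)) P₂ :=
  Integrable.of_bound ((measurable_truncSq M).comp (hM.measurable_D k)).aestronglyMeasurable
    (M ^ 2) (Eventually.of_forall fun ω => by
      rw [Real.norm_eq_abs, abs_of_nonneg (truncSq_nonneg _ _)]
      exact truncSq_le _ _)

theorem measurable_truncTerm (hM : ProductModel P₁ P₂ P₃ γ D Y δ L c)
    (ht : SmoothTest n δ K f g h) (good : ℕ → ℕ → Prop) (a N : ℕ) (M : ℝ) :
    Measurable (truncTerm P₂ P₃ Y γ D good h a N M) := by
  refine Finset.measurable_fun_sum _ fun k _ => ?_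
  refine ((measurable_goodWeight hM ht good N k).mul
    (((hM.measurable_γ k).pow_const 2).comp measurable_fst)).mul ?_
  exact (((measurable_truncSq M).comp (hM.measurable_D k)).sub
    (stronglyMeasurable_condExp.mono (hM.naturalSigma_le' _)).measurable).comp measurable_snd

theorem lintegral_truncTerm_sq_le (hM : ProductModel P₁ P₂ P₃ γ D Y δ L c)
    (ht : SmoothTest n δ K f g h) (hS : PastSystem γ a κ G good far) (hn : 0 < n) (M : ℝ) :
    ∫⁻ p, ENNReal.ofReal (truncTerm P₂ P₃ Y γ D good h a (rowStart (n + 1)) M p ^ 2)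
        ∂(P₁.prod P₂)
      ≤ ENNReal.ofReal (κ * (K * c ^ 2 * M ^ 2) ^ 2 / n) := by
  have hn' : (0 : ℝ) < n := by exact_mod_cast hn
  have hK := ht.K_nonneg
  have hκ : 0 ≤ κ := (Nat.cast_nonneg _).trans (hS.card_bad 0)
  refine lintegral_prod_le_of_ae_left
    ((measurable_truncTerm hM ht good a _ M).pow_const 2).ennreal_ofReal.aemeasurable ?_
  filter_upwards [hM.bound_γ] with ω hω
  have hcen := fun k => memLp_two_sub_condExp (P := P₂) (hM.naturalSigma_le' (k - a))
    (integrable_truncSq hM M k) (Eventually.of_forall fun _ => truncSq_nonneg _ _)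
    (Eventually.of_forall fun _ => truncSq_le _ _)
  have h1 := lintegral_sq_weighted_sum_le (P := P₂) (s := Finset.Icc 1 (rowStart (n + 1)))
    (m := fun k => naturalSigma D (k - a)) (fun k => hM.naturalSigma_le' _)
    (w := fun k ω' => goodWeight P₃ Y γ D good h (rowStart (n + 1)) k (ω, ω') * γ k ω ^ 2)
    (d := fun k ω' => truncSq M (D k ω')
      - (P₂[fun ω => truncSq M (D k ω) | naturalSigma D (k - a)]) ω')
    (b := K / n ^ 2 * c ^ 2) (v := (M ^ 2) ^ 2) (κ := κ * n) (far := far)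
    (fun k _ => (stronglyMeasurable_goodWeight_right hM.measurable_Y ht (hS.add_le k) _ ω).mul
      stronglyMeasurable_const) (fun k _ ω' => ?_) (fun k _ => (hcen k).1)
    (fun k _ => (hcen k).2)
    (fun k _ => condExp_sub_condExp_eq_zero (hM.naturalSigma_le' _) (integrable_truncSq hM M k))
    (fun k hk l hl hkl => ?_) (hS.card_close n)
  · refine h1.trans (ENNReal.ofReal_le_ofReal ?_)
    calc _ ≤ (n : ℝ) ^ 2 * (κ * n * ((K / n ^ 2 * c ^ 2) ^ 2 * (M ^ 2) ^ 2)) := by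
          gcongr
          exact card_Icc_rowStart_le n
      _ = _ := by field_simp
  · rw [abs_mul, abs_pow]
    exact mul_le_mul (abs_goodWeight_le ht good _ k _)
      (pow_le_pow_left₀ (abs_nonneg _) (hω k) 2) (by positivity) (by positivity)
  · rw [Finset.mem_Icc] at hl
    have hlk := hS.add_le k l (hS.far_good k l l hkl hl.1 le_rfl)
    have hmono : naturalSigma D (l - a) ≤ naturalSigma D (k - a) :=
      naturalSigma_mono D (by omega)
    refine (((stronglyMeasurable_goodWeight_right hM.measurable_Y ht (hS.add_le l) _ ω).mono hmono).mul
      stronglyMeasurable_const).mul (StronglyMeasurable.sub ?_ ?_)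
    · exact ((measurable_truncSq M).comp
        (measurable_naturalSigma D hl.1 (by omega))).stronglyMeasurable
    · exact stronglyMeasurable_condExp.mono hmono

end Model

end MartingaleMatrix

namespace MartingaleMatrix

section Remainders

open scoped Classical

set_option linter.unusedSectionVars false

variable {Ω₁ Ω₂ Ω₃ : Type*} [mΩ₁ : MeasurableSpace Ω₁] [mΩ₂ : MeasurableSpace Ω₂]
  [mΩ₃ : MeasurableSpace Ω₃]
  {P₁ : Measure Ω₁} {P₂ : Measure Ω₂} {P₃ : Measure Ω₃} [IsProbabilityMeasure P₁]
  [IsProbabilityMeasure P₂] [IsProbabilityMeasure P₃] {γ : ℕ → Ω₁ → ℝ} {D : ℕ → Ω₂ → ℝ}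
  {Y : ℕ → Ω₃ → ℝ} {δ L c : ℝ} {n : ℕ} {K : ℝ} {f : (ℕ → ℝ) → ℝ} {g h : ℕ → (ℕ → ℝ) → ℝ}
  {a : ℕ} {κ : ℝ} {G : ℕ → MeasurableSpace Ω₁} {good far : ℕ → ℕ → Prop}

theorem lintegral_ofReal_add_le {Ω : Type*} [MeasurableSpace Ω] {P : Measure Ω} {u v : Ω → ℝ}
    (hu : AEMeasurable u P) {A B : ℝ} (hA : 0 ≤ A) (hB : 0 ≤ B)
    (h1 : ∫⁻ ω, ENNReal.ofReal (u ω) ∂P ≤ ENNReal.ofReal A)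
    (h2 : ∫⁻ ω, ENNReal.ofReal (v ω) ∂P ≤ ENNReal.ofReal B) :
    ∫⁻ ω, ENNReal.ofReal (u ω + v ω) ∂P ≤ ENNReal.ofReal (A + B) := by
  rw [ENNReal.ofReal_add hA hB]
  refine (lintegral_mono fun ω => ENNReal.ofReal_add_le).trans ?_
  rw [lintegral_add_left' hu.ennreal_ofReal]
  exact add_le_add h1 h2

theorem lintegral_ofReal_const_mul_le {Ω : Type*} [MeasurableSpace Ω] {P : Measure Ω} {b : ℝ}
    (hb : 0 ≤ b) {v : Ω → ℝ} (hv : AEMeasurable v P) {A : ℝ}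
    (h : ∫⁻ ω, ENNReal.ofReal (v ω) ∂P ≤ ENNReal.ofReal A) :
    ∫⁻ ω, ENNReal.ofReal (b * v ω) ∂P ≤ ENNReal.ofReal (b * A) := by
  rw [lintegral_ofReal_const_mul hb v hv, ENNReal.ofReal_mul hb]
  gcongr

theorem div_sqrt_rpow (hn : 0 < n) (x : ℝ) :
    (|x| / √(n : ℝ)) ^ (2 + δ) = ((n : ℝ) * √n ^ δ)⁻¹ * |x| ^ (2 + δ) := by
  have hs : (0 : ℝ) < √n := Real.sqrt_pos.2 (by exact_mod_cast hn)
  rw [Real.div_rpow (abs_nonneg _) hs.le, Real.rpow_add hs, Real.rpow_two,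
    Real.sq_sqrt (Nat.cast_nonneg n), inv_mul_eq_div]

/-- The remainder of the second order expansion. -/
def taylorError (P₃ : Measure Ω₃) (Y : ℕ → Ω₃ → ℝ) (γ : ℕ → Ω₁ → ℝ) (D : ℕ → Ω₂ → ℝ)
    (δ K : ℝ) (n : ℕ) (p : Ω₁ × Ω₂) : ℝ :=
  ∑ k ∈ Finset.Icc 1 (rowStart (n + 1)), K / n * ((|prodEntry γ D p k| / √n) ^ (2 + δ)
    + ∫ ω, (|Y k ω| / √n) ^ (2 + δ) ∂P₃)

theorem integral_Y_rpow_le (hM : ProductModel P₁ P₂ P₃ γ D Y δ L c) (hn : 0 < n) (k : ℕ) :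
    ∫ ω, (|Y k ω| / √(n : ℝ)) ^ (2 + δ) ∂P₃ ≤ ((n : ℝ) * √n ^ δ)⁻¹ * L := by
  simp_rw [div_sqrt_rpow hn]
  rw [integral_const_mul]
  gcongr
  exact integral_le_of_lintegral_le ((hM.measurable_Y k).norm.pow_const _).aestronglyMeasurable
    (fun _ => Real.rpow_nonneg (abs_nonneg _) _) hM.L_nonneg (hM.moment_Y k)

theorem measurable_taylorError (hM : ProductModel P₁ P₂ P₃ γ D Y δ L c) (K : ℝ) (n : ℕ) :
    Measurable (taylorError P₃ Y γ D δ K n) := by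
  refine Finset.measurable_fun_sum _ fun k _ => ?_
  exact ((((measurable_prodEntry hM k).norm.div_const _).pow_const _).add_const _).const_mul _

theorem lintegral_taylorError_le (hM : ProductModel P₁ P₂ P₃ γ D Y δ L c) (hK : 0 ≤ K)
    (hn : 0 < n) :
    ∫⁻ p, ENNReal.ofReal (taylorError P₃ Y γ D δ K n p) ∂(P₁.prod P₂)
      ≤ ENNReal.ofReal (K * (c ^ (2 + δ) * L + L) * (√n ^ δ)⁻¹) := by
  have hn' : (0 : ℝ) < n := by exact_mod_cast hn
  have hL := hM.L_nonneg
  have hc := hM.c_nonneg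
  have hs : (0 : ℝ) < √n := Real.sqrt_pos.2 hn'
  have h0 : ∀ k, 0 ≤ ∫ ω, (|Y k ω| / √(n : ℝ)) ^ (2 + δ) ∂P₃ := fun k =>
    integral_nonneg fun _ => by positivity
  have hmeas : ∀ k, Measurable fun p => (|prodEntry γ D p k| / √(n : ℝ)) ^ (2 + δ) := fun k =>
    ((measurable_prodEntry hM k).norm.div_const _).pow_const _
  have h1 := lintegral_ofReal_sum_le (P := P₁.prod P₂) (s := Finset.Icc 1 (rowStart (n + 1)))
    (v := fun k p => K / n * ((|prodEntry γ D p k| / √n) ^ (2 + δ)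
      + ∫ ω, (|Y k ω| / √n) ^ (2 + δ) ∂P₃))
    (K := K / n * (((n : ℝ) * √n ^ δ)⁻¹ * (c ^ (2 + δ) * L) + ((n : ℝ) * √n ^ δ)⁻¹ * L))
    (fun k _ => (((hmeas k).add_const _).const_mul _).aemeasurable)
    (fun k p => by have := h0 k; positivity) (fun k _ => ?_)
  · refine h1.trans (ENNReal.ofReal_le_ofReal ?_)
    calc _ ≤ (n : ℝ) ^ 2 * (K / n * (((n : ℝ) * √n ^ δ)⁻¹ * (c ^ (2 + δ) * L)
          + ((n : ℝ) * √n ^ δ)⁻¹ * L)) := by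
          gcongr
          exact card_Icc_rowStart_le n
      _ = _ := by field_simp
  · refine lintegral_ofReal_const_mul_le (by positivity) ((hmeas k).add_const _).aemeasurable ?_
    refine lintegral_ofReal_add_le (hmeas k).aemeasurable (by positivity) (by positivity) ?_ ?_
    · simp_rw [div_sqrt_rpow hn]
      exact lintegral_ofReal_const_mul_le (by positivity)
        ((measurable_prodEntry hM k).norm.pow_const _).aemeasurable (lintegral_prodEntry_le hM k)
    · rw [lintegral_const, measure_univ, mul_one]
      exact ENNReal.ofReal_le_ofReal (integral_Y_rpow_le hM hn k)

theorem sq_mul_rpow_le {δ x y : ℝ} (hδ : 0 < δ) (hx : 0 ≤ x) (hy : 0 ≤ y) :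
    x ^ 2 * y ^ δ ≤ x ^ (2 + δ) + y ^ (2 + δ) := by
  have e : ∀ z : ℝ, 0 ≤ z → z ^ (2 + δ) = z ^ 2 * z ^ δ := by
    intro z hz
    rw [Real.rpow_add_of_nonneg hz zero_le_two hδ.le, Real.rpow_two]
  rcases le_total x y with hxy | hxy
  · have : x ^ 2 * y ^ δ ≤ y ^ 2 * y ^ δ := by gcongr
    rw [e y hy]
    linarith [Real.rpow_nonneg hx (2 + δ)]
  · have : x ^ 2 * y ^ δ ≤ x ^ 2 * x ^ δ := by gcongr
    rw [e x hx]
    linarith [Real.rpow_nonneg hy (2 + δ)]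

/-- The error made by replacing the entries that are not good by zero. -/
def badError (P₃ : Measure Ω₃) (Y : ℕ → Ω₃ → ℝ) (γ : ℕ → Ω₁ → ℝ) (D : ℕ → Ω₂ → ℝ)
    (good : ℕ → ℕ → Prop) (δ K : ℝ) (n : ℕ) (p : Ω₁ × Ω₂) : ℝ :=
  ∑ k ∈ Finset.Icc 1 (rowStart (n + 1)),
    K / n ^ 2 * ∑ l ∈ (Finset.Ico 1 k).filter fun l => ¬ good k l,
      (prodEntry γ D p k ^ 2 + ∫ ω, Y k ω ^ 2 ∂P₃) * (|prodEntry γ D p l| / √n) ^ δ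

theorem integral_Y_sq_nonneg (k : ℕ) : 0 ≤ ∫ ω, Y k ω ^ 2 ∂P₃ :=
  integral_nonneg fun _ => sq_nonneg _

theorem measurable_badError (hM : ProductModel P₁ P₂ P₃ γ D Y δ L c) (good : ℕ → ℕ → Prop)
    (K : ℝ) (n : ℕ) : Measurable (badError P₃ Y γ D good δ K n) := by
  refine Finset.measurable_fun_sum _ fun k _ => ?_
  refine (Finset.measurable_fun_sum _ fun l _ => ?_).const_mul _
  exact (((measurable_prodEntry hM k).pow_const 2).add_const _).mul
    (((measurable_prodEntry hM l).norm.div_const _).pow_const _)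

theorem integral_Y_sq_le (hM : ProductModel P₁ P₂ P₃ γ D Y δ L c) (k : ℕ) :
    ∫ ω, Y k ω ^ 2 ∂P₃ ≤ 1 + L :=
  (memLp_two_of_moment (hM.measurable_Y k) hM.delta_pos hM.L_nonneg (hM.moment_Y k)).2

theorem lintegral_badError_le (hM : ProductModel P₁ P₂ P₃ γ D Y δ L c)
    (hS : PastSystem γ a κ G good far) (hK : 0 ≤ K) (hn : 0 < n) :
    ∫⁻ p, ENNReal.ofReal (badError P₃ Y γ D good δ K n p) ∂(P₁.prod P₂)
      ≤ ENNReal.ofReal (K * κ * (3 * (c ^ (2 + δ) * L) + (√(1 + L)) ^ (2 + δ)) * (√n ^ δ)⁻¹) := by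
  have hn' : (0 : ℝ) < n := by exact_mod_cast hn
  have hL := hM.L_nonneg
  have hc := hM.c_nonneg
  have hδ := hM.delta_pos
  have hκ : 0 ≤ κ := (Nat.cast_nonneg _).trans (hS.card_bad 0)
  have hs : (0 : ℝ) < √n := Real.sqrt_pos.2 hn'
  set Q := c ^ (2 + δ) * L with hQ
  set S := (√(1 + L)) ^ (2 + δ) with hSdef
  have hQ0 : 0 ≤ Q := by positivity
  have hS0 : 0 ≤ S := by positivity
  have hm : ∀ l, AEMeasurable (fun p => |prodEntry γ D p l| ^ (2 + δ)) (P₁.prod P₂) := fun l =>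
    ((measurable_prodEntry hM l).norm.pow_const _).aemeasurable
  have hterm : ∀ k l, ∫⁻ p, ENNReal.ofReal ((prodEntry γ D p k ^ 2 + ∫ ω, Y k ω ^ 2 ∂P₃)
      * (|prodEntry γ D p l| / √n) ^ δ) ∂(P₁.prod P₂)
      ≤ ENNReal.ofReal ((√n ^ δ)⁻¹ * (3 * Q + S)) := by
    intro k l
    have hpt : ∀ p, (prodEntry γ D p k ^ 2 + ∫ ω, Y k ω ^ 2 ∂P₃)
        * (|prodEntry γ D p l| / √n) ^ δ ≤ (√n ^ δ)⁻¹ * (|prodEntry γ D p k| ^ (2 + δ)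
          + (|prodEntry γ D p l| ^ (2 + δ) + (|prodEntry γ D p l| ^ (2 + δ) + S))) := by
      intro p
      have h1 := sq_mul_rpow_le hδ (abs_nonneg (prodEntry γ D p k))
        (abs_nonneg (prodEntry γ D p l))
      have h2 := sq_mul_rpow_le hδ (Real.sqrt_nonneg (1 + L)) (abs_nonneg (prodEntry γ D p l))
      rw [Real.sq_sqrt (by linarith)] at h2
      rw [sq_abs] at h1
      rw [Real.div_rpow (abs_nonneg _) hs.le, div_eq_inv_mul, mul_left_comm]
      gcongr
      have h3 : (∫ ω, Y k ω ^ 2 ∂P₃) * |prodEntry γ D p l| ^ δ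
          ≤ (1 + L) * |prodEntry γ D p l| ^ δ := by
        gcongr
        exact integral_Y_sq_le hM k
      rw [add_mul]
      linarith
    refine (lintegral_mono fun p => ENNReal.ofReal_le_ofReal (hpt p)).trans ?_
    have hconst : ∫⁻ _p, ENNReal.ofReal S ∂(P₁.prod P₂) ≤ ENNReal.ofReal S := by simp
    have h4 := lintegral_ofReal_const_mul_le (b := (√(n : ℝ) ^ δ)⁻¹) (by positivity)
      ((hm k).add ((hm l).add ((hm l).add_const S)))
      (lintegral_ofReal_add_le (hm k) hQ0 (by positivity) (lintegral_prodEntry_le hM k)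
        (lintegral_ofReal_add_le (hm l) hQ0 (by positivity) (lintegral_prodEntry_le hM l)
          (lintegral_ofReal_add_le (hm l) hQ0 hS0 (lintegral_prodEntry_le hM l) hconst)))
    refine h4.trans (le_of_eq ?_)
    congr 1
    ring
  have hmeas : ∀ k l, Measurable fun p => (prodEntry γ D p k ^ 2 + ∫ ω, Y k ω ^ 2 ∂P₃)
      * (|prodEntry γ D p l| / √(n : ℝ)) ^ δ := fun k l =>
    (((measurable_prodEntry hM k).pow_const 2).add_const _).mul
      (((measurable_prodEntry hM l).norm.div_const _).pow_const _)
  have hnn : ∀ k l p, 0 ≤ (prodEntry γ D p k ^ 2 + ∫ ω, Y k ω ^ 2 ∂P₃)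
      * (|prodEntry γ D p l| / √(n : ℝ)) ^ δ := fun k l p => by
    have := integral_Y_sq_nonneg (P₃ := P₃) (Y := Y) k
    positivity
  have h1 := lintegral_ofReal_sum_le (P := P₁.prod P₂) (s := Finset.Icc 1 (rowStart (n + 1)))
    (v := fun k p => K / n ^ 2 * ∑ l ∈ (Finset.Ico 1 k).filter fun l => ¬ good k l,
      (prodEntry γ D p k ^ 2 + ∫ ω, Y k ω ^ 2 ∂P₃) * (|prodEntry γ D p l| / √n) ^ δ)
    (K := K / n ^ 2 * (κ * ((√n ^ δ)⁻¹ * (3 * Q + S))))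
    (fun k _ => ((Finset.measurable_fun_sum _ fun l _ => hmeas k l).const_mul _).aemeasurable)
    (fun k p => mul_nonneg (by positivity) (Finset.sum_nonneg fun l _ => hnn k l p))
    (fun k _ => ?_)
  · refine h1.trans (ENNReal.ofReal_le_ofReal ?_)
    calc _ ≤ (n : ℝ) ^ 2 * (K / n ^ 2 * (κ * ((√n ^ δ)⁻¹ * (3 * Q + S)))) := by
          gcongr
          exact card_Icc_rowStart_le n
      _ = _ := by field_simp
  · refine lintegral_ofReal_const_mul_le (by positivity)
      (Finset.measurable_fun_sum _ fun l _ => hmeas k l).aemeasurable ?_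
    refine (lintegral_ofReal_sum_le (fun l _ => (hmeas k l).aemeasurable) (fun l p => hnn k l p)
      fun l _ => hterm k l).trans (ENNReal.ofReal_le_ofReal ?_)
    gcongr
    exact hS.card_bad k

/-- The error made by truncating the squares of `D`. -/
def truncError (P₂ : Measure Ω₂) (D : ℕ → Ω₂ → ℝ) (c K : ℝ) (a n : ℕ) (M : ℝ) (ω : Ω₂) : ℝ :=
  ∑ k ∈ Finset.Icc 1 (rowStart (n + 1)), K / n ^ 2 * c ^ 2 * ((D k ω ^ 2 - truncSq M (D k ω))
    + |(P₂[fun ω => D k ω ^ 2 - truncSq M (D k ω) | naturalSigma D (k - a)]) ω|)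

theorem measurable_sq_sub_truncSq (hM : ProductModel P₁ P₂ P₃ γ D Y δ L c) (M : ℝ) (k : ℕ) :
    Measurable fun ω => D k ω ^ 2 - truncSq M (D k ω) :=
  ((hM.measurable_D k).pow_const 2).sub ((measurable_truncSq M).comp (hM.measurable_D k))

theorem measurable_abs_condExp_naturalSigma (hM : ProductModel P₁ P₂ P₃ γ D Y δ L c) (u : Ω₂ → ℝ)
    (k : ℕ) : Measurable fun ω => |(P₂[u | naturalSigma D k]) ω| :=
  have h : Measurable (P₂[u | naturalSigma D k]) :=
    (stronglyMeasurable_condExp.mono (hM.naturalSigma_le' k)).measurable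
  h.norm

theorem measurable_truncError (hM : ProductModel P₁ P₂ P₃ γ D Y δ L c) (K : ℝ) (a n : ℕ)
    (M : ℝ) : Measurable (truncError P₂ D c K a n M) := by
  refine Finset.measurable_fun_sum _ fun k _ => ?_
  exact ((measurable_sq_sub_truncSq hM M k).add
    (measurable_abs_condExp_naturalSigma hM _ _)).const_mul _

theorem lintegral_truncError_le (hM : ProductModel P₁ P₂ P₃ γ D Y δ L c) (hK : 0 ≤ K)
    (hn : 0 < n) (a : ℕ) {M : ℝ} (hM0 : 0 < M) :
    ∫⁻ ω, ENNReal.ofReal (truncError P₂ D c K a n M ω) ∂P₂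
      ≤ ENNReal.ofReal (2 * K * c ^ 2 * L * (M ^ δ)⁻¹) := by
  have hn' : (0 : ℝ) < n := by exact_mod_cast hn
  have hL := hM.L_nonneg
  have hB : 0 ≤ (M ^ δ)⁻¹ * L := by positivity
  have hr : ∀ k, ∫⁻ ω, ENNReal.ofReal (D k ω ^ 2 - truncSq M (D k ω)) ∂P₂
      ≤ ENNReal.ofReal ((M ^ δ)⁻¹ * L) := fun k =>
    (lintegral_mono fun ω => ENNReal.ofReal_le_ofReal
      (sq_sub_truncSq_le hM0 hM.delta_pos (D k ω))).trans
      (lintegral_ofReal_const_mul_le (by positivity)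
        ((hM.measurable_D k).norm.pow_const _).aemeasurable (hM.moment_D k))
  have hc : ∀ k, ∫⁻ ω, ENNReal.ofReal
      |(P₂[fun ω => D k ω ^ 2 - truncSq M (D k ω) | naturalSigma D (k - a)]) ω| ∂P₂
      ≤ ENNReal.ofReal ((M ^ δ)⁻¹ * L) := by
    intro k
    rw [← ofReal_integral_eq_lintegral_ofReal integrable_condExp.abs
      (Eventually.of_forall fun _ => abs_nonneg _)]
    refine ENNReal.ofReal_le_ofReal ((integral_abs_condExp_le _).trans ?_)
    simp_rw [abs_of_nonneg (sq_sub_truncSq_nonneg M _)]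
    exact integral_le_of_lintegral_le (measurable_sq_sub_truncSq hM M k).aestronglyMeasurable
      (fun _ => sq_sub_truncSq_nonneg _ _) hB (hr k)
  have hmc : ∀ k, Measurable fun ω =>
      |(P₂[fun ω => D k ω ^ 2 - truncSq M (D k ω) | naturalSigma D (k - a)]) ω| := fun k =>
    measurable_abs_condExp_naturalSigma hM _ _
  have h1 := lintegral_ofReal_sum_le (P := P₂) (s := Finset.Icc 1 (rowStart (n + 1)))
    (v := fun k ω => K / n ^ 2 * c ^ 2 * ((D k ω ^ 2 - truncSq M (D k ω))
      + |(P₂[fun ω => D k ω ^ 2 - truncSq M (D k ω) | naturalSigma D (k - a)]) ω|))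
    (K := K / n ^ 2 * c ^ 2 * ((M ^ δ)⁻¹ * L + (M ^ δ)⁻¹ * L))
    (fun k _ => (((measurable_sq_sub_truncSq hM M k).add (hmc k)).const_mul _).aemeasurable)
    (fun k ω => by have := sq_sub_truncSq_nonneg M (D k ω); positivity) (fun k _ => ?_)
  · refine h1.trans (ENNReal.ofReal_le_ofReal ?_)
    calc _ ≤ (n : ℝ) ^ 2 * (K / n ^ 2 * c ^ 2 * ((M ^ δ)⁻¹ * L + (M ^ δ)⁻¹ * L)) := by
          gcongr
          exact card_Icc_rowStart_le n
      _ = _ := by field_simp; ring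
  · exact lintegral_ofReal_const_mul_le (by positivity)
      ((measurable_sq_sub_truncSq hM M k).add (hmc k)).aemeasurable
      (lintegral_ofReal_add_le (measurable_sq_sub_truncSq hM M k).aemeasurable hB hB (hr k) (hc k))

/-- The mixing averages of the two factors. -/
def mixingD (P₂ : Measure Ω₂) (D : ℕ → Ω₂ → ℝ) (a n : ℕ) (ω : Ω₂) : ℝ :=
  ∑ k ∈ Finset.Icc 1 (rowStart (n + 1)),
    |(P₂[fun ω => D k ω ^ 2 | naturalSigma D (k - a)]) ω - ∫ ω, D k ω ^ 2 ∂P₂|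

/-- The mixing average of the random field. -/
def mixingField (P₁ : Measure Ω₁) (γ : ℕ → Ω₁ → ℝ) (G : ℕ → MeasurableSpace Ω₁) (n : ℕ)
    (ω : Ω₁) : ℝ :=
  ∑ k ∈ Finset.Icc 1 (rowStart (n + 1)),
    |(P₁[fun ω => γ k ω ^ 2 | G k]) ω - ∫ ω, γ k ω ^ 2 ∂P₁|

theorem ae_abs_sub_le (hM : ProductModel P₁ P₂ P₃ γ D Y δ L c) (ht : SmoothTest n δ K f g h)
    (a : ℕ) (G : ℕ → MeasurableSpace Ω₁) (good : ℕ → ℕ → Prop) (M : ℝ) :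
    ∀ᵐ p ∂(P₁.prod P₂), |f (prodEntry γ D p) - ∫ ω, f (fun l => Y l ω) ∂P₃|
      ≤ |firstTerm P₃ Y γ D g (rowStart (n + 1)) p|
        + |fieldTerm P₁ P₂ P₃ Y γ D good G h (rowStart (n + 1)) p|
        + |truncTerm P₂ P₃ Y γ D good h a (rowStart (n + 1)) M p|
        + (taylorError P₃ Y γ D δ K n p + badError P₃ Y γ D good δ K n p
          + truncError P₂ D c K a n M p.2)
        + K / n ^ 2 * c ^ 2 * mixingD P₂ D a n p.2
        + K / n ^ 2 * (1 + L) * mixingField P₁ γ G n p.1 := by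
  have hK := ht.K_nonneg
  have hL := hM.L_nonneg
  have hγ : ∀ᵐ p ∂(P₁.prod P₂), ∀ k, |γ k p.1| ≤ c :=
    Measure.quasiMeasurePreserving_fst.ae hM.bound_γ
  have hD : ∀ᵐ p ∂(P₁.prod P₂), ∀ k, (P₂[fun ω => D k ω ^ 2 | naturalSigma D (k - a)]) p.2
      = (P₂[fun ω => truncSq M (D k ω) | naturalSigma D (k - a)]) p.2
        + (P₂[fun ω => D k ω ^ 2 - truncSq M (D k ω) | naturalSigma D (k - a)]) p.2 := by
    suffices hall : ∀ᵐ ω' ∂P₂, ∀ k, (P₂[fun ω => D k ω ^ 2 | naturalSigma D (k - a)]) ω'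
        = (P₂[fun ω => truncSq M (D k ω) | naturalSigma D (k - a)]) ω'
          + (P₂[fun ω => D k ω ^ 2 - truncSq M (D k ω) | naturalSigma D (k - a)]) ω' from
      Measure.quasiMeasurePreserving_snd.ae hall
    refine ae_all_iff.2 fun k => ?_
    have h1 := condExp_add (integrable_truncSq hM M k)
      ((hM.memLp_D k).integrable_sq.sub (integrable_truncSq hM M k)) (naturalSigma D (k - a))
    have e : (fun ω => truncSq M (D k ω)) + ((fun ω => D k ω ^ 2) - fun ω => truncSq M (D k ω))
        = fun ω => D k ω ^ 2 := by
      funext ω; simp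
    rw [e] at h1
    exact h1
  filter_upwards [hγ, hD] with p hγ hD
  set x := prodEntry γ D p with hx
  set N := rowStart (n + 1) with hN
  set s := Finset.Icc 1 N with hs
  have hYi : ∀ k, Integrable (fun ω => |Y k ω| ^ (2 + δ)) P₃ := fun k =>
    integrable_of_lintegral_le ((hM.measurable_Y k).norm.pow_const _).aestronglyMeasurable
      (fun _ => Real.rpow_nonneg (abs_nonneg _) _) (hM.moment_Y k)
  have hlin := lindeberg_sum ht hM.measurable_Y hM.memLp_Y hYi hM.mean_Y hM.indep_Y x
  have e1 : ∑ k ∈ s, x k * hybridMean P₃ Y N k (g k) x = firstTerm P₃ Y γ D g N p :=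
    Finset.sum_congr rfl fun k _ => by rw [hx]; simp only [prodEntry]; ring
  set W := fun k => goodWeight P₃ Y γ D good h N k p with hW
  set H := fun k => hybridMean P₃ Y N k (h k) x with hH
  set t := fun k => truncSq M (D k p.2) with htdef
  set r := fun k => D k p.2 ^ 2 - truncSq M (D k p.2) with hr
  set Et := fun k => (P₂[fun ω => truncSq M (D k ω) | naturalSigma D (k - a)]) p.2 with hEt
  set Er := fun k => (P₂[fun ω => D k ω ^ 2 - truncSq M (D k ω) | naturalSigma D (k - a)]) p.2
    with hEr
  set E := fun k => (P₂[fun ω => D k ω ^ 2 | naturalSigma D (k - a)]) p.2 with hE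
  set F := fun k => (P₁[fun ω => γ k ω ^ 2 | G k]) p.1 with hF
  set α := fun k => ∫ ω, γ k ω ^ 2 ∂P₁ with hα
  set β := fun k => ∫ ω, D k ω ^ 2 ∂P₂ with hβ
  have hWb : ∀ k, |W k| ≤ K / n ^ 2 := fun k => abs_goodWeight_le ht good N k p
  have hγ2 : ∀ k, |γ k p.1 ^ 2| ≤ c ^ 2 := fun k => by
    rw [abs_pow]
    exact pow_le_pow_left₀ (abs_nonneg _) (hγ k) 2
  have e2 : ∑ k ∈ s, (x k ^ 2 - ∫ ω, Y k ω ^ 2 ∂P₃) * H k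
      = fieldTerm P₁ P₂ P₃ Y γ D good G h N p + truncTerm P₂ P₃ Y γ D good h a N M p
        + (∑ k ∈ s, (H k - W k) * (x k ^ 2 - ∫ ω, Y k ω ^ 2 ∂P₃)
          + ∑ k ∈ s, W k * γ k p.1 ^ 2 * (r k - Er k)
          + ∑ k ∈ s, W k * γ k p.1 ^ 2 * (E k - β k)
          + ∑ k ∈ s, W k * β k * (F k - α k)) := by
    rw [fieldTerm, truncTerm, ← Finset.sum_add_distrib, ← Finset.sum_add_distrib,
      ← Finset.sum_add_distrib, ← Finset.sum_add_distrib, ← Finset.sum_add_distrib]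
    refine Finset.sum_congr rfl fun k _ => ?_
    have h1 : x k ^ 2 = γ k p.1 ^ 2 * (t k + r k) := by
      simp only [hx, prodEntry, htdef, hr]; ring
    have h2 : E k = Et k + Er k := hD k
    rw [hM.variance_Y k]
    change (x k ^ 2 - α k * β k) * H k = W k * β k * (γ k p.1 ^ 2 - F k)
      + W k * γ k p.1 ^ 2 * (t k - Et k) + ((H k - W k) * (x k ^ 2 - α k * β k)
        + W k * γ k p.1 ^ 2 * (r k - Er k) + W k * γ k p.1 ^ 2 * (E k - β k)
        + W k * β k * (F k - α k))
    rw [h1, h2]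
    ring
  have b1 : |∑ k ∈ s, (H k - W k) * (x k ^ 2 - ∫ ω, Y k ω ^ 2 ∂P₃)|
      ≤ badError P₃ Y γ D good δ K n p := by
    refine (Finset.abs_sum_le_sum_abs _ _).trans (Finset.sum_le_sum fun k _ => ?_)
    have h1 := abs_hybridMean_sub_le (P := P₃) ht hM.measurable_Y N k
      ((Finset.Ico 1 k).filter fun l => ¬ good k l) x (keepGood good k x) (fun l hl hls => by
        rw [keepGood, if_pos]
        by_contra hg
        exact hls (Finset.mem_filter.2 ⟨hl, hg⟩)) (Finset.filter_subset _ _)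
    have h2 : ∑ l ∈ (Finset.Ico 1 k).filter (fun l => ¬ good k l),
        (|x l - keepGood good k x l| / √n) ^ δ
        = ∑ l ∈ (Finset.Ico 1 k).filter (fun l => ¬ good k l), (|x l| / √n) ^ δ := by
      refine Finset.sum_congr rfl fun l hl => ?_
      rw [keepGood, if_neg (Finset.mem_filter.1 hl).2, sub_zero]
    rw [h2] at h1
    have h3 : |x k ^ 2 - ∫ ω, Y k ω ^ 2 ∂P₃| ≤ x k ^ 2 + ∫ ω, Y k ω ^ 2 ∂P₃ := by
      have := integral_Y_sq_nonneg (P₃ := P₃) (Y := Y) k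
      have := sq_nonneg (x k)
      rw [abs_le]
      constructor <;> linarith
    rw [abs_mul, ← Finset.mul_sum]
    calc |H k - W k| * |x k ^ 2 - ∫ ω, Y k ω ^ 2 ∂P₃|
        ≤ (K / n ^ 2 * ∑ l ∈ (Finset.Ico 1 k).filter (fun l => ¬ good k l), (|x l| / √n) ^ δ)
          * (x k ^ 2 + ∫ ω, Y k ω ^ 2 ∂P₃) :=
          mul_le_mul h1 h3 (abs_nonneg _) ((abs_nonneg _).trans h1)
      _ = _ := by ring
  have b2 : |∑ k ∈ s, W k * γ k p.1 ^ 2 * (r k - Er k)| ≤ truncError P₂ D c K a n M p.2 := by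
    refine (Finset.abs_sum_le_sum_abs _ _).trans (Finset.sum_le_sum fun k _ => ?_)
    rw [abs_mul, abs_mul]
    have h1 : |r k - Er k| ≤ r k + |Er k| := by
      refine (abs_sub _ _).trans (le_of_eq ?_)
      rw [abs_of_nonneg (show 0 ≤ r k from sq_sub_truncSq_nonneg _ _)]
    exact mul_le_mul (mul_le_mul (hWb k) (hγ2 k) (abs_nonneg _) (by positivity)) h1 (abs_nonneg _)
      (by positivity)
  have b3 : |∑ k ∈ s, W k * γ k p.1 ^ 2 * (E k - β k)|
      ≤ K / n ^ 2 * c ^ 2 * mixingD P₂ D a n p.2 := by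
    rw [mixingD, Finset.mul_sum]
    refine (Finset.abs_sum_le_sum_abs _ _).trans (Finset.sum_le_sum fun k _ => ?_)
    rw [abs_mul, abs_mul]
    exact mul_le_mul_of_nonneg_right (mul_le_mul (hWb k) (hγ2 k) (abs_nonneg _) (by positivity))
      (abs_nonneg _)
  have b4 : |∑ k ∈ s, W k * β k * (F k - α k)|
      ≤ K / n ^ 2 * (1 + L) * mixingField P₁ γ G n p.1 := by
    rw [mixingField, Finset.mul_sum]
    refine (Finset.abs_sum_le_sum_abs _ _).trans (Finset.sum_le_sum fun k _ => ?_)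
    rw [abs_mul, abs_mul]
    refine mul_le_mul_of_nonneg_right (mul_le_mul (hWb k) ?_ (abs_nonneg _) (by positivity))
      (abs_nonneg _)
    rw [abs_of_nonneg (show 0 ≤ β k from integral_nonneg fun _ => sq_nonneg _)]
    exact hM.integral_D_sq_le k
  have hlin' : |f x - (∫ ω, f (fun l => Y l ω) ∂P₃) - firstTerm P₃ Y γ D g N p
      - ∑ k ∈ s, (x k ^ 2 - ∫ ω, Y k ω ^ 2 ∂P₃) * H k| ≤ taylorError P₃ Y γ D δ K n p := by
    rw [← e1]
    exact hlin
  rw [e2] at hlin'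
  generalize firstTerm P₃ Y γ D g N p = T1 at *
  generalize fieldTerm P₁ P₂ P₃ Y γ D good G h N p = T5 at *
  generalize truncTerm P₂ P₃ Y γ D good h a N M p = T3 at *
  rw [abs_le] at hlin' b1 b2 b3 b4
  rw [abs_le]
  have := abs_le.1 (le_refl |T1|)
  have := abs_le.1 (le_refl |T5|)
  have := abs_le.1 (le_refl |T3|)
  constructor <;> linarith

end Remainders

end MartingaleMatrix

namespace MartingaleMatrix

section Combination

set_option linter.unusedSectionVars false

variable {Ω₁ Ω₂ Ω₃ : Type*} [mΩ₁ : MeasurableSpace Ω₁] [mΩ₂ : MeasurableSpace Ω₂]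
  [mΩ₃ : MeasurableSpace Ω₃]
  {P₁ : Measure Ω₁} {P₂ : Measure Ω₂} {P₃ : Measure Ω₃} [IsProbabilityMeasure P₁]
  [IsProbabilityMeasure P₂] [IsProbabilityMeasure P₃] {γ : ℕ → Ω₁ → ℝ} {D : ℕ → Ω₂ → ℝ}
  {Y : ℕ → Ω₃ → ℝ} {δ L c : ℝ}
  {a : ℕ} {κ : ℝ} {G : ℕ → MeasurableSpace Ω₁} {good far : ℕ → ℕ → Prop}

theorem inv_le_rate (hδ : 0 < δ) (hδ1 : δ ≤ 1) {n : ℕ} (hn : 0 < n) :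
    (n : ℝ)⁻¹ ≤ (n : ℝ) ^ (-(δ / 8)) ∧ (√(n : ℝ) ^ δ)⁻¹ ≤ (n : ℝ) ^ (-(δ / 8)) ∧
      (((n : ℝ) ^ (1 / 8 : ℝ)) ^ δ)⁻¹ = (n : ℝ) ^ (-(δ / 8)) ∧
      ((((n : ℝ) ^ (1 / 8 : ℝ)) ^ 2) ^ 2) / n ≤ (n : ℝ) ^ (-(δ / 8)) := by
  have hn0 : (0 : ℝ) < n := by exact_mod_cast hn
  have hn1 : (1 : ℝ) ≤ n := by exact_mod_cast hn
  refine ⟨?_, ?_, ?_, ?_⟩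
  · rw [← Real.rpow_neg_one]
    exact Real.rpow_le_rpow_of_exponent_le hn1 (by linarith)
  · rw [Real.sqrt_eq_rpow, ← Real.rpow_mul hn0.le, ← Real.rpow_neg hn0.le]
    exact Real.rpow_le_rpow_of_exponent_le hn1 (by linarith)
  · rw [← Real.rpow_mul hn0.le, ← Real.rpow_neg hn0.le]
    congr 1
    ring
  · rw [← pow_mul, ← Real.rpow_natCast, ← Real.rpow_mul hn0.le]
    rw [← Real.rpow_sub_one hn0.ne']
    exact Real.rpow_le_rpow_of_exponent_le hn1 (by norm_num; linarith)

theorem le_sqrt_add_of_le {x t₁ t₂ t₃ u₁ u₂ u₃ A B : ℝ} (h₁ : 0 ≤ u₁) (h₂ : 0 ≤ u₂) (h₃ : 0 ≤ u₃)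
    (h : x ≤ |t₁| + |t₂| + |t₃| + (u₁ + u₂ + u₃) + A + B) :
    x ≤ 3 * √(t₁ ^ 2 + (t₂ ^ 2 + (t₃ ^ 2 + (u₁ + (u₂ + u₃)))))
      + (t₁ ^ 2 + (t₂ ^ 2 + (t₃ ^ 2 + (u₁ + (u₂ + u₃))))) + A + B := by
  have q₁ := sq_nonneg t₁
  have q₂ := sq_nonneg t₂
  have q₃ := sq_nonneg t₃
  set V := t₁ ^ 2 + (t₂ ^ 2 + (t₃ ^ 2 + (u₁ + (u₂ + u₃)))) with hV
  have v₁ : |t₁| ≤ √V := Real.abs_le_sqrt (by linarith)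
  have v₂ : |t₂| ≤ √V := Real.abs_le_sqrt (by linarith)
  have v₃ : |t₃| ≤ √V := Real.abs_le_sqrt (by linarith)
  linarith

theorem exists_estimate (hM : ProductModel P₁ P₂ P₃ γ D Y δ L c)
    (hS : PastSystem γ a κ G good far) {K : ℝ} (hK : 0 ≤ K) :
    ∃ C : ℝ, ∀ n : ℕ, 0 < n → ∀ f g h, SmoothTest n δ K f g h →
      ∃ V : Ω₁ × Ω₂ → ℝ, Measurable V ∧ (∀ p, 0 ≤ V p) ∧
        ∫⁻ p, ENNReal.ofReal (V p) ∂(P₁.prod P₂) ≤ ENNReal.ofReal (C * (n : ℝ) ^ (-(δ / 8))) ∧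
        ∀ᵐ p ∂(P₁.prod P₂), |f (prodEntry γ D p) - ∫ ω, f (fun l => Y l ω) ∂P₃|
          ≤ 3 * √(V p) + V p + K * c ^ 2 * (mixingD P₂ D a n p.2 / n ^ 2)
            + K * (1 + L) * (mixingField P₁ γ G n p.1 / n ^ 2) := by
  classical
  have hL := hM.L_nonneg
  have hc := hM.c_nonneg
  have hδ := hM.delta_pos
  have hκ : 0 ≤ κ := (Nat.cast_nonneg _).trans (hS.card_bad 0)
  set C1 := (K * c) ^ 2 * (1 + L) with hC1
  set C2 := κ * (K * (1 + L) * c ^ 2) ^ 2 with hC2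
  set C3 := κ * (K * c ^ 2) ^ 2 with hC3
  set C4 := K * (c ^ (2 + δ) * L + L) with hC4
  set C5 := K * κ * (3 * (c ^ (2 + δ) * L) + (√(1 + L)) ^ (2 + δ)) with hC5
  set C6 := 2 * K * c ^ 2 * L with hC6
  have p1 : 0 ≤ C1 := by positivity
  have p2 : 0 ≤ C2 := by positivity
  have p3 : 0 ≤ C3 := by positivity
  have p4 : 0 ≤ C4 := by positivity
  have p5 : 0 ≤ C5 := by positivity
  have p6 : 0 ≤ C6 := by positivity
  refine ⟨C1 + (C2 + (C3 + (C4 + (C5 + C6)))), fun n hn f g h ht => ?_⟩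
  have hn0 : (0 : ℝ) < n := by exact_mod_cast hn
  obtain ⟨r1, r2, r3, r4⟩ := inv_le_rate hδ hM.delta_le hn
  set ρ := (n : ℝ) ^ (-(δ / 8)) with hρ
  have hρ0 : 0 ≤ ρ := by positivity
  set M := (n : ℝ) ^ (1 / 8 : ℝ) with hMdef
  have hM0 : 0 < M := by positivity
  set T1 := firstTerm P₃ Y γ D g (rowStart (n + 1)) with hT1
  set T2 := fieldTerm P₁ P₂ P₃ Y γ D good G h (rowStart (n + 1)) with hT2
  set T3 := truncTerm P₂ P₃ Y γ D good h a (rowStart (n + 1)) M with hT3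
  set U4 := taylorError P₃ Y γ D δ K n with hU4
  set U5 := badError P₃ Y γ D good δ K n with hU5
  set U6 : Ω₁ × Ω₂ → ℝ := fun p => truncError P₂ D c K a n M p.2 with hU6
  have m1 : Measurable T1 := measurable_firstTerm hM ht _
  have m2 : Measurable T2 := measurable_fieldTerm hM ht hS _
  have m3 : Measurable T3 := measurable_truncTerm hM ht good a _ M
  have m4 : Measurable U4 := measurable_taylorError hM K n
  have m5 : Measurable U5 := measurable_badError hM good K n
  have m6 : Measurable U6 := (measurable_truncError hM K a n M).comp measurable_snd
  have n4 : ∀ p, 0 ≤ U4 p := fun p => Finset.sum_nonneg fun k _ => by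
    have : 0 ≤ ∫ ω, (|Y k ω| / √(n : ℝ)) ^ (2 + δ) ∂P₃ := integral_nonneg fun _ => by positivity
    positivity
  have n5 : ∀ p, 0 ≤ U5 p := fun p => Finset.sum_nonneg fun k _ =>
    mul_nonneg (by positivity) (Finset.sum_nonneg fun l _ => by
      have := integral_Y_sq_nonneg (P₃ := P₃) (Y := Y) k
      positivity)
  have n6 : ∀ p, 0 ≤ U6 p := fun p => Finset.sum_nonneg fun k _ => by
    have := sq_sub_truncSq_nonneg M (D k p.2)
    positivity
  have mono : ∀ {x y : ℝ}, x ≤ y → ENNReal.ofReal x ≤ ENNReal.ofReal y :=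
    fun h => ENNReal.ofReal_le_ofReal h
  have i1 : ∫⁻ p, ENNReal.ofReal (T1 p ^ 2) ∂(P₁.prod P₂) ≤ ENNReal.ofReal (C1 * ρ) :=
    (lintegral_firstTerm_sq_le hM ht hn).trans (mono (by
      rw [div_eq_mul_inv]; gcongr))
  have i2 : ∫⁻ p, ENNReal.ofReal (T2 p ^ 2) ∂(P₁.prod P₂) ≤ ENNReal.ofReal (C2 * ρ) :=
    (lintegral_fieldTerm_sq_le hM ht hS hn).trans (mono (by
      rw [div_eq_mul_inv]; gcongr))
  have i3 : ∫⁻ p, ENNReal.ofReal (T3 p ^ 2) ∂(P₁.prod P₂) ≤ ENNReal.ofReal (C3 * ρ) :=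
    (lintegral_truncTerm_sq_le hM ht hS hn M).trans (mono (by
      rw [mul_pow (K * c ^ 2), ← mul_assoc, mul_div_assoc]; gcongr))
  have i4 : ∫⁻ p, ENNReal.ofReal (U4 p) ∂(P₁.prod P₂) ≤ ENNReal.ofReal (C4 * ρ) :=
    (lintegral_taylorError_le hM hK hn).trans (mono (by gcongr))
  have i5 : ∫⁻ p, ENNReal.ofReal (U5 p) ∂(P₁.prod P₂) ≤ ENNReal.ofReal (C5 * ρ) :=
    (lintegral_badError_le hM hS hK hn).trans (mono (by gcongr))
  have i6 : ∫⁻ p, ENNReal.ofReal (U6 p) ∂(P₁.prod P₂) ≤ ENNReal.ofReal (C6 * ρ) := by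
    rw [← r3]
    exact lintegral_prod_le_of_ae_left m6.ennreal_ofReal.aemeasurable
      (Eventually.of_forall fun _ => lintegral_truncError_le hM hK hn a hM0)
  refine ⟨fun p => T1 p ^ 2 + (T2 p ^ 2 + (T3 p ^ 2 + (U4 p + (U5 p + U6 p)))), ?_, ?_, ?_, ?_⟩
  · exact (m1.pow_const 2).add ((m2.pow_const 2).add ((m3.pow_const 2).add
      (m4.add (m5.add m6))))
  · intro p
    have := n4 p
    have := n5 p
    have := n6 p
    positivity
  · have := lintegral_ofReal_add_le (m1.pow_const 2).aemeasurable (by positivity) (by positivity) i1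
      (lintegral_ofReal_add_le (m2.pow_const 2).aemeasurable (by positivity) (by positivity) i2
      (lintegral_ofReal_add_le (m3.pow_const 2).aemeasurable (by positivity) (by positivity) i3
      (lintegral_ofReal_add_le m4.aemeasurable (by positivity) (by positivity) i4
      (lintegral_ofReal_add_le m5.aemeasurable (by positivity) (by positivity) i5 i6))))
    refine this.trans (le_of_eq ?_)
    congr 1
    ring
  · filter_upwards [ae_abs_sub_le hM ht a G good M] with p hp
    have e1 : K / n ^ 2 * c ^ 2 * mixingD P₂ D a n p.2
        = K * c ^ 2 * (mixingD P₂ D a n p.2 / n ^ 2) := by ring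
    have e2 : K / n ^ 2 * (1 + L) * mixingField P₁ γ G n p.1
        = K * (1 + L) * (mixingField P₁ γ G n p.1 / n ^ 2) := by ring
    rw [e1, e2] at hp
    exact le_sqrt_add_of_le (n4 p) (n5 p) (n6 p) hp

/-- Along the powers `(j + 1) ^ q` the difference is controlled by the mixing averages. -/
theorem ae_exists_tendsto_zero (hM : ProductModel P₁ P₂ P₃ γ D Y δ L c)
    (hS : PastSystem γ a κ G good far) {K : ℝ} (hK : 0 ≤ K) {q : ℕ} (hq : 16 ≤ q * δ)
    {f : ℕ → (ℕ → ℝ) → ℝ}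
    (hf : ∀ n, 0 < n → ∃ g h, SmoothTest n δ K (f n) g h) :
    ∀ᵐ p ∂(P₁.prod P₂), ∃ u : ℕ → ℝ, Tendsto u atTop (𝓝 0) ∧ ∀ j : ℕ,
      |f ((j + 1) ^ q) (prodEntry γ D p) - ∫ ω, f ((j + 1) ^ q) (fun l => Y l ω) ∂P₃|
        ≤ u j + K * c ^ 2 * (mixingD P₂ D a ((j + 1) ^ q) p.2 / (((j + 1) ^ q : ℕ) : ℝ) ^ 2)
          + K * (1 + L)
            * (mixingField P₁ γ G ((j + 1) ^ q) p.1 / (((j + 1) ^ q : ℕ) : ℝ) ^ 2) := by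
  obtain ⟨C, hC⟩ := exists_estimate hM hS hK
  have hpos : ∀ j : ℕ, 0 < (j + 1) ^ q := fun j => by positivity
  choose g h hgh using hf
  choose V hVm hV0 hVi hVb using fun j : ℕ => hC ((j + 1) ^ q) (hpos j) _ _ _ (hgh _ (hpos j))
  have hconv : ∀ᵐ p ∂(P₁.prod P₂), Tendsto (fun j => V j p) atTop (𝓝 0) := by
    refine ae_tendsto_zero_of_lintegral_le (C := |C|) (q := 2) (fun j => (hVm j).aemeasurable) hV0
      (by norm_num) fun j => (hVi j).trans (ENNReal.ofReal_le_ofReal ?_)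
    have hj : (1 : ℝ) ≤ (j : ℝ) + 1 := by linarith [Nat.cast_nonneg (α := ℝ) j]
    have hj0 : (0 : ℝ) < (j : ℝ) + 1 := by linarith
    rw [div_eq_mul_inv |C|, ← Real.rpow_neg hj0.le]
    refine mul_le_mul (le_abs_self C) ?_ (by positivity) (abs_nonneg C)
    push_cast
    rw [← Real.rpow_natCast, ← Real.rpow_mul hj0.le]
    exact Real.rpow_le_rpow_of_exponent_le hj (by linarith)
  filter_upwards [hconv, ae_all_iff.2 hVb] with p h1 h2
  refine ⟨fun j => 3 * √(V j p) + V j p, ?_, fun j => h2 j⟩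
  simpa using (h1.sqrt.const_mul 3).add h1

end Combination

end MartingaleMatrix

namespace MartingaleMatrix

/-- The averages `s a n / n ^ 2` become small, first in `n` and then in `a`. -/
def MixingVanishes (s : ℕ → ℕ → ℝ) : Prop :=
  ∀ ε : ℝ, 0 < ε → ∀ᶠ a in atTop, ∀ᶠ n : ℕ in atTop, s a n / (n : ℝ) ^ 2 < ε

theorem tendsto_zero_of_mixingVanishes {x : ℕ → ℝ} {s t : ℕ → ℕ → ℝ} (hs : MixingVanishes s)
    (ht : MixingVanishes t) {A B : ℝ} (hA : 0 ≤ A) (hB : 0 ≤ B) {m : ℕ → ℕ}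
    (hm : Tendsto m atTop atTop)
    (h : ∀ a, 1 ≤ a → ∃ u : ℕ → ℝ, Tendsto u atTop (𝓝 0) ∧ ∀ j,
      |x j| ≤ u j + A * (s a (m j) / (m j : ℝ) ^ 2) + B * (t a (m j) / (m j : ℝ) ^ 2)) :
    Tendsto x atTop (𝓝 0) := by
  rw [Metric.tendsto_atTop']
  intro ε hε
  have hεA : 0 < ε / 3 / (A + 1) := by positivity
  have hεB : 0 < ε / 3 / (B + 1) := by positivity
  obtain ⟨a, ⟨hsa, hta⟩, ha⟩ := (((hs _ hεA).and (ht _ hεB)).and (eventually_ge_atTop 1)).exists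
  obtain ⟨u, hu, hx⟩ := h a ha
  have hu' : ∀ᶠ j in atTop, u j < ε / 3 := hu.eventually_lt_const (by positivity)
  obtain ⟨N, hN⟩ := eventually_atTop.1 ((hu'.and (hm.eventually hsa)).and (hm.eventually hta))
  refine ⟨N, fun j hj => ?_⟩
  obtain ⟨⟨h1, h2⟩, h3⟩ := hN j hj.le
  rw [Real.dist_eq, sub_zero]
  rw [lt_div_iff₀ (by positivity)] at h2 h3
  refine (hx j).trans_lt ?_
  set S := s a (m j) / (m j : ℝ) ^ 2
  set T := t a (m j) / (m j : ℝ) ^ 2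
  have bound : ∀ {A S : ℝ}, 0 ≤ A → S * (A + 1) < ε / 3 → A * S < ε / 3 := by
    intro A S hA hS
    rcases le_or_gt 0 S with h0 | h0
    · nlinarith
    · nlinarith [mul_nonneg hA (neg_pos.2 h0).le]
  linarith [bound hA h2, bound hB h3]

/-- The expectation, taken part by part, of the Stieltjes transform of the matrix of `Y`. -/
def meanStieltjes {Ω : Type*} [MeasurableSpace Ω] (P : Measure Ω) (Y : ℕ → Ω → ℝ) (n : ℕ) (z : ℂ) :
    ℂ :=
  ⟨∫ ω, (seqStieltjes n z fun l => Y l ω).re ∂P, ∫ ω, (seqStieltjes n z fun l => Y l ω).im ∂P⟩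

theorem tendsto_succ_pow_atTop {q : ℕ} (hq : q ≠ 0) :
    Tendsto (fun j : ℕ => (j + 1) ^ q) atTop atTop :=
  (tendsto_pow_atTop hq).comp (tendsto_add_atTop_nat 1)

/-- Along the powers `(j + 1) ^ q`, the Stieltjes transform of the matrix with entries `γ k * D k`
is almost surely close to the mean Stieltjes transform of the comparison matrix. -/
theorem ae_tendsto_seqStieltjes_sub_mean {Ω₁ Ω₂ Ω₃ : Type*} [MeasurableSpace Ω₁]
    [MeasurableSpace Ω₂] [MeasurableSpace Ω₃] {P₁ : Measure Ω₁} {P₂ : Measure Ω₂} {P₃ : Measure Ω₃}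
    [IsProbabilityMeasure P₁] [IsProbabilityMeasure P₂] [IsProbabilityMeasure P₃]
    {γ : ℕ → Ω₁ → ℝ} {D : ℕ → Ω₂ → ℝ} {Y : ℕ → Ω₃ → ℝ} {δ L c : ℝ}
    (hM : ProductModel P₁ P₂ P₃ γ D Y δ L c) {κ : ℕ → ℝ} {G : ℕ → ℕ → MeasurableSpace Ω₁}
    {good far : ℕ → ℕ → ℕ → Prop}
    (hS : ∀ a, 1 ≤ a → PastSystem γ a (κ a) (G a) (good a) (far a))
    (hD : ∀ᵐ ω ∂P₂, MixingVanishes fun a n => mixingD P₂ D a n ω)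
    (hγ : ∀ᵐ ω ∂P₁, MixingVanishes fun a n => mixingField P₁ γ (G a) n ω)
    {q : ℕ} (hq : 16 ≤ q * δ) {z : ℂ} (hz : 0 < z.im) :
    ∀ᵐ p ∂(P₁.prod P₂), Tendsto (fun j : ℕ => seqStieltjes ((j + 1) ^ q) z (prodEntry γ D p)
      - meanStieltjes P₃ Y ((j + 1) ^ q) z) atTop (𝓝 0) := by
  have hq0 : q ≠ 0 := by
    rintro rfl
    norm_num at hq
  have hL := hM.L_nonneg
  have hm := tendsto_succ_pow_atTop hq0
  have hD' : ∀ᵐ p ∂(P₁.prod P₂), MixingVanishes fun a n => mixingD P₂ D a n p.2 :=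
    Measure.quasiMeasurePreserving_snd.ae hD
  have hγ' : ∀ᵐ p ∂(P₁.prod P₂), MixingVanishes fun a n => mixingField P₁ γ (G a) n p.1 :=
    Measure.quasiMeasurePreserving_fst.ae hγ
  have part : ∀ l : ℂ →L[ℝ] ℝ, (∀ w, |l w| ≤ ‖w‖) → ∀ᵐ p ∂(P₁.prod P₂),
      Tendsto (fun j : ℕ => l (seqStieltjes ((j + 1) ^ q) z (prodEntry γ D p))
        - ∫ ω, l (seqStieltjes ((j + 1) ^ q) z fun k => Y k ω) ∂P₃) atTop (𝓝 0) := by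
    intro l hl
    obtain ⟨K, hK, hf⟩ := exists_smoothTest l hl hz hM.delta_pos hM.delta_le
    have hae := ae_all_iff.2 fun a : ℕ => ae_all_iff.2 fun ha : 1 ≤ a =>
      ae_exists_tendsto_zero hM (hS a ha) hK.le hq hf
    filter_upwards [hae, hD', hγ'] with p hp h1 h2
    exact tendsto_zero_of_mixingVanishes h1 h2 (A := K * c ^ 2) (B := K * (1 + L))
      (by positivity) (by positivity) hm hp
  filter_upwards [part Complex.reCLM Complex.abs_re_le_norm,
    part Complex.imCLM Complex.abs_im_le_norm] with p h1 h2
  refine squeeze_zero_norm (fun j => Complex.norm_le_abs_re_add_abs_im _) ?_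
  simpa [meanStieltjes] using h1.abs.add h2.abs

end MartingaleMatrix

namespace MartingaleMatrix

section Geometry

/-- The row of the entry at position `k ≥ 1`. -/
def rowOf (k : ℕ) : ℕ := if h : 1 ≤ k then (exists_position k h).choose else 0

/-- The column of the entry at position `k ≥ 1`. -/
def colOf (k : ℕ) : ℕ := if h : 1 ≤ k then (exists_position k h).choose_spec.choose else 0

theorem rowOf_colOf_spec {k : ℕ} (hk : 1 ≤ k) :
    1 ≤ colOf k ∧ colOf k ≤ rowOf k ∧ position (rowOf k) (colOf k) = k := by
  rw [rowOf, colOf, dif_pos hk, dif_pos hk]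
  exact (exists_position k hk).choose_spec.choose_spec

theorem rowOf_position {i j : ℕ} (hj : 1 ≤ j) (hji : j ≤ i) :
    rowOf (position i j) = i ∧ colOf (position i j) = j := by
  obtain ⟨h1, h2, h3⟩ := rowOf_colOf_spec (k := position i j) (by rw [position_eq]; omega)
  exact position_inj h1 h2 hj hji h3

theorem eq_rowStart_add_colOf {k : ℕ} (hk : 1 ≤ k) : k = rowStart (rowOf k) + colOf k :=
  (rowOf_colOf_spec hk).2.2.symm

theorem rowOf_le {k n : ℕ} (hk : 1 ≤ k) (hkn : k ≤ rowStart (n + 1)) : rowOf k ≤ n := by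
  by_contra! h
  have h1 := rowStart_mono (Nat.succ_le_of_lt h)
  have h2 := eq_rowStart_add_colOf hk
  have h3 := (rowOf_colOf_spec hk).1
  simp only [Nat.succ_eq_add_one] at h1
  omega

theorem le_rowStart_succ_rowOf {k : ℕ} (hk : 1 ≤ k) : k ≤ rowStart (rowOf k + 1) := by
  rw [rowStart_succ]
  have h2 := eq_rowStart_add_colOf hk
  have h3 := (rowOf_colOf_spec hk).2.1
  omega

theorem rowOf_mono {l k : ℕ} (hl : 1 ≤ l) (hlk : l ≤ k) : rowOf l ≤ rowOf k :=
  rowOf_le hl (hlk.trans (le_rowStart_succ_rowOf (hl.trans hlk)))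

theorem rowStart_add_le {r : ℕ} (hr : 1 ≤ r) (b : ℕ) :
    rowStart (r + 1) + b ≤ rowStart (r + 1 + b) := by
  induction b with
  | zero => simp
  | succ b ih =>
    rw [show r + 1 + (b + 1) = (r + 1 + b) + 1 by ring, rowStart_succ (r + 1 + b)]
    omega

theorem card_le_of_rowOf_mem {s : Finset ℕ} (hs : ∀ l ∈ s, 1 ≤ l) {A B : Finset ℤ}
    (hA : ∀ l ∈ s, (rowOf l : ℤ) ∈ A) (hB : ∀ l ∈ s, (colOf l : ℤ) ∈ B) :
    s.card ≤ A.card * B.card := by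
  rw [← Finset.card_product]
  refine Finset.card_le_card_of_injOn (fun l => ((rowOf l : ℤ), (colOf l : ℤ)))
    (fun l hl => Finset.mem_coe.2 (Finset.mem_product.2 ⟨hA l hl, hB l hl⟩)) ?_
  intro l hl l' hl' h
  simp only [Prod.mk.injEq, Nat.cast_inj] at h
  rw [eq_rowStart_add_colOf (hs l hl), eq_rowStart_add_colOf (hs l' hl'), h.1, h.2]

theorem card_near_le (a k : ℕ) {s : Finset ℕ} (hs : ∀ l ∈ s, 1 ≤ l ∧ l ≤ k ∧ k < l + a) : s.card ≤ a := by
  have : s ⊆ Finset.Ioc (k - a) k := fun l hl => by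
    have := hs l hl
    rw [Finset.mem_Ioc]
    omega
  refine (Finset.card_le_card this).trans ?_
  rw [Nat.card_Ioc]
  omega

theorem card_Ioo_sub_add (x : ℤ) (a : ℕ) : (Finset.Ioo (x - a) (x + a)).card ≤ 2 * a := by
  rw [Int.card_Ioo]
  omega

end Geometry

section Systems

variable {Ω : Type*} [mΩ : MeasurableSpace Ω]

theorem pastSystem_const (a : ℕ) : PastSystem (fun _ (_ : Ω) => (1 : ℝ)) a (2 * a : ℕ) (fun _ => ⊥)
    (fun k l => l + a ≤ k) (fun k l => l + a ≤ k) where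
  le _ := bot_le
  add_le _ _ h := h
  measurable _ _ _ _ := measurable_const
  card_bad k := by
    refine Nat.cast_le.2 ((card_near_le a k fun l hl => ?_).trans (by omega))
    simp only [Finset.mem_filter, Finset.mem_Ico] at hl
    omega
  far_le _ _ _ := le_rfl
  far_good k l l' h _ hl := by omega
  card_close n k hk := by
    have hn : 1 ≤ n := by
      by_contra! h
      obtain rfl : n = 0 := by omega
      simp [rowStart] at hk
    rw [← Nat.cast_mul]
    refine Nat.cast_le.2 ?_
    have h : ((Finset.Icc 1 (rowStart (n + 1))).filter fun l =>
        ¬ l + a ≤ k ∧ ¬ k + a ≤ l).card ≤ 2 * a * n := by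
      refine le_trans ?_ (Nat.le_mul_of_pos_right _ hn)
      refine (Finset.card_le_card (t := Finset.Ioc (k - a) (k + a)) fun l hl => ?_).trans ?_
      · simp only [Finset.mem_filter, Finset.mem_Icc] at hl
        rw [Finset.mem_Ioc]
        omega
      · rw [Nat.card_Ioc]
        omega
    convert h

/-- The field `γ` read along the positions, and extended by `0` to the position `0`. -/
def flatField (γ : ℤ × ℤ → Ω → ℝ) (k : ℕ) (ω : Ω) : ℝ :=
  if k = 0 then 0 else γ ((rowOf k : ℤ), (colOf k : ℤ)) ω

theorem measurable_flatField {γ : ℤ × ℤ → Ω → ℝ} (hγ : ∀ p, Measurable (γ p)) (k : ℕ) :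
    Measurable (flatField γ k) := by
  unfold flatField
  split_ifs
  · exact measurable_const
  · exact hγ _

theorem lexPast_mono {a : ℕ} (ha : 1 ≤ a) {i j i' j' : ℤ} (h : i' + a ≤ i) :
    lexPast a i' j' ⊆ lexPast a i j := by
  rintro ⟨u, v⟩ ⟨-, h2⟩
  rw [Prod.Lex.toLex_le_toLex] at h2
  have hu : u ≤ i' := by
    rcases h2 with h2 | h2
    · exact h2.le
    · exact h2.1.le
  refine ⟨le_max_of_le_left ?_, ?_⟩
  · simp only
    rw [abs_sub_comm]
    exact (by omega : (a : ℤ) ≤ i - u).trans (le_abs_self _)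
  · rw [Prod.Lex.toLex_le_toLex]
    exact Or.inl (by simp only; omega)

theorem mem_lexPast_of_add_le {a : ℕ} (ha : 1 ≤ a) {i j u v : ℤ} (h : u + a ≤ i) :
    (u, v) ∈ lexPast a i j := by
  refine ⟨le_max_of_le_left ?_, ?_⟩
  · simp only
    rw [abs_sub_comm]
    exact (by omega : (a : ℤ) ≤ i - u).trans (le_abs_self _)
  · rw [Prod.Lex.toLex_le_toLex]
    exact Or.inl (by simp only; omega)

theorem toLex_rowOf_colOf_le {l k : ℕ} (hl : 1 ≤ l) (hlk : l ≤ k) :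
    toLex ((rowOf l : ℤ), (colOf l : ℤ)) ≤ toLex ((rowOf k : ℤ), (colOf k : ℤ)) := by
  rw [Prod.Lex.toLex_le_toLex]
  rcases (rowOf_mono hl hlk).lt_or_eq with h | h
  · exact Or.inl (by simp only; exact_mod_cast h)
  · refine Or.inr ⟨by simp only; exact_mod_cast h, ?_⟩
    have h1 := eq_rowStart_add_colOf hl
    have h2 := eq_rowStart_add_colOf (hl.trans hlk)
    rw [h] at h1
    simp only
    omega

theorem pastSystem_flatField {γ : ℤ × ℤ → Ω → ℝ} (hγ : ∀ p, Measurable (γ p)) {a : ℕ} (ha : 1 ≤ a) :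
    PastSystem (flatField γ) a (a + 2 * a + 2 * a * (2 * a) : ℕ)
      (fun k => fieldSigma γ a (rowOf k) (colOf k))
      (fun k l => 1 ≤ l ∧ l + a ≤ k ∧
        ((rowOf l : ℤ), (colOf l : ℤ)) ∈ lexPast a (rowOf k) (colOf k))
      (fun k l => 1 ≤ l ∧ rowOf l + a ≤ rowOf k) where
  le k := iSup₂_le fun p _ => (hγ p).comap_le
  add_le k l h := h.2.1
  measurable k l hl h := by
    have e : flatField γ l = γ ((rowOf l : ℤ), (colOf l : ℤ)) := by
      funext ω
      rw [flatField, if_neg (by omega)]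
    rw [e]
    exact (comap_measurable _).mono (le_iSup₂_of_le _ h.2.2 le_rfl) le_rfl
  card_bad k := by
    classical
    refine Nat.cast_le.2 ?_
    set s := (Finset.Ico 1 k).filter fun l => ¬(1 ≤ l ∧ l + a ≤ k ∧
        ((rowOf l : ℤ), (colOf l : ℤ)) ∈ lexPast a (rowOf k) (colOf k)) with hs
    have h1 : (s.filter fun l => k < l + a).card ≤ a := card_near_le a k fun l hl => by
      simp only [hs, Finset.mem_filter, Finset.mem_Ico] at hl
      omega
    have hmem : ∀ l ∈ s.filter fun l => ¬ k < l + a, 1 ≤ l ∧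
        (rowOf l : ℤ) ∈ Finset.Ioo ((rowOf k : ℤ) - a) (rowOf k + a) ∧
        (colOf l : ℤ) ∈ Finset.Ioo ((colOf k : ℤ) - a) (colOf k + a) := by
      intro l hl
      simp only [hs, Finset.mem_filter, Finset.mem_Ico, not_lt] at hl
      obtain ⟨⟨⟨h1, h2⟩, h3⟩, h4⟩ := hl
      have h5 : ¬ (a : ℤ) ≤ max |(rowOf l : ℤ) - rowOf k| |(colOf l : ℤ) - colOf k| := fun h5 =>
        h3 ⟨h1, h4, h5, toLex_rowOf_colOf_le h1 h2.le⟩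
      rw [not_le, max_lt_iff, abs_lt, abs_lt] at h5
      rw [Finset.mem_Ioo, Finset.mem_Ioo]
      omega
    have h2 := (card_le_of_rowOf_mem (fun l hl => (hmem l hl).1) (fun l hl => (hmem l hl).2.1)
      (fun l hl => (hmem l hl).2.2)).trans
        (Nat.mul_le_mul (card_Ioo_sub_add _ _) (card_Ioo_sub_add _ _))
    have h3 := Finset.card_filter_add_card_filter_not (s := s) (fun l => k < l + a)
    have : s.card ≤ a + 2 * a + 2 * a * (2 * a) := by omega
    convert this
  far_le k l h := by
    refine iSup₂_le fun p hp => le_iSup₂_of_le p (lexPast_mono ha ?_ hp) le_rfl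
    exact_mod_cast h.2
  far_good k l l' h hl' hle := by
    have hl : 1 ≤ l := h.1
    have h1 := rowOf_mono hl' hle
    have h2 := le_rowStart_succ_rowOf hl
    have hr : 1 ≤ rowOf l := (rowOf_colOf_spec hl).1.trans (rowOf_colOf_spec hl).2.1
    have hk : 1 ≤ k := by
      by_contra! hk
      obtain rfl : k = 0 := by omega
      have : rowOf 0 = 0 := by simp [rowOf]
      omega
    have h3 := rowStart_add_le hr (a - 1)
    rw [show rowOf l + 1 + (a - 1) = rowOf l + a by omega] at h3
    have h4 := rowStart_mono h.2
    have h5 := eq_rowStart_add_colOf hk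
    have h6 := (rowOf_colOf_spec hk).1
    refine ⟨hl', by omega, mem_lexPast_of_add_le ha ?_⟩
    have := h.2
    omega
  card_close n k hk := by
    classical
    rw [← Nat.cast_mul]
    refine Nat.cast_le.2 ?_
    rw [Finset.mem_Icc] at hk
    set s := (Finset.Icc 1 (rowStart (n + 1))).filter fun l =>
      ¬(1 ≤ l ∧ rowOf l + a ≤ rowOf k) ∧ ¬(1 ≤ k ∧ rowOf k + a ≤ rowOf l) with hs
    have hmem : ∀ l ∈ s, 1 ≤ l ∧
        (rowOf l : ℤ) ∈ Finset.Ioo ((rowOf k : ℤ) - a) (rowOf k + a) ∧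
        (colOf l : ℤ) ∈ Finset.Ioc (0 : ℤ) n := by
      intro l hl
      simp only [hs, Finset.mem_filter, Finset.mem_Icc] at hl
      have h1 := rowOf_colOf_spec hl.1.1
      have h2 := rowOf_le hl.1.1 hl.1.2
      rw [Finset.mem_Ioo, Finset.mem_Ioc]
      omega
    have h2 := (card_le_of_rowOf_mem (fun l hl => (hmem l hl).1) (fun l hl => (hmem l hl).2.1)
      (fun l hl => (hmem l hl).2.2)).trans
        (Nat.mul_le_mul (card_Ioo_sub_add _ _) (by simp : _ ≤ n))
    have : s.card ≤ (a + 2 * a + 2 * a * (2 * a)) * n :=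
      h2.trans (Nat.mul_le_mul_right n (by omega))
    convert this

end Systems

end MartingaleMatrix

namespace MartingaleMatrix

section Mixing

set_option linter.unusedSectionVars false

variable {Ω : Type*} [mΩ : MeasurableSpace Ω] {P : Measure Ω} [IsProbabilityMeasure P]

/-- The sequence `D` with its value at `0` replaced by `0`. -/
def dropZero (D : ℕ → Ω → ℝ) (k : ℕ) (ω : Ω) : ℝ := if k = 0 then 0 else D k ω

theorem dropZero_of_pos (D : ℕ → Ω → ℝ) {k : ℕ} (hk : 1 ≤ k) : dropZero D k = D k := by
  funext ω
  rw [dropZero, if_neg (by omega)]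

theorem naturalSigma_dropZero (D : ℕ → Ω → ℝ) (k : ℕ) :
    naturalSigma (dropZero D) k = naturalSigma D k :=
  iSup_congr fun j => iSup_congr fun hj => by rw [dropZero_of_pos D hj.1]

theorem naturalSigma_zero (D : ℕ → Ω → ℝ) : naturalSigma D 0 = ⊥ := by
  simp [naturalSigma]

theorem flatField_position (γ : ℤ × ℤ → Ω → ℝ) {i j : ℕ} (hj : 1 ≤ j) (hji : j ≤ i) :
    flatField γ (position i j) = γ ((i : ℤ), (j : ℤ)) := by
  funext ω
  obtain ⟨h1, h2⟩ := rowOf_position hj hji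
  rw [flatField, if_neg (by rw [position_eq]; omega), h1, h2]

theorem mixingField_flatField (γ : ℤ × ℤ → Ω → ℝ) (a n : ℕ) (ω : Ω) :
    mixingField P (flatField γ) (fun k => fieldSigma γ a (rowOf k) (colOf k)) n ω
      = ∑ i ∈ Finset.Icc 1 n, ∑ j ∈ Finset.Icc 1 i,
        |(P[fun ω' => γ ((i : ℤ), (j : ℤ)) ω' ^ 2 | fieldSigma γ a (i : ℤ) (j : ℤ)]) ω
          - ∫ ω', γ ((i : ℤ), (j : ℤ)) ω' ^ 2 ∂P| := by
  rw [mixingField, ← sum_position]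
  refine Finset.sum_congr rfl fun i _ => Finset.sum_congr rfl fun j hj => ?_
  obtain ⟨hj1, hj2⟩ := Finset.mem_Icc.1 hj
  rw [flatField_position γ hj1 hj2, (rowOf_position hj1 hj2).1, (rowOf_position hj1 hj2).2]

theorem eventually_lt_of_tendsto_limsup {s : ℕ → ℕ → ℝ}
    (h : Tendsto (fun a => limsup (fun n => ENNReal.ofReal (s a n)) atTop) atTop (𝓝 0)) {ε : ℝ}
    (hε : 0 < ε) : ∀ᶠ a in atTop, ∀ᶠ n in atTop, s a n < ε := by
  filter_upwards [h.eventually_lt_const (ENNReal.ofReal_pos.2 hε)] with a ha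
  filter_upwards [eventually_lt_of_limsup_lt ha] with n hn
  exact (ENNReal.ofReal_lt_ofReal_iff hε).1 hn

theorem mixingVanishes_mixingField {γ : ℤ × ℤ → Ω → ℝ}
    (h : ∀ᵐ ω ∂P, Tendsto (fun a : ℕ => limsup
        (fun n : ℕ => ENNReal.ofReal ((1 / (n : ℝ) ^ 2) *
          ∑ i ∈ Finset.Icc 1 n, ∑ j ∈ Finset.Icc 1 i,
          |(P[fun ω' => γ ((i : ℤ), (j : ℤ)) ω' ^ 2 | fieldSigma γ a (i : ℤ) (j : ℤ)]) ω
            - ∫ ω', γ ((i : ℤ), (j : ℤ)) ω' ^ 2 ∂P|)) atTop) atTop (𝓝 0)) :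
    ∀ᵐ ω ∂P, MixingVanishes fun a n =>
      mixingField P (flatField γ) (fun k => fieldSigma γ a (rowOf k) (colOf k)) n ω := by
  filter_upwards [h] with ω hω ε hε
  filter_upwards [eventually_lt_of_tendsto_limsup hω hε] with a ha
  filter_upwards [ha] with n hn
  rwa [mixingField_flatField, div_eq_inv_mul, ← one_div]

theorem mixingD_dropZero (D : ℕ → Ω → ℝ) {a : ℕ} (ha : 1 ≤ a) (n : ℕ) (ω : Ω) :
    mixingD P (dropZero D) a n ω = ∑ k ∈ Finset.Icc a (rowStart (n + 1)),
      |(P[fun ω' => D k ω' ^ 2 | naturalSigma D (k - a)]) ω - ∫ ω', D k ω' ^ 2 ∂P| := by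
  symm
  rw [mixingD]
  refine Finset.sum_subset_zero_on_sdiff (Finset.Icc_subset_Icc_left ha) (fun k hk => ?_)
    fun k hk => ?_
  · simp only [Finset.mem_sdiff, Finset.mem_Icc] at hk
    rw [naturalSigma_dropZero, show k - a = 0 by omega, naturalSigma_zero, condExp_bot, sub_self,
      abs_zero]
  · have hk' := (Finset.mem_Icc.1 hk).1
    rw [naturalSigma_dropZero, dropZero_of_pos D (ha.trans hk')]

theorem le_rowStart_succ (n : ℕ) : n ≤ rowStart (n + 1) := by
  rw [rowStart_succ]
  omega

theorem mixingVanishes_mixingD {D : ℕ → Ω → ℝ}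
    (h : ∀ᵐ ω ∂P, Tendsto (fun a : ℕ => limsup
        (fun n : ℕ => ENNReal.ofReal ((1 / (n : ℝ)) * ∑ i ∈ Finset.Icc a n,
          |(P[fun ω' => D i ω' ^ 2 | naturalSigma D (i - a)]) ω
            - ∫ ω', D i ω' ^ 2 ∂P|)) atTop) atTop (𝓝 0)) :
    ∀ᵐ ω ∂P, MixingVanishes fun a n => mixingD P (dropZero D) a n ω := by
  filter_upwards [h] with ω hω ε hε
  have hN : Tendsto (fun n => rowStart (n + 1)) atTop atTop :=
    tendsto_atTop_mono le_rowStart_succ tendsto_id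
  filter_upwards [eventually_lt_of_tendsto_limsup hω hε, eventually_ge_atTop 1] with a ha ha1
  filter_upwards [hN.eventually ha, eventually_ge_atTop 1] with n hn hn1
  refine lt_of_le_of_lt ?_ hn
  rw [mixingD_dropZero D ha1, div_eq_inv_mul, ← one_div]
  refine mul_le_mul_of_nonneg_right ?_ (Finset.sum_nonneg fun _ _ => abs_nonneg _)
  have h1 : (0 : ℝ) < (rowStart (n + 1) : ℝ) := by
    exact_mod_cast lt_of_lt_of_le hn1 (le_rowStart_succ n)
  exact one_div_le_one_div_of_le h1 (by exact_mod_cast rowStart_succ_le_sq n)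

theorem mixingVanishes_of_eq_zero {s : ℕ → ℕ → ℝ} (h : ∀ a, 1 ≤ a → ∀ n, s a n = 0) :
    MixingVanishes s := fun ε hε => by
  filter_upwards [eventually_ge_atTop 1] with a ha
  exact Eventually.of_forall fun n => by rw [h a ha, zero_div]; exact hε

theorem mixingField_const (n : ℕ) (ω : Ω) :
    mixingField P (fun _ _ => (1 : ℝ)) (fun _ => ⊥) n ω = 0 :=
  Finset.sum_eq_zero fun k _ => by rw [condExp_bot, sub_self, abs_zero]

end Mixing

section Gaussian

set_option linter.unusedSectionVars false

variable {Ω : Type*} [mΩ : MeasurableSpace Ω] {P : Measure Ω} [IsProbabilityMeasure P]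

theorem exists_gaussianReal_moment_le (V : ℝ) {p : ℝ} (hp : 0 < p) :
    ∃ L : ℝ, 0 ≤ L ∧ ∀ v : NNReal, (v : ℝ) ≤ V →
      ∫⁻ x, ENNReal.ofReal (|x| ^ p) ∂(gaussianReal 0 v) ≤ ENNReal.ofReal L := by
  set I := ∫⁻ x, ENNReal.ofReal (|x| ^ p) ∂(gaussianReal 0 1) with hI
  have hIfin : I ≠ ⊤ := by
    have h := memLp_id_gaussianReal (μ := 0) (v := 1) p.toNNReal
    have h2 := lintegral_rpow_enorm_lt_top_of_eLpNorm_lt_top (p := ((p.toNNReal : NNReal) : ENNReal))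
      (by simpa using hp) (by simp) h.2
    refine (lt_of_eq_of_lt ?_ h2).ne
    refine lintegral_congr fun x => ?_
    rw [ENNReal.coe_toReal, Real.coe_toNNReal p hp.le, id, Real.enorm_eq_ofReal_abs,
      ENNReal.ofReal_rpow_of_nonneg (abs_nonneg x) hp.le]
  refine ⟨√V ^ p * I.toReal, by positivity, fun v hv => ?_⟩
  have hmap : gaussianReal 0 v = (gaussianReal 0 1).map (√(v : ℝ) * ·) := by
    rw [gaussianReal_map_const_mul, mul_zero, mul_one]
    congr 1
    ext
    simp
  rw [hmap, lintegral_map (by fun_prop) (by fun_prop), ENNReal.ofReal_mul (by positivity),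
    ENNReal.ofReal_toReal hIfin, hI, ← lintegral_const_mul _ (by fun_prop)]
  refine lintegral_mono fun x => ?_
  rw [← ENNReal.ofReal_mul (by positivity), abs_mul, Real.mul_rpow (abs_nonneg _) (abs_nonneg _),
    abs_of_nonneg (Real.sqrt_nonneg _)]
  refine ENNReal.ofReal_le_ofReal (mul_le_mul_of_nonneg_right ?_ (by positivity))
  exact Real.rpow_le_rpow (Real.sqrt_nonneg _) (Real.sqrt_le_sqrt hv) hp.le

/-- `(W k)_{k ≥ 1}` are independent centered Gaussian variables with variances `v k`. -/
structure GaussianSequence (P : Measure Ω) (W : ℕ → Ω → ℝ) (v : ℕ → NNReal) : Prop where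
  measurable : ∀ k, Measurable (W k)
  law : ∀ k, P.map (W k) = gaussianReal 0 (v k)
  indep : iIndepFun (fun k : {k : ℕ // 1 ≤ k} => W k) P

namespace GaussianSequence

variable {W : ℕ → Ω → ℝ} {v : ℕ → NNReal}

theorem integral_eq_zero (hW : GaussianSequence P W v) (k : ℕ) : ∫ ω, W k ω ∂P = 0 := by
  have h := integral_map (μ := P) (hW.measurable k).aemeasurable (f := fun x : ℝ => x)
    measurable_id.aestronglyMeasurable
  rw [← h, hW.law, integral_id_gaussianReal]

theorem integral_sq (hW : GaussianSequence P W v) (k : ℕ) : ∫ ω, W k ω ^ 2 ∂P = v k := by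
  have h := integral_map (μ := P) (hW.measurable k).aemeasurable (f := fun x : ℝ => x ^ 2)
    (measurable_id.pow_const 2).aestronglyMeasurable
  have h2 := variance_id_gaussianReal (μ := 0) (v := v k)
  rw [variance_eq_sub (memLp_id_gaussianReal 2)] at h2
  simp only [id, integral_id_gaussianReal] at h2
  rw [← h, hW.law, ← h2]
  simp

theorem exists_moment_le (hW : GaussianSequence P W v) {V : ℝ} (hV : ∀ k, (v k : ℝ) ≤ V) {p : ℝ}
    (hp : 0 < p) : ∃ L : ℝ, 0 ≤ L ∧ ∀ k,
      ∫⁻ ω, ENNReal.ofReal (|W k ω| ^ p) ∂P ≤ ENNReal.ofReal L := by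
  obtain ⟨L, hL, h⟩ := exists_gaussianReal_moment_le V hp
  refine ⟨L, hL, fun k => ?_⟩
  refine le_of_eq_of_le ?_ (h (v k) (hV k))
  rw [← hW.law, lintegral_map (by fun_prop) (hW.measurable k)]

theorem indepFun_block (hW : GaussianSequence P W v) {k : ℕ} (hk : 1 ≤ k) {T : Finset ℕ}
    (hT : ∀ l ∈ T, 1 ≤ l) (hkT : k ∉ T) :
    IndepFun (W k) (fun ω l => if l ∈ T then W l ω else 0) P := by
  have h := hW.indep.indepFun_finset {⟨k, hk⟩} (T.subtype fun l => 1 ≤ l)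
    (by simpa using hkT) fun i => hW.measurable i
  set φ : (({⟨k, hk⟩} : Finset {k : ℕ // 1 ≤ k}) → ℝ) → ℝ :=
    fun x => x ⟨⟨k, hk⟩, Finset.mem_singleton_self _⟩
  set ψ : ((T.subtype fun l => 1 ≤ l) → ℝ) → ℕ → ℝ := fun x l =>
    if hl : l ∈ T then x ⟨⟨l, hT l hl⟩, Finset.mem_subtype.2 hl⟩ else 0
  have hφ : Measurable φ := measurable_pi_apply _
  have hψ : Measurable ψ := by
    refine measurable_pi_lambda _ fun l => ?_
    by_cases hl : l ∈ T
    · simpa only [ψ, dif_pos hl] using measurable_pi_apply _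
    · simpa only [ψ, dif_neg hl] using measurable_const
  have e : (fun ω l => if l ∈ T then W l ω else 0)
      = ψ ∘ fun ω (i : (T.subtype fun l => 1 ≤ l)) => W i ω := by
    funext ω l
    by_cases hl : l ∈ T <;> simp [ψ, hl]
  rw [e]
  exact h.comp hφ hψ

theorem indep_naturalSigma (hW : GaussianSequence P W v) {k m : ℕ} (hm : m < k) :
    Indep (MeasurableSpace.comap (W k) inferInstance) (naturalSigma W m) P := by
  have h := hW.indepFun_block (k := k) (by omega) (T := Finset.Icc 1 m)
    (fun l hl => (Finset.mem_Icc.1 hl).1) (by simp; omega)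
  rw [IndepFun_iff_Indep] at h
  refine indep_of_indep_of_le_right h (iSup₂_le fun j hj => ?_)
  have e : W j = (fun x : ℕ → ℝ => x j) ∘
      (fun ω l => if l ∈ Finset.Icc 1 m then W l ω else 0) := by
    funext ω
    simp only [Function.comp_apply]
    rw [if_pos (Finset.mem_Icc.2 hj)]
  rw [e, ← MeasurableSpace.comap_comp]
  exact MeasurableSpace.comap_mono (measurable_pi_apply j).comap_le

theorem condExp_comp (hW : GaussianSequence P W v) {k m : ℕ} (hm : m < k) {φ : ℝ → ℝ}
    (hφ : Measurable φ) :
    P[fun ω => φ (W k ω) | naturalSigma W m] =ᵐ[P] fun _ => ∫ ω, φ (W k ω) ∂P :=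
  condExp_indep_eq (hW.measurable k).comap_le (naturalSigma_le (fun k _ => hW.measurable k) m)
    (hφ.comp (comap_measurable (W k))).stronglyMeasurable (hW.indep_naturalSigma hm)

theorem mixingVanishes (hW : GaussianSequence P W v) :
    ∀ᵐ ω ∂P, MixingVanishes fun a n => mixingD P W a n ω := by
  have h : ∀ᵐ ω ∂P, ∀ a, 1 ≤ a → ∀ k, 1 ≤ k →
      (P[fun ω' => W k ω' ^ 2 | naturalSigma W (k - a)]) ω = ∫ ω', W k ω' ^ 2 ∂P := by
    refine ae_all_iff.2 fun a => ae_all_iff.2 fun ha => ae_all_iff.2 fun k => ae_all_iff.2 fun hk =>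
      ?_
    exact hW.condExp_comp (by omega) (measurable_id.pow_const 2)
  filter_upwards [h] with ω hω
  refine mixingVanishes_of_eq_zero fun a ha n => Finset.sum_eq_zero fun k hk => ?_
  rw [hω a ha k (Finset.mem_Icc.1 hk).1, sub_self, abs_zero]

/-- A Gaussian sequence is its own comparison model. -/
theorem productModel (hW : GaussianSequence P W v) {δ L : ℝ} (hδ : 0 < δ) (hδ1 : δ ≤ 1)
    (hL : 0 ≤ L) (hm : ∀ k, ∫⁻ ω, ENNReal.ofReal (|W k ω| ^ (2 + δ)) ∂P ≤ ENNReal.ofReal L) :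
    ProductModel P P P (fun _ _ => (1 : ℝ)) W W δ L 1 where
  measurable_γ _ := measurable_const
  measurable_D := hW.measurable
  measurable_Y := hW.measurable
  delta_pos := hδ
  delta_le := hδ1
  L_nonneg := hL
  c_nonneg := zero_le_one
  moment_D := hm
  moment_Y := hm
  condExp_D k hk := by
    refine (hW.condExp_comp (m := k - 1) (by omega) measurable_id).trans ?_
    simp only [id, hW.integral_eq_zero]
    rfl
  bound_γ := by simp
  mean_Y := hW.integral_eq_zero
  variance_Y k := by simp
  indep_Y k N hk := hW.indepFun_block hk (fun l hl => by
    have := (Finset.mem_Ioc.1 hl).1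
    omega) (by simp)

end GaussianSequence

end Gaussian

end MartingaleMatrix

namespace MartingaleMatrix

section Transfer

set_option linter.unusedSectionVars false

variable {Ω : Type*} [mΩ : MeasurableSpace Ω] {P : Measure Ω} [IsProbabilityMeasure P]

/-- An almost sure property of independent copies of two independent variables holds almost surely
for the variables themselves. -/
theorem ae_of_ae_prod_of_indepFun {α β : Type*} [MeasurableSpace α] [MeasurableSpace β] {U : Ω → α}
    {V : Ω → β} (hU : Measurable U) (hV : Measurable V) (h : IndepFun U V P) {S : Set (α × β)}
    (hS : MeasurableSet S) (hae : ∀ᵐ p ∂(P.prod P), (U p.1, V p.2) ∈ S) :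
    ∀ᵐ ω ∂P, (U ω, V ω) ∈ S := by
  have h1 := (indepFun_iff_map_prod_eq_prod_map_map hU.aemeasurable hV.aemeasurable).1 h
  rw [Measure.map_prod_map _ _ hU hV] at h1
  have h2 : ∀ᵐ x ∂(P.prod P).map (Prod.map U V), x ∈ S :=
    (ae_map_iff (hU.prodMap hV).aemeasurable hS).2 hae
  rw [← h1] at h2
  exact (ae_map_iff (hU.prodMk hV).aemeasurable hS).1 h2

theorem measurable_seqStieltjes (n : ℕ) {z : ℂ} (hz : 0 < z.im) :
    Measurable (seqStieltjes n z) := by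
  have : Continuous (seqStieltjes n z) := by
    unfold seqStieltjes
    simp only [stieltjes_eq]
    exact continuous_const.mul (continuous_green_seqMatrix hz).matrix_trace
  exact this.measurable

/-- The flattened entries `γ_{ij} D_{u(i,j)}`. -/
def flatEntry (γ : ℤ × ℤ → Ω → ℝ) (D : ℕ → Ω → ℝ) (ω : Ω) (k : ℕ) : ℝ :=
  flatField γ k ω * dropZero D k ω

theorem ae_tendsto_diagonal {γ : ℤ × ℤ → Ω → ℝ} {D : ℕ → Ω → ℝ} (hγ : ∀ p, Measurable (γ p))
    (hD : ∀ i, 1 ≤ i → Measurable (D i))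
    (h : IndepFun (fun ω (p : ℤ × ℤ) => γ p ω) (fun ω (i : {i : ℕ // 1 ≤ i}) => D i ω) P)
    {z : ℂ} (hz : 0 < z.im) {m : ℕ → ℕ} {μ : ℕ → ℂ}
    (hae : ∀ᵐ p ∂(P.prod P), Tendsto (fun j =>
      seqStieltjes (m j) z (prodEntry (flatField γ) (dropZero D) p) - μ j) atTop (𝓝 0)) :
    ∀ᵐ ω ∂P, Tendsto (fun j => seqStieltjes (m j) z (flatEntry γ D ω) - μ j) atTop (𝓝 0) := by
  set E : (ℤ × ℤ → ℝ) × ({i : ℕ // 1 ≤ i} → ℝ) → ℕ → ℝ := fun x k =>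
    if hk : 1 ≤ k then x.1 ((rowOf k : ℤ), (colOf k : ℤ)) * x.2 ⟨k, hk⟩ else 0 with hE
  have hEm : Measurable E := by
    refine measurable_pi_lambda _ fun k => ?_
    by_cases hk : 1 ≤ k
    · simp only [hE, dif_pos hk]
      fun_prop
    · simp only [hE, dif_neg hk]
      exact measurable_const
  have hS : MeasurableSet {x | Tendsto (fun j => seqStieltjes (m j) z (E x) - μ j) atTop (𝓝 0)} :=
    measurableSet_tendsto _ fun j =>
      ((measurable_seqStieltjes (m j) hz).comp hEm).sub measurable_const
  have key : ∀ ω ω', E ((fun p => γ p ω), (fun i => D i ω'))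
      = fun k => flatField γ k ω * dropZero D k ω' := by
    intro ω ω'
    funext k
    by_cases hk : 1 ≤ k
    · simp only [hE, dif_pos hk, flatField, dropZero, if_neg (show ¬ k = 0 by omega)]
    · obtain rfl : k = 0 := by omega
      simp [hE, flatField]
  have := ae_of_ae_prod_of_indepFun (measurable_pi_lambda _ fun p => hγ p)
    (measurable_pi_lambda _ fun i : {i : ℕ // 1 ≤ i} => hD i i.2) h hS (by
      filter_upwards [hae] with p hp
      simp only [key]
      exact hp)
  filter_upwards [this] with ω hω
  simp only [key] at hω
  exact hω

theorem symmetricMatrix_congr {x y : ℕ → ℕ → ℝ} (h : ∀ i j, 1 ≤ j → j ≤ i → x i j = y i j) (n : ℕ) :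
    symmetricMatrix x n = symmetricMatrix y n := by
  ext i j
  simp only [symmetricMatrix, Matrix.of_apply]
  split_ifs with hij
  · exact h _ _ (by omega) (by have : (j : ℕ) ≤ i := hij; omega)
  · exact h _ _ (by omega) (by have : (i : ℕ) < j := not_le.1 hij; omega)

theorem flatEntry_position (γ : ℤ × ℤ → Ω → ℝ) (D : ℕ → Ω → ℝ) (ω : Ω) {i j : ℕ} (hj : 1 ≤ j)
    (hji : j ≤ i) : flatEntry γ D ω (position i j) = entry γ D i j ω := by
  rw [flatEntry, flatField_position γ hj hji,
    dropZero_of_pos D (by rw [position_eq]; omega : 1 ≤ position i j), entry]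

/-- The lower triangular array `Y` read along the positions, extended by `0` to the position `0`. -/
def flatArray (Y : ℕ → ℕ → Ω → ℝ) (k : ℕ) (ω : Ω) : ℝ :=
  if k = 0 then 0 else Y (rowOf k) (colOf k) ω

theorem flatArray_position (Y : ℕ → ℕ → Ω → ℝ) (ω : Ω) {i j : ℕ} (hj : 1 ≤ j) (hji : j ≤ i) :
    flatArray Y (position i j) ω = Y i j ω := by
  obtain ⟨h1, h2⟩ := rowOf_position hj hji
  rw [flatArray, if_neg (by rw [position_eq]; omega), h1, h2]

theorem entry_rowOf_colOf (γ : ℤ × ℤ → Ω → ℝ) (D : ℕ → Ω → ℝ) {k : ℕ} (hk : 1 ≤ k) (ω : Ω) :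
    entry γ D (rowOf k) (colOf k) ω = flatEntry γ D ω k := by
  obtain ⟨h1, h2, h3⟩ := rowOf_colOf_spec hk
  rw [← flatEntry_position γ D ω h1 h2, h3]

theorem gaussianSequence_flatArray {Y : ℕ → ℕ → Ω → ℝ} {γ : ℤ × ℤ → Ω → ℝ} {D : ℕ → Ω → ℝ}
    (hm : ∀ i j, 1 ≤ j → j ≤ i → Measurable (Y i j))
    (hlaw : ∀ i j, 1 ≤ j → j ≤ i → P.map (Y i j) =
      gaussianReal 0 (∫ ω, entry γ D i j ω ^ 2 ∂P).toNNReal)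
    (hind : iIndepFun (fun (p : LowerIndex) => Y p.1.1 p.1.2) P) :
    GaussianSequence P (flatArray Y) fun k => (∫ ω, flatEntry γ D ω k ^ 2 ∂P).toNNReal := by
  have heq : ∀ k, 1 ≤ k → flatArray Y k = Y (rowOf k) (colOf k) := fun k hk => by
    funext ω
    rw [flatArray, if_neg (by omega)]
  have hzero : flatArray Y 0 = fun _ => 0 := by
    funext ω
    simp [flatArray]
  refine ⟨fun k => ?_, fun k => ?_, ?_⟩
  · rcases Nat.eq_zero_or_pos k with rfl | hk
    · rw [hzero]
      exact measurable_const
    · obtain ⟨h1, h2, -⟩ := rowOf_colOf_spec hk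
      rw [heq k hk]
      exact hm _ _ h1 h2
  · rcases Nat.eq_zero_or_pos k with rfl | hk
    · simp [hzero, flatEntry, flatField]
    · obtain ⟨h1, h2, -⟩ := rowOf_colOf_spec hk
      rw [heq k hk, hlaw _ _ h1 h2]
      simp only [entry_rowOf_colOf γ D hk]
  · have h := hind.precomp (g := fun k : {k : ℕ // 1 ≤ k} =>
      (⟨(rowOf k, colOf k), (rowOf_colOf_spec k.2).1, (rowOf_colOf_spec k.2).2.1⟩ : LowerIndex))
      (fun k l hkl => by
        simp only [Subtype.mk.injEq, Prod.mk.injEq] at hkl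
        refine Subtype.ext ?_
        rw [eq_rowStart_add_colOf k.2, eq_rowStart_add_colOf l.2, hkl.1, hkl.2])
    have e : (fun k : {k : ℕ // 1 ≤ k} => flatArray Y k)
        = fun k : {k : ℕ // 1 ≤ k} => Y (rowOf k) (colOf k) := funext fun k => heq k k.2
    rw [e]
    exact h

end Transfer

section Model

set_option linter.unusedSectionVars false

variable {Ω : Type*} [mΩ : MeasurableSpace Ω] {P : Measure Ω} [IsProbabilityMeasure P]
  {γ : ℤ × ℤ → Ω → ℝ} {D : ℕ → Ω → ℝ}

theorem lintegral_rpow_le_of_le {δ δ' : ℝ} (hδ' : 0 < δ') (hle : δ' ≤ δ) {u : Ω → ℝ} :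
    ∫⁻ ω, ENNReal.ofReal (|u ω| ^ (2 + δ')) ∂P
      ≤ 1 + ∫⁻ ω, ENNReal.ofReal (|u ω| ^ (2 + δ)) ∂P := by
  have h : ∀ x : ℝ, 0 ≤ x → x ^ (2 + δ') ≤ 1 + x ^ (2 + δ) := by
    intro x hx
    rcases le_total x 1 with h1 | h1
    · have := Real.rpow_le_one hx h1 (by linarith : 0 ≤ 2 + δ')
      have : 0 ≤ x ^ (2 + δ) := by positivity
      linarith
    · have := Real.rpow_le_rpow_of_exponent_le h1 (by linarith : 2 + δ' ≤ 2 + δ)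
      linarith
  calc ∫⁻ ω, ENNReal.ofReal (|u ω| ^ (2 + δ')) ∂P
      ≤ ∫⁻ ω, (1 + ENNReal.ofReal (|u ω| ^ (2 + δ))) ∂P := lintegral_mono fun ω => by
        rw [← ENNReal.ofReal_one, ← ENNReal.ofReal_add zero_le_one (by positivity)]
        exact ENNReal.ofReal_le_ofReal (h _ (abs_nonneg _))
    _ = 1 + ∫⁻ ω, ENNReal.ofReal (|u ω| ^ (2 + δ)) ∂P := by
        rw [lintegral_add_left measurable_const, lintegral_one, measure_univ]

theorem exists_moment_dropZero_le {δ δ' : ℝ} (hδ' : 0 < δ') (hle : δ' ≤ δ)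
    (h : ⨆ (i : ℕ) (_ : 1 ≤ i), ∫⁻ ω, ENNReal.ofReal (|D i ω| ^ (2 + δ)) ∂P < ⊤) :
    ∃ L : ℝ, 0 ≤ L ∧ ∀ k, ∫⁻ ω, ENNReal.ofReal (|dropZero D k ω| ^ (2 + δ')) ∂P
      ≤ ENNReal.ofReal L := by
  set B := ⨆ (i : ℕ) (_ : 1 ≤ i), ∫⁻ ω, ENNReal.ofReal (|D i ω| ^ (2 + δ)) ∂P with hB
  refine ⟨1 + B.toReal, by positivity, fun k => ?_⟩
  rcases Nat.eq_zero_or_pos k with rfl | hk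
  · simp [dropZero, Real.zero_rpow (by linarith : 2 + δ' ≠ 0)]
  · rw [dropZero_of_pos D hk]
    refine (lintegral_rpow_le_of_le hδ' hle).trans ?_
    rw [ENNReal.ofReal_add zero_le_one ENNReal.toReal_nonneg, ENNReal.ofReal_one,
      ENNReal.ofReal_toReal h.ne]
    exact add_le_add le_rfl (le_iSup₂ (f := fun (i : ℕ) (_ : 1 ≤ i) =>
      ∫⁻ ω, ENNReal.ofReal (|D i ω| ^ (2 + δ)) ∂P) k hk)

theorem ae_abs_flatField_le {c : ℝ}
    (h : ∀ᵐ ω ∂P, ∀ i j : ℕ, 1 ≤ j → j ≤ i → |γ ((i : ℤ), (j : ℤ)) ω| ≤ c) :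
    ∀ᵐ ω ∂P, ∀ k, |flatField γ k ω| ≤ |c| := by
  filter_upwards [h] with ω hω k
  rcases Nat.eq_zero_or_pos k with rfl | hk
  · simp [flatField]
  · rw [flatField, if_neg (by omega)]
    exact (hω _ _ (rowOf_colOf_spec hk).1 (rowOf_colOf_spec hk).2.1).trans (le_abs_self c)

theorem integral_flatEntry_sq (hγ : ∀ p, Measurable (γ p)) (hD : ∀ i, 1 ≤ i → Measurable (D i))
    (h : IndepFun (fun ω (p : ℤ × ℤ) => γ p ω) (fun ω (i : {i : ℕ // 1 ≤ i}) => D i ω) P) (k : ℕ) :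
    ∫ ω, flatEntry γ D ω k ^ 2 ∂P
      = (∫ ω, flatField γ k ω ^ 2 ∂P) * ∫ ω, dropZero D k ω ^ 2 ∂P := by
  rcases Nat.eq_zero_or_pos k with rfl | hk
  · simp [flatEntry, flatField]
  · have e : flatField γ k = γ ((rowOf k : ℤ), (colOf k : ℤ)) := by
      funext ω
      rw [flatField, if_neg (by omega)]
    have h1 : IndepFun (fun ω => γ ((rowOf k : ℤ), (colOf k : ℤ)) ω ^ 2) (fun ω => D k ω ^ 2) P :=
      h.comp (φ := fun x : ℤ × ℤ → ℝ => x ((rowOf k : ℤ), (colOf k : ℤ)) ^ 2)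
        (ψ := fun x : {i : ℕ // 1 ≤ i} → ℝ => x ⟨k, hk⟩ ^ 2) (by fun_prop) (by fun_prop)
    simp only [flatEntry, dropZero_of_pos D hk, e, mul_pow]
    exact h1.integral_fun_mul_eq_mul_integral ((hγ _).pow_const 2).aestronglyMeasurable
      ((hD k hk).pow_const 2).aestronglyMeasurable

theorem integral_flatField_sq_le {c : ℝ} (h : ∀ᵐ ω ∂P, ∀ k, |flatField γ k ω| ≤ |c|) (k : ℕ) :
    ∫ ω, flatField γ k ω ^ 2 ∂P ≤ c ^ 2 := by
  have := integral_mono_of_nonneg (μ := P) (f := fun ω => flatField γ k ω ^ 2) (g := fun _ => c ^ 2)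
    (Eventually.of_forall fun ω => sq_nonneg _) (integrable_const _) (by
      filter_upwards [h] with ω hω
      exact sq_le_sq.2 (hω k))
  simpa using this

theorem measurable_dropZero (hD : ∀ i, 1 ≤ i → Measurable (D i)) (k : ℕ) :
    Measurable (dropZero D k) := by
  rcases Nat.eq_zero_or_pos k with rfl | hk
  · have : dropZero D 0 = fun _ => 0 := by
      funext ω
      simp [dropZero]
    rw [this]
    exact measurable_const
  · rw [dropZero_of_pos D hk]
    exact hD k hk

theorem lintegral_flatEntry_le {c δ L : ℝ} (hδ : 0 < δ)
    (h : ∀ᵐ ω ∂P, ∀ k, |flatField γ k ω| ≤ |c|)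
    (hL : ∀ k, ∫⁻ ω, ENNReal.ofReal (|dropZero D k ω| ^ (2 + δ)) ∂P ≤ ENNReal.ofReal L) (k : ℕ) :
    ∫⁻ ω, ENNReal.ofReal (|flatEntry γ D ω k| ^ (2 + δ)) ∂P
      ≤ ENNReal.ofReal (|c| ^ (2 + δ) * L) := by
  calc ∫⁻ ω, ENNReal.ofReal (|flatEntry γ D ω k| ^ (2 + δ)) ∂P
      ≤ ∫⁻ ω, ENNReal.ofReal (|c| ^ (2 + δ)) * ENNReal.ofReal (|dropZero D k ω| ^ (2 + δ)) ∂P := by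
        refine lintegral_mono_ae ?_
        filter_upwards [h] with ω hω
        rw [← ENNReal.ofReal_mul (by positivity), flatEntry, abs_mul,
          Real.mul_rpow (abs_nonneg _) (abs_nonneg _)]
        refine ENNReal.ofReal_le_ofReal (mul_le_mul_of_nonneg_right ?_ (by positivity))
        exact Real.rpow_le_rpow (abs_nonneg _) (hω k) (by linarith)
    _ = ENNReal.ofReal (|c| ^ (2 + δ))
        * ∫⁻ ω, ENNReal.ofReal (|dropZero D k ω| ^ (2 + δ)) ∂P :=
        lintegral_const_mul' _ _ ENNReal.ofReal_ne_top
    _ ≤ ENNReal.ofReal (|c| ^ (2 + δ) * L) := by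
        rw [ENNReal.ofReal_mul (by positivity)]
        exact mul_le_mul_right (hL k) _

end Model

end MartingaleMatrix

end

open MartingaleMatrix

theorem mainTheorem11 {Ω : Type*} [MeasurableSpace Ω] (P : Measure Ω) [IsProbabilityMeasure P]
    (D : ℕ → Ω → ℝ) (γ : ℤ × ℤ → Ω → ℝ) (Y : ℕ → ℕ → Ω → ℝ)
    (hD_meas : ∀ i, 1 ≤ i → Measurable (D i))
    (hγ_meas : ∀ p, Measurable (γ p))
    (hY_meas : ∀ i j, 1 ≤ j → j ≤ i → Measurable (Y i j))
    -- `D` is a martingale difference sequence, the family `γ` is independent of `D`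
    (hD_mart : MartingaleMatrix.IsMartingaleDifference P D)
    (h_indep : IndepFun (fun ω (p : ℤ × ℤ) => γ p ω) (fun ω (i : {i : ℕ // 1 ≤ i}) => D i ω) P)
    -- `Y` is a family of independent centered Gaussian variables, independent of the matrix
    -- entries and with the same variances
    (hY_law : ∀ i j, 1 ≤ j → j ≤ i → P.map (Y i j) =
      gaussianReal 0 (∫ ω, MartingaleMatrix.entry γ D i j ω ^ 2 ∂P).toNNReal)
    (hY_iIndep : iIndepFun (fun (p : MartingaleMatrix.LowerIndex) => Y p.1.1 p.1.2) P)
    (hY_indep : IndepFun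
      (fun ω (p : MartingaleMatrix.LowerIndex) => MartingaleMatrix.entry γ D p.1.1 p.1.2 ω)
      (fun ω (p : MartingaleMatrix.LowerIndex) => Y p.1.1 p.1.2 ω) P)
    -- moment and boundedness conditions
    (δ : ℝ) (hδ : 0 < δ)
    (hD_moment : ⨆ (i : ℕ) (_ : 1 ≤ i), ∫⁻ ω, ENNReal.ofReal (|D i ω| ^ (2 + δ)) ∂P < ⊤)
    (c : ℝ)
    (hγ_bdd : ∀ᵐ ω ∂P, ∀ i j : ℕ, 1 ≤ j → j ≤ i → |γ ((i : ℤ), (j : ℤ)) ω| ≤ c)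
    -- almost sure mixing conditions
    (hD_mix : ∀ᵐ ω ∂P, Tendsto
      (fun a : ℕ => limsup
        (fun n : ℕ => ENNReal.ofReal ((1 / (n : ℝ)) * ∑ i ∈ Finset.Icc a n,
          |(P[fun ω' => D i ω' ^ 2 | MartingaleMatrix.naturalSigma D (i - a)]) ω
            - ∫ ω', D i ω' ^ 2 ∂P|)) atTop)
      atTop (𝓝 0))
    (hγ_mix : ∀ᵐ ω ∂P, Tendsto
      (fun a : ℕ => limsup
        (fun n : ℕ => ENNReal.ofReal ((1 / (n : ℝ) ^ 2) *
          ∑ i ∈ Finset.Icc 1 n, ∑ j ∈ Finset.Icc 1 i,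
          |(P[fun ω' => γ ((i : ℤ), (j : ℤ)) ω' ^ 2 |
              MartingaleMatrix.fieldSigma γ a (i : ℤ) (j : ℤ)]) ω
            - ∫ ω', γ ((i : ℤ), (j : ℤ)) ω' ^ 2 ∂P|)) atTop)
      atTop (𝓝 0)) :
    ∀ z : ℂ, 0 < z.im → ∀ᵐ ω ∂P, Tendsto
      (fun n : ℕ =>
        MartingaleMatrix.stieltjes
            (MartingaleMatrix.symmetricMatrix (fun i j => MartingaleMatrix.entry γ D i j ω) n) z
          - MartingaleMatrix.stieltjes
            (MartingaleMatrix.symmetricMatrix (fun i j => Y i j ω) n) z)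
      atTop (𝓝 0) := by
  intro z hz
  set δ' := min δ 1 with hδ'def
  have hδ' : 0 < δ' := lt_min hδ one_pos
  obtain ⟨L₁, hL₁, hDmom⟩ := exists_moment_dropZero_le hδ' (min_le_left δ 1) hD_moment
  have hbdd := ae_abs_flatField_le hγ_bdd
  have hDm := measurable_dropZero hD_meas
  have hvar := integral_flatEntry_sq hγ_meas hD_meas h_indep
  have hW := gaussianSequence_flatArray hY_meas hY_law hY_iIndep
  have hV : ∀ k, ((∫ ω, flatEntry γ D ω k ^ 2 ∂P).toNNReal : ℝ) ≤ c ^ 2 * (1 + L₁) := by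
    intro k
    have h1 : 0 ≤ ∫ ω, flatEntry γ D ω k ^ 2 ∂P := integral_nonneg fun _ => sq_nonneg _
    rw [Real.coe_toNNReal _ h1, hvar]
    exact mul_le_mul (integral_flatField_sq_le hbdd k)
      (memLp_two_of_moment (hDm k) hδ' hL₁ (hDmom k)).2 (integral_nonneg fun _ => sq_nonneg _)
      (sq_nonneg c)
  obtain ⟨L₂, hL₂, hYmom⟩ := hW.exists_moment_le hV (p := 2 + δ') (by linarith)
  have hXmodel : ProductModel P P P (flatField γ) (dropZero D) (flatArray Y) δ' (max L₁ L₂) |c| :=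
    { measurable_γ := measurable_flatField hγ_meas
      measurable_D := hDm
      measurable_Y := hW.measurable
      delta_pos := hδ'
      delta_le := min_le_right δ 1
      L_nonneg := hL₁.trans (le_max_left _ _)
      c_nonneg := abs_nonneg c
      moment_D := fun k => (hDmom k).trans (ENNReal.ofReal_le_ofReal (le_max_left _ _))
      moment_Y := fun k => (hYmom k).trans (ENNReal.ofReal_le_ofReal (le_max_right _ _))
      condExp_D := fun k hk => by
        rw [naturalSigma_dropZero, dropZero_of_pos D hk]
        exact (hD_mart k hk).2
      bound_γ := hbdd
      mean_Y := hW.integral_eq_zero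
      variance_Y := fun k => by
        rw [hW.integral_sq, Real.coe_toNNReal _ (integral_nonneg fun _ => sq_nonneg _), hvar]
      indep_Y := fun k N hk => hW.indepFun_block hk (fun l hl => by
        have := (Finset.mem_Ioc.1 hl).1
        omega) (by simp) }
  have hYmodel := hW.productModel hδ' (min_le_right δ 1) hL₂ hYmom
  obtain ⟨q, hq⟩ := exists_nat_ge (16 / δ')
  rw [div_le_iff₀ hδ'] at hq
  have hq0 : q ≠ 0 := by
    rintro rfl
    norm_num at hq
  have hX := ae_tendsto_diagonal hγ_meas hD_meas h_indep hz
    (ae_tendsto_seqStieltjes_sub_mean hXmodel (fun a ha => pastSystem_flatField hγ_meas ha)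
      (mixingVanishes_mixingD hD_mix) (mixingVanishes_mixingField hγ_mix) hq hz)
  have hY : ∀ᵐ ω ∂P, Tendsto (fun j : ℕ => seqStieltjes ((j + 1) ^ q) z (fun k => flatArray Y k ω)
      - meanStieltjes P (flatArray Y) ((j + 1) ^ q) z) atTop (𝓝 0) := by
    have h := ae_tendsto_seqStieltjes_sub_mean hYmodel (fun a _ => pastSystem_const a)
      hW.mixingVanishes (Eventually.of_forall fun ω => mixingVanishes_of_eq_zero fun a _ n =>
        mixingField_const n ω) hq hz
    obtain ⟨ω₀, h₀⟩ := (Measure.ae_ae_of_ae_prod h).exists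
    have e : ∀ ω, prodEntry (fun _ (_ : Ω) => (1 : ℝ)) (flatArray Y) (ω₀, ω)
        = fun k => flatArray Y k ω := fun ω => funext fun k => one_mul _
    filter_upwards [h₀] with ω hω
    rwa [← e ω]
  have hXblocks := ae_smallBlocks (P := P) (X := fun k ω => flatEntry γ D ω k) hδ'
    (K := |c| ^ (2 + δ') * L₁) (by positivity)
    (fun k _ => ((measurable_flatField hγ_meas k).mul (hDm k)).aemeasurable)
    (fun k _ => lintegral_flatEntry_le hδ' hbdd hDmom k) q
  have hYblocks := ae_smallBlocks (P := P) (X := flatArray Y) hδ' hL₂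
    (fun k _ => (hW.measurable k).aemeasurable) (fun k _ => hYmom k) q
  filter_upwards [hX, hY, hXblocks, hYblocks] with ω h1 h2 h3 h4
  have h := tendsto_of_tendsto_pow hq0 hz h3 h4 (by simpa using h1.sub h2)
  simp only [seqStieltjes] at h
  refine h.congr fun n => ?_
  rw [symmetricMatrix_congr (fun i j hj hji => flatEntry_position γ D ω hj hji) n,
    symmetricMatrix_congr (fun i j hj hji => flatArray_position Y ω hj hji) n]
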